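/- **Setting.** For $\sigma>0$ and $\theta\in(0,1)$ let $\mathcal G=\{z\in\mathbb C^{\mathbb Z} : \|z\|_\sigma:=2\sum_{a\in\mathbb Z}e^{\sigma|a|^\theta}|z_a|<\infty\}$, regarded as a real normed space, and let $\mathbb B(0,s)$ be its open ball of radius $s$ centred at $0$. Let $(u,v)_{L^2}=\mathrm{Re}\sum_a u_a\overline{v_a}$. A differentiable map $\Psi$ from an open set $\mathcal O\subset\mathcal G$ to $\mathcal G$ is called symplectic if $(\mathbf i\,\mathrm d\Psi(z)v,\mathrm d\Psi(z)w)_{L^2}=(\mathbf i v,w)_{L^2}$ for all $z\in\mathcal O$ and $v,w\in\mathcal G$. For a $C^1$ function $P$ on $\mathcal O$, its Hamiltonian vector field is the sequence $(X_P(z))_a=\mathbf i\,\partial_{\overline{z_a}}P(z)$, where $2\partial_{\overline{z_a}}=\partial_{\mathrm{Re}\,z_a}+\mathbf i\,\partial_{\mathrm{Im}\,z_a}$. For $m\ge1$ let $\mathcal M_m$ be the set of $\boldsymbol j=(\delta_\alpha,a_\alpha)_{\alpha=1}^{2m}\in(\{-1,1\}\times\mathbb Z)^{2m}$ with $\sum_\alpha\delta_\alpha=0$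 and $\sum_\alpha\delta_\alpha a_\alpha=0$, and let $\mathcal R_m$ be the set of those $\boldsymbol j\in\mathcal M_m$ that also satisfy $\sum_\alpha\delta_\alpha a_\alpha^2=0$. Put $z_{(1,a)}=z_a$, $z_{(-1,a)}=\overline{z_a}$ and $z_{\boldsymbol j}=\prod_{\alpha=1}^{2m} z_{j_\alpha}$. Let $\mathcal H_m$ be the space of polynomials $P(z)=\sum_{\boldsymbol j\in\mathcal M_m}P_{\boldsymbol j}z_{\boldsymbol j}$ whose complex coefficients are invariant under permutations of the $2m$ entries of $\boldsymbol j$, satisfy $\overline{P_{\boldsymbol j}}=P_{\overline{\boldsymbol j}}$ (where $\overline{\boldsymbol j}=(-\delta_\alpha,a_\alpha)_\alpha$), and are bounded: $\|P\|_{\ell^\infty}:=\sup_{\boldsymbol j\in\mathcal M_m}|P_{\boldsymbol j}|<\infty$. Let $\mathcal H_m^{\mathcal R}$ be the subspace of those $P$ with $P_{\boldsymbol j}=0$ for $\boldsymbol j\notin\mathcal R_m$. The Hamiltonian of the Schrödinger–Poisson equation on the circle is $$H(z)=L_2(z)+\sum_{\substack{a_1+a_2=b_1+b_2\\ a_1\ne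 b_1}}\frac{1}{2(a_1-b_1)^2}\,z_{a_1}z_{a_2}\overline{z_{b_1}}\,\overline{z_{b_2}},\qquad L_2(z)=\sum_{a\in\mathbb Z}a^2|z_a|^2 .$$ **Proposition 3.1 (Bnormalform).** There exists a constant $C\ge2^8$ (independent of $\sigma$, $\theta$ and $r$) such that for all $\sigma>0$, $\theta\in(0,1)$ and all integers $r\ge2$, setting $\rho=\frac{1}{8Cr}$, there are two $C^\infty$ symplectic maps $\phi_{(0)}:\mathbb B(0,\rho)\to\mathbb B(0,2\rho)$ and $\phi_{(1)}:\mathbb B(0,2\rho)\to\mathcal G$ with $\phi_{(1)}\circ\phi_{(0)}=\mathrm{id}$ on $\mathbb B(0,\rho)$ such that on $\mathbb B(0,2\rho)$ $$H\circ\phi_{(1)}=L_2+L_4+\sum_{m=3}^rK_{2m}+R,\qquad L_4(z)=\sum_{a_1\ne a_2}\frac{1}{2(a_1-a_2)^2}|z_{a_1}|^2|z_{a_2}|^2 .$$ Here, with $K_4:=L_4$, one has $K_{2m}\in\mathcal H_m^{\mathcal R}$ and $\|K_{2m}\|_{\ell^\infty}\le C^{2m-3}m^{2(m-2)}$ for all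 $2\le m\le r$. The remainder $R:\mathbb B(0,2\rho)\to\mathbb R$ is a $C^\infty$ function whose Hamiltonian vector field takes values in $\mathcal G$ and satisfies $$\|X_R(z)\|_\sigma\le C^{4r-1}r^{2r}\|z\|_\sigma^{2r+1}\qquad\text{for all } z\in\mathbb B(0,2\rho).$$ Furthermore, for $\iota\in\{0,1\}$, $$\|\phi_{(\iota)}(z)-z\|_\sigma\le C^2\|z\|_\sigma^3\qquad\text{for all } z\in\mathbb B(0,(1+\iota)\rho).$$ -/

import Mathlib

open scoped ContDiff ComplexConjugate

noncomputable section

/-! ### The Gevrey space -/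

/-- The Gevrey weight `e^{σ |a|^θ}`. -/
def gevreyWeight (σ θ : ℝ) (a : ℤ) : ℝ := Real.exp (σ * |(a : ℝ)| ^ θ)

lemma gevreyWeight_pos (σ θ : ℝ) (a : ℤ) : 0 < gevreyWeight σ θ a := Real.exp_pos _

/-- Sequences `z : ℤ → ℂ` with `∑ₐ e^{σ |a|^θ} |zₐ| < ∞`, as a real vector space. -/
def gevreySubmodule (σ θ : ℝ) : Submodule ℝ (ℤ → ℂ) where
  carrier := {z | Summable fun a => gevreyWeight σ θ a * ‖z a‖}
  zero_mem' := by simp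
  add_mem' := by
    intro x y hx hy
    refine Summable.of_nonneg_of_le
      (fun a => mul_nonneg (gevreyWeight_pos σ θ a).le (norm_nonneg _)) (fun a => ?_) (hx.add hy)
    rw [← mul_add]
    exact mul_le_mul_of_nonneg_left (norm_add_le _ _) (gevreyWeight_pos σ θ a).le
  smul_mem' := by
    intro c x hx
    have h := Summable.mul_left |c| hx
    refine h.congr fun a => ?_
    simp only [Pi.smul_apply, norm_smul, Real.norm_eq_abs]
    ring

/-- The Gevrey space `𝒢`; it is normed below by `‖z‖_σ = 2 ∑ₐ e^{σ |a|^θ} |zₐ|`.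
(A separate type, so that it does not inherit the topology of pointwise convergence.) -/
def Gevrey (σ θ : ℝ) : Type := gevreySubmodule σ θ

namespace Gevrey

variable {σ θ : ℝ}

instance : AddCommGroup (Gevrey σ θ) := inferInstanceAs (AddCommGroup (gevreySubmodule σ θ))

instance : Module ℝ (Gevrey σ θ) := inferInstanceAs (Module ℝ (gevreySubmodule σ θ))

/-- An element of `𝒢` is the sequence of its Fourier coefficients. -/
instance : CoeFun (Gevrey σ θ) (fun _ => ℤ → ℂ) := ⟨fun z => z.1⟩

/-- `‖z‖_σ = 2 ∑ₐ e^{σ |a|^θ} |zₐ|`. -/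
instance : Norm (Gevrey σ θ) := ⟨fun z => 2 * ∑' a : ℤ, gevreyWeight σ θ a * ‖z a‖⟩

lemma norm_def (z : Gevrey σ θ) : ‖z‖ = 2 * ∑' a : ℤ, gevreyWeight σ θ a * ‖z a‖ := rfl

lemma summable (z : Gevrey σ θ) : Summable fun a => gevreyWeight σ θ a * ‖z a‖ := z.2

@[simp] lemma add_apply (x y : Gevrey σ θ) (a : ℤ) : (x + y) a = x a + y a := rfl

@[simp] lemma smul_apply (c : ℝ) (x : Gevrey σ θ) (a : ℤ) : (c • x) a = c • x a := rfl

@[simp] lemma zero_apply (a : ℤ) : (0 : Gevrey σ θ) a = 0 := rfl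

lemma normedSpaceCore : NormedSpace.Core ℝ (Gevrey σ θ) where
  norm_nonneg z := by
    rw [norm_def]
    exact mul_nonneg (by norm_num)
      (tsum_nonneg fun a => mul_nonneg (gevreyWeight_pos σ θ a).le (norm_nonneg _))
  norm_smul c z := by
    have h : ∀ a, gevreyWeight σ θ a * ‖(c • z) a‖ = ‖c‖ * (gevreyWeight σ θ a * ‖z a‖) := by
      intro a
      rw [smul_apply, norm_smul]
      ring
    simp only [norm_def, h, tsum_mul_left]
    ring
  norm_triangle x y := by
    simp only [norm_def]
    rw [← mul_add, ← (summable x).tsum_add (summable y)]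
    refine mul_le_mul_of_nonneg_left ?_ (by norm_num)
    refine (summable (x + y)).tsum_le_tsum (fun a => ?_) ((summable x).add (summable y))
    rw [← mul_add]
    exact mul_le_mul_of_nonneg_left (norm_add_le _ _) (gevreyWeight_pos σ θ a).le
  norm_eq_zero_iff z := by
    constructor
    · intro h
      rw [norm_def] at h
      have h0 : ∑' a : ℤ, gevreyWeight σ θ a * ‖z a‖ = 0 := by linarith
      have h1 := (hasSum_zero_iff_of_nonneg
        (fun a => mul_nonneg (gevreyWeight_pos σ θ a).le (norm_nonneg (z a)))).1
        (h0 ▸ (summable z).hasSum)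
      refine Subtype.ext (funext fun a => ?_)
      have h2 := congrFun h1 a
      simp only [Pi.zero_apply, mul_eq_zero, norm_eq_zero] at h2
      exact h2.resolve_left (gevreyWeight_pos σ θ a).ne'
    · rintro rfl
      simp [norm_def]

instance : NormedAddCommGroup (Gevrey σ θ) := NormedAddCommGroup.ofCore normedSpaceCore

instance : NormedSpace ℝ (Gevrey σ θ) := NormedSpace.ofCore normedSpaceCore

/-- The sequence with the single Fourier coefficient `c` at the frequency `a`. -/
def single (a : ℤ) (c : ℂ) : Gevrey σ θ :=
  ⟨Pi.single a c, by
    refine summable_of_ne_finset_zero (s := {a}) fun b hb => ?_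
    have : b ≠ a := by simpa using hb
    simp [this]⟩

/-! ### Differential calculus and symplectic structure -/

/-- `∂_{\bar zₐ} P = (∂_{Re zₐ} P + i ∂_{Im zₐ} P) / 2`. -/
def dzbar (P : Gevrey σ θ → ℂ) (z : Gevrey σ θ) (a : ℤ) : ℂ :=
  (fderiv ℝ P z (single a 1) + Complex.I * fderiv ℝ P z (single a Complex.I)) / 2

/-- The Hamiltonian vector field, `(X_P(z))ₐ = i ∂_{\bar zₐ} P(z)`, a priori only a sequence. -/
def hamVF (P : Gevrey σ θ → ℂ) (z : Gevrey σ θ) : ℤ → ℂ :=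
  fun a => Complex.I * dzbar P z a

/-- The real `L²` scalar product `Re ∑ₐ uₐ \bar vₐ`. -/
def l2Inner (u v : ℤ → ℂ) : ℝ := (∑' a : ℤ, u a * conj (v a)).re

/-- `Ψ` is symplectic on `O`: `(i dΨ(z)v, dΨ(z)w) = (i v, w)` for `z ∈ O` and `v, w ∈ 𝒢`. -/
def IsSymplecticOn (Ψ : Gevrey σ θ → Gevrey σ θ) (O : Set (Gevrey σ θ)) : Prop :=
  ∀ z ∈ O, ∀ v w : Gevrey σ θ,
    l2Inner (fun a => Complex.I * (fderiv ℝ Ψ z v) a) (fderiv ℝ Ψ z w)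
      = l2Inner (fun a => Complex.I * v a) w

end Gevrey

/-! ### Multi-indices and polynomials -/

/-- Multi-indices of length `2m` with entries `(δ, a) ∈ {-1, 1} × ℤ`. -/
abbrev MIdx (m : ℕ) : Type := Fin (2 * m) → ℤˣ × ℤ

/-- The conjugate multi-index: `(δ, a) ↦ (-δ, a)` in each entry. -/
def MIdx.conj {m : ℕ} (j : MIdx m) : MIdx m := fun α => (-(j α).1, (j α).2)

/-- `𝓜ₘ`: the multi-indices with `∑ δ_α = 0` and `∑ δ_α a_α = 0`. -/
def momentumSet (m : ℕ) : Set (MIdx m) :=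
  {j | ∑ α, ((j α).1 : ℤ) = 0 ∧ ∑ α, ((j α).1 : ℤ) * (j α).2 = 0}

/-- `𝓡ₘ`: the `j ∈ 𝓜ₘ` with `∑ δ_α a_α² = 0`. -/
def resonantSet (m : ℕ) : Set (MIdx m) :=
  {j | j ∈ momentumSet m ∧ ∑ α, ((j α).1 : ℤ) * (j α).2 ^ 2 = 0}

/-- `z_{(1, a)} = zₐ` and `z_{(-1, a)} = \bar zₐ`. -/
def signedCoord (z : ℤ → ℂ) (j : ℤˣ × ℤ) : ℂ := if j.1 = 1 then z j.2 else conj (z j.2)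

/-- The monomial `z_j = z_{j₁} ⋯ z_{j_{2m}}`. -/
def monomialEval {m : ℕ} (z : ℤ → ℂ) (j : MIdx m) : ℂ := ∏ α, signedCoord z (j α)

/-- The space `𝓗ₘ` of homogeneous polynomials of degree `2m`, given by their coefficients on `𝓜ₘ`
(extended by zero to all multi-indices). -/
structure HPoly (m : ℕ) where
  coeff : MIdx m → ℂ
  support : ∀ j, j ∉ momentumSet m → coeff j = 0
  reality : ∀ j, conj (coeff j) = coeff j.conj
  symmetry : ∀ (j : MIdx m) (φ : Equiv.Perm (Fin (2 * m))), coeff (j ∘ φ) = coeff j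
  bounded : BddAbove (Set.range fun j => ‖coeff j‖)

namespace HPoly

variable {m : ℕ}

/-- `P(z) = ∑_{j ∈ 𝓜ₘ} P_j z_j`. -/
def eval (P : HPoly m) (z : ℤ → ℂ) : ℂ := ∑' j : momentumSet m, P.coeff j * monomialEval z j.1

/-- `‖P‖_{ℓ^∞} = sup_{j ∈ 𝓜ₘ} |P_j|`. -/
def supNorm (P : HPoly m) : ℝ := ⨆ j : momentumSet m, ‖P.coeff j‖

/-- `P` is resonant: `P_j ≠ 0` only if `j` is resonant. -/
def IsResonant (P : HPoly m) : Prop := ∀ j, P.coeff j ≠ 0 → j ∈ resonantSet m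

end HPoly

/-! ### The Schrödinger–Poisson Hamiltonian -/

namespace NLSP

/-- `L₂(z) = ∑ₐ a² |zₐ|²`. -/
def L2 (z : ℤ → ℂ) : ℝ := ∑' a : ℤ, (a : ℝ) ^ 2 * ‖z a‖ ^ 2

/-- The quadruples `(a₁, a₂, b₁, b₂)` with `a₁ + a₂ = b₁ + b₂` and `a₁ ≠ b₁`. -/
def quartets : Set (ℤ × ℤ × ℤ × ℤ) :=
  {(a₁, a₂, b₁, b₂) : ℤ × ℤ × ℤ × ℤ | a₁ + a₂ = b₁ + b₂ ∧ a₁ ≠ b₁}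

/-- `P₄(z) = ∑ z_{a₁} z_{a₂} \bar z_{b₁} \bar z_{b₂} / (2 (a₁ - b₁)²)` over the quadruples above. -/
def P4 (z : ℤ → ℂ) : ℂ :=
  ∑' q : quartets, match q.1 with
    | (a₁, a₂, b₁, b₂) =>
      1 / (2 * ((a₁ : ℂ) - (b₁ : ℂ)) ^ 2) * z a₁ * z a₂ * conj (z b₁) * conj (z b₂)

/-- The Hamiltonian `H = L₂ + P₄`. -/
def H (z : ℤ → ℂ) : ℂ := (L2 z : ℂ) + P4 z

/-- `L₄(z) = ∑_{a₁ ≠ a₂} |z_{a₁}|² |z_{a₂}|² / (2 (a₁ - a₂)²)`. -/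
def L4 (z : ℤ → ℂ) : ℝ :=
  ∑' p : {p : ℤ × ℤ // p.1 ≠ p.2},
    1 / (2 * ((p.1.1 : ℝ) - (p.1.2 : ℝ)) ^ 2) * ‖z p.1.1‖ ^ 2 * ‖z p.1.2‖ ^ 2

end NLSP

end

noncomputable section

/-! ### Basic structure of the Gevrey space -/

/-! The normal form comes from one Lie transform. Give degree `2p + 2` the order `p` and put `n = r
- 1`. A time-independent generator `χ = χ₁ + ... + χₙ` is sought; `φ₁` is the time-one flow of its
Hamiltonian field `X_χ`, and `φ₀` is that of `-X_χ`.

Algebra. Taylor expansion of the Hamiltonian along the flow writes `H ∘ φ₁` as `L₂` plus components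
`transformed χ p`. Deriving along `X_χ` raises the order by at least one, so `χ_p` enters the order
`p` only through the derivative of `L₂`, which multiplies the monomial `z_j` by `-i ∑ δ_α a_α²`.
Everything else at that order (`obstruction`) involves only `χ_q` with `q < p`. The system is
therefore triangular: dividing by the divisor removes the nonresonant part order by order, and the
resonant part remains (`transformed_eq`, `obstruction_congr`, `transformed_truncGen`). At order one
the only resonances are pairings, which gives `L₄`.

Estimates. A nonzero divisor is an integer, so division costs nothing (`norm_solve_le`). A bracket
of orders `a`, `b` costs `8 (a + 1)(b + 1)` in sup norm. With the majorant `∑_{p ≤ N} ‖Q_p‖ x^p` and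
`x = 1 / (64 (N + 1)²)`, derivation along `χ` contracts by `1/8`, and induction on the order bounds
the obstruction by `x` (`wnorm_obstruction_truncGen_le`). Taking `N = p` gives `‖K_{2m}‖ ≤ (64
m²)^(m - 2)`. For the whole series `x = 1 / (64 r²)` is kept fixed, and the `k!` of the Taylor
coefficients absorbs the factors `(p + 1)^k` (`norm_iterate_le`). This gives convergence as soon as
`64 r² ‖z‖²` is small, that is for `‖z‖` of size `1 / r`.

Analysis. The Gevrey weight is submultiplicative and momentum is conserved, so a polynomial with
bounded coefficients has a smooth field on `𝒢`, with bounds free of `σ` and `θ` (`norm_vf_le`). The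
weight also dominates `a²`, so `L₂` is smooth on `𝒢`; the constant there depends on `σ` and `θ` but
is used only qualitatively. The flow is obtained by inverting `γ ↦ γ - ∫ X(γ)` on the Banach space
of curves, which yields smooth dependence on the initial point (`exists_curve`). Symplecticity is
the symmetry of the Hessian of `χ` carried along the variational equation. The components of order
above `n` sum to the remainder, whose field is computed term by term (`exists_remainder_field`). -/

lemma one_le_gevreyWeight {σ θ : ℝ} (hσ : 0 < σ) (a : ℤ) : 1 ≤ gevreyWeight σ θ a :=
  Real.one_le_exp (mul_nonneg hσ.le (Real.rpow_nonneg (abs_nonneg _) _))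

lemma gevreyWeight_neg (σ θ : ℝ) (a : ℤ) : gevreyWeight σ θ (-a) = gevreyWeight σ θ a := by
  simp [gevreyWeight]

/-- Subadditivity of `t ↦ t ^ θ` for `θ ≤ 1`. Through it, bounded coefficients with conserved
momentum define bounded vector fields, uniformly in `σ` and `θ`. -/
lemma gevreyWeight_add_le {σ θ : ℝ} (hσ : 0 < σ) (hθ : 0 < θ) (hθ1 : θ < 1) (a b : ℤ) :
    gevreyWeight σ θ (a + b) ≤ gevreyWeight σ θ a * gevreyWeight σ θ b := by
  unfold gevreyWeight
  rw [← Real.exp_add, Real.exp_le_exp, ← mul_add]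
  refine mul_le_mul_of_nonneg_left ?_ hσ.le
  push_cast
  calc |(a : ℝ) + b| ^ θ ≤ (|(a : ℝ)| + |(b : ℝ)|) ^ θ :=
        Real.rpow_le_rpow (abs_nonneg _) (abs_add_le _ _) hθ.le
    _ ≤ |(a : ℝ)| ^ θ + |(b : ℝ)| ^ θ :=
        Real.rpow_add_le_add_rpow (abs_nonneg _) (abs_nonneg _) hθ.le hθ1.le

lemma gevreyWeight_sum_le {σ θ : ℝ} (hσ : 0 < σ) (hθ : 0 < θ) (hθ1 : θ < 1) {ι : Type*}
    (s : Finset ι) (f : ι → ℤ) :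
    gevreyWeight σ θ (∑ i ∈ s, f i) ≤ ∏ i ∈ s, gevreyWeight σ θ (f i) := by
  classical
  induction s using Finset.induction_on with
  | empty => simp [gevreyWeight, Real.zero_rpow hθ.ne']
  | insert i s hi ih =>
    rw [Finset.sum_insert hi, Finset.prod_insert hi]
    exact (gevreyWeight_add_le hσ hθ hθ1 _ _).trans
      (mul_le_mul_of_nonneg_left ih (gevreyWeight_pos _ _ _).le)

/-- A stretched exponential beats every power: one term `x ^ n / n!` of the exponential series with
`n θ ≥ 2` suffices. It makes `L₂` a continuous polynomial on `𝒢`; its constant never enters a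
quantitative bound. -/
lemma exists_sq_le_gevreyWeight {σ θ : ℝ} (hσ : 0 < σ) (hθ : 0 < θ) :
    ∃ B : ℝ, 0 ≤ B ∧ ∀ a : ℤ, (a : ℝ) ^ 2 ≤ B * gevreyWeight σ θ a := by
  obtain ⟨n, hn⟩ := exists_nat_ge (2 / θ)
  refine ⟨1 + n.factorial / σ ^ n, by positivity, fun a => ?_⟩
  have hw := one_le_gevreyWeight (θ := θ) hσ a
  rcases eq_or_ne a 0 with rfl | ha
  · simp; positivity
  have h1 : (1 : ℝ) ≤ |(a : ℝ)| := by exact_mod_cast Int.one_le_abs ha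
  have hpos : 0 ≤ |(a : ℝ)| ^ θ := Real.rpow_nonneg (abs_nonneg _) _
  have h2 : (a : ℝ) ^ 2 ≤ (|(a : ℝ)| ^ θ) ^ n := by
    rw [← sq_abs, ← Real.rpow_natCast, ← Real.rpow_natCast (_ ^ θ), ← Real.rpow_mul (abs_nonneg _)]
    refine Real.rpow_le_rpow_of_exponent_le h1 ?_
    rw [div_le_iff₀ hθ] at hn
    push_cast
    linarith
  have h3 := Real.pow_div_factorial_le_exp (x := σ * |(a : ℝ)| ^ θ) (by positivity) n
  have h4 : (|(a : ℝ)| ^ θ) ^ n ≤ n.factorial / σ ^ n * gevreyWeight σ θ a := by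
    rw [div_le_iff₀ (by positivity), mul_pow] at h3
    rw [div_mul_eq_mul_div, le_div_iff₀ (by positivity)]
    unfold gevreyWeight
    linarith
  nlinarith

namespace Gevrey

variable {σ θ : ℝ}

@[ext] lemma ext {x y : Gevrey σ θ} (h : ∀ a, x a = y a) : x = y := Subtype.ext (funext h)

lemma weight_mul_norm_le (z : Gevrey σ θ) (a : ℤ) : 2 * (gevreyWeight σ θ a * ‖z a‖) ≤ ‖z‖ := by
  rw [norm_def]
  exact mul_le_mul_of_nonneg_left ((summable z).le_tsum a fun b _ =>
    mul_nonneg (gevreyWeight_pos σ θ b).le (norm_nonneg _)) (by norm_num)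

lemma norm_single (a : ℤ) (c : ℂ) : ‖(single a c : Gevrey σ θ)‖ = 2 * gevreyWeight σ θ a * ‖c‖ := by
  rw [norm_def, tsum_eq_single a]
  · simp [single, mul_assoc]
  · intro b hb
    simp [single, hb]

lemma single_apply (a b : ℤ) (c : ℂ) : (single a c : Gevrey σ θ) b = if b = a then c else 0 := by
  simp [single, Pi.single_apply]

/-- The coordinate `z ↦ zₐ`. -/
def coordL (hσ : 0 < σ) (a : ℤ) : Gevrey σ θ →L[ℝ] ℂ :=
  LinearMap.mkContinuous
    { toFun := fun z => z a
      map_add' := fun _ _ => rfl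
      map_smul' := fun _ _ => rfl } 1 (fun z => by
        have h1 := weight_mul_norm_le z a
        have h2 := one_le_gevreyWeight (θ := θ) hσ a
        have h3 := norm_nonneg (z a)
        change ‖z a‖ ≤ 1 * ‖z‖
        nlinarith)

@[simp] lemma coordL_apply (hσ : 0 < σ) (a : ℤ) (z : Gevrey σ θ) : coordL hσ a z = z a := rfl

/-- The inclusion of one Fourier mode. -/
def singleL (a : ℤ) : ℂ →L[ℝ] Gevrey σ θ :=
  LinearMap.mkContinuous
    { toFun := fun c => single a c
      map_add' := fun c d => by ext b; simp only [single_apply, add_apply]; split_ifs <;> simp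
      map_smul' := fun c d => by
        ext b; simp only [single_apply, smul_apply, RingHom.id_apply]; split_ifs <;> simp }
    (2 * gevreyWeight σ θ a) (fun c => (norm_single a c).le)

lemma norm_singleL_le (a : ℤ) : ‖(singleL a : ℂ →L[ℝ] Gevrey σ θ)‖ ≤ 2 * gevreyWeight σ θ a :=
  LinearMap.mkContinuous_norm_le _ (by have := gevreyWeight_pos σ θ a; positivity) _

/-- The Gevrey space is isometric to `ℓ¹(ℤ, ℂ)`. -/
def toLp : Gevrey σ θ ≃ₗᵢ[ℝ] lp (fun _ : ℤ => ℂ) 1 where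
  toFun z := ⟨fun a => (2 * gevreyWeight σ θ a : ℝ) • z a, by
    refine (memℓp_gen_iff (by norm_num)).2 ?_
    refine ((summable z).mul_left 2).congr fun a => ?_
    have := gevreyWeight_pos σ θ a
    simp only [ENNReal.toReal_one, Real.rpow_one, norm_smul, Real.norm_eq_abs]
    rw [abs_of_pos (by positivity)]
    ring⟩
  invFun f := ⟨fun a => (2 * gevreyWeight σ θ a : ℝ)⁻¹ • f a, by
    have h := lp.memℓp f
    rw [memℓp_gen_iff (by norm_num)] at h
    refine (h.mul_left (1 / 2)).congr fun a => ?_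
    have := gevreyWeight_pos σ θ a
    simp only [ENNReal.toReal_one, Real.rpow_one, norm_smul, Real.norm_eq_abs]
    rw [abs_of_pos (by positivity)]
    field_simp⟩
  left_inv z := by
    ext a
    have := gevreyWeight_pos σ θ a
    simp only [smul_smul]
    rw [inv_mul_cancel₀ (by positivity), one_smul]
  right_inv f := by
    ext a
    have := gevreyWeight_pos σ θ a
    simp only [smul_smul]
    rw [mul_inv_cancel₀ (by positivity), one_smul]
  map_add' x y := by ext a; exact smul_add _ (x a) (y a)
  map_smul' c x := by ext a; exact smul_comm _ c (x a)
  norm_map' z := by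
    rw [lp.norm_eq_tsum_rpow (by norm_num), norm_def, ← tsum_mul_left]
    simp only [ENNReal.toReal_one, Real.rpow_one, div_one]
    refine tsum_congr fun a => ?_
    have := gevreyWeight_pos σ θ a
    change ‖(2 * gevreyWeight σ θ a : ℝ) • z a‖ = 2 * (gevreyWeight σ θ a * ‖z a‖)
    rw [norm_smul, Real.norm_eq_abs, abs_of_pos (by positivity)]
    ring

instance : CompleteSpace (Gevrey σ θ) :=
  (completeSpace_congr (e := (toLp (σ := σ) (θ := θ)).toEquiv)
    toLp.isometry.isUniformEmbedding).2 inferInstance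

end Gevrey
end

noncomputable section

/-! ### Flows of small vector fields on a Banach space -/

section Flow

variable {E : Type*} [NormedAddCommGroup E]

/-- A curve on the unit interval, extended to the real line by constants. -/
def extendCurve (γ : C(unitInterval, E)) (t : ℝ) : E := γ (Set.projIcc 0 1 zero_le_one t)

lemma continuous_extendCurve (γ : C(unitInterval, E)) : Continuous (extendCurve γ) :=
  γ.continuous.comp continuous_projIcc

lemma extendCurve_of_mem (γ : C(unitInterval, E)) {t : ℝ} (ht : t ∈ Set.Icc (0 : ℝ) 1) :
    extendCurve γ t = γ ⟨t, ht⟩ := by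
  rw [extendCurve, Set.projIcc_of_mem]

lemma norm_extendCurve_le (γ : C(unitInterval, E)) (t : ℝ) : ‖extendCurve γ t‖ ≤ ‖γ‖ :=
  γ.norm_coe_le_norm _

lemma curve_mem_ball {S : ℝ} {γ : C(unitInterval, E)} (hγ : γ ∈ Metric.ball (0 : C(unitInterval, E)) S) (t : unitInterval) :
    γ t ∈ Metric.ball (0 : E) S := by
  rw [mem_ball_zero_iff] at hγ ⊢
  exact (γ.norm_coe_le_norm t).trans_lt hγ

variable [NormedSpace ℝ E]

/-- The operator `γ ↦ (t ↦ ∫₀ᵗ γ)` on curves. -/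
def primitiveL : C(unitInterval, E) →L[ℝ] C(unitInterval, E) :=
  LinearMap.mkContinuous
    { toFun := fun γ => ⟨fun t => ∫ s in (0 : ℝ)..t, extendCurve γ s,
        (intervalIntegral.continuous_primitive
          (fun _ _ => (continuous_extendCurve γ).intervalIntegrable _ _) 0).comp
          continuous_subtype_val⟩
      map_add' := fun γ η => by
        ext t
        exact intervalIntegral.integral_add ((continuous_extendCurve γ).intervalIntegrable _ _)
          ((continuous_extendCurve η).intervalIntegrable _ _)
      map_smul' := fun c γ => by
        ext t
        exact intervalIntegral.integral_smul c (extendCurve γ) } 1 (fun γ => by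
      rw [ContinuousMap.norm_le _ (by positivity)]
      intro t
      refine (intervalIntegral.norm_integral_le_of_norm_le_const
        (fun s _ => norm_extendCurve_le γ s)).trans ?_
      rw [sub_zero, abs_of_nonneg t.2.1, mul_comm]
      exact mul_le_mul_of_nonneg_right t.2.2 (norm_nonneg _))

lemma primitiveL_apply (γ : C(unitInterval, E)) (t : unitInterval) :
    primitiveL γ t = ∫ s in (0 : ℝ)..t, extendCurve γ s := rfl

lemma norm_primitiveL_le (γ : C(unitInterval, E)) : ‖primitiveL γ‖ ≤ ‖γ‖ := by
  have := (primitiveL (E := E)).le_of_opNorm_le (LinearMap.mkContinuous_norm_le _ zero_le_one _) γ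
  simpa using this

/-- Points as constant curves. -/
def constCurve : E →L[ℝ] C(unitInterval, E) :=
  LinearMap.mkContinuous
    { toFun := fun x => ContinuousMap.const unitInterval x
      map_add' := fun _ _ => rfl
      map_smul' := fun _ _ => rfl } 1 (fun x => by
        rw [one_mul]
        exact (ContinuousMap.norm_le _ (norm_nonneg _)).2 fun t => le_rfl)

/-- If `γ = x + ∫ η`, then `γ` is differentiable with derivative `η`. -/
lemma hasDerivWithinAt_extendCurve [CompleteSpace E] {γ η : C(unitInterval, E)} {x : E}
    (h : γ = ContinuousMap.const unitInterval x + primitiveL η) {t : ℝ} (ht : t ∈ Set.Icc (0 : ℝ) 1) :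
    HasDerivWithinAt (extendCurve γ) (extendCurve η t) (Set.Icc 0 1) t := by
  have h1 : HasDerivAt (fun t => x + ∫ s in (0 : ℝ)..t, extendCurve η s) (extendCurve η t) t :=
    (((continuous_extendCurve η).integral_hasStrictDerivAt 0 t).hasDerivAt).const_add x
  refine h1.hasDerivWithinAt.congr (fun s hs => ?_) ?_
  · rw [extendCurve_of_mem γ hs, h]; rfl
  · rw [extendCurve_of_mem γ ht, h]; rfl

/-- A vector field `X` that lifts to a smooth map `Xh` on curves, vanishes at `0`, and is a
contraction on the ball of radius `S`. -/
structure SmallField (X : E → E) (Xh : C(unitInterval, E) → C(unitInterval, E)) (S : ℝ) : Prop where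
  pos : 0 < S
  lift : ∀ γ t, Xh γ t = X (γ t)
  smooth : ContDiff ℝ ∞ X
  smooth_lift : ContDiff ℝ ∞ Xh
  zero : X 0 = 0
  contract : ∀ x ∈ Metric.ball (0 : E) S, ∀ y ∈ Metric.ball (0 : E) S,
    ‖X x - X y‖ ≤ 1 / 2 * ‖x - y‖

namespace SmallField

variable {X : E → E} {Xh : C(unitInterval, E) → C(unitInterval, E)} {S : ℝ}

lemma extend_lift (h : SmallField X Xh S) (γ : C(unitInterval, E)) (t : ℝ) :
    extendCurve (Xh γ) t = X (extendCurve γ t) := h.lift _ _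

/-- The integral equation is a `1/2`-Lipschitz perturbation of the identity on a ball of curves.
Existence, uniqueness and smoothness of the flow up to time one all follow from this. -/
lemma approximates (h : SmallField X Xh S) :
    ApproximatesLinearOn (fun γ => γ - primitiveL (Xh γ))
      (ContinuousLinearEquiv.refl ℝ C(unitInterval, E) : C(unitInterval, E) →L[ℝ] C(unitInterval, E))
      (Metric.ball 0 S) (1 / 2) := by
  intro γ hγ η hη
  have : γ - primitiveL (Xh γ) - (η - primitiveL (Xh η)) - (γ - η)
      = -primitiveL (Xh γ - Xh η) := by rw [map_sub]; abel
  simp only [ContinuousLinearEquiv.coe_refl, ContinuousLinearMap.coe_id', id_eq]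
  rw [this, norm_neg]
  refine (norm_primitiveL_le _).trans ?_
  rw [ContinuousMap.norm_le _ (by positivity)]
  intro t
  rw [ContinuousMap.sub_apply, h.lift, h.lift]
  refine (h.contract _ (curve_mem_ball hγ t) _ (curve_mem_ball hη t)).trans ?_
  have := (γ - η).norm_coe_le_norm t
  rw [ContinuousMap.sub_apply] at this
  push_cast
  linarith

lemma lift_zero (h : SmallField X Xh S) : Xh 0 = 0 := by
  ext t; rw [h.lift]; exact h.zero

/-- Comparison with the zero curve, which solves the equation because the field vanishes at `0`. -/
lemma norm_le_two_mul (h : SmallField X Xh S) {γ : C(unitInterval, E)} {x : E}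
    (hγ : γ ∈ Metric.ball (0 : C(unitInterval, E)) S)
    (hx : γ - primitiveL (Xh γ) = ContinuousMap.const unitInterval x) : ‖γ‖ ≤ 2 * ‖x‖ := by
  have h1 := h.approximates γ hγ 0 (Metric.mem_ball_self h.pos)
  simp only [h.lift_zero, map_zero, sub_zero, ContinuousLinearEquiv.coe_refl,
    ContinuousLinearMap.coe_id', id_eq] at h1
  rw [hx] at h1
  have h2 : ‖ContinuousMap.const unitInterval x‖ ≤ ‖x‖ :=
    (ContinuousMap.norm_le _ (norm_nonneg _)).2 fun t => le_rfl
  have h3 : ‖γ‖ - ‖ContinuousMap.const unitInterval x‖ ≤ ‖ContinuousMap.const unitInterval x - γ‖ := by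
    rw [norm_sub_rev]; exact norm_sub_norm_le _ _
  push_cast at h1
  linarith

lemma unique (h : SmallField X Xh S) {γ η : C(unitInterval, E)} {x : E}
    (hγ : γ ∈ Metric.ball (0 : C(unitInterval, E)) S) (hη : η ∈ Metric.ball (0 : C(unitInterval, E)) S)
    (hx : γ - primitiveL (Xh γ) = ContinuousMap.const unitInterval x)
    (hy : η - primitiveL (Xh η) = ContinuousMap.const unitInterval x) : γ = η := by
  have h1 := h.approximates γ hγ η hη
  simp only [hx, hy, ContinuousLinearEquiv.coe_refl, ContinuousLinearMap.coe_id', id_eq, sub_self,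
    zero_sub, norm_neg] at h1
  push_cast at h1
  have h2 := norm_nonneg (γ - η)
  exact sub_eq_zero.1 (norm_eq_zero.1 (by linarith))

/-- Solving the differential equation for all initial points at once means inverting `γ ↦ γ - ∫
X(γ)` near the constant curves. The quantitative inverse function theorem provides the domain, and
smoothness of the inverse is smooth dependence on the initial point. -/
lemma exists_curve [CompleteSpace E] (h : SmallField X Xh S) :
    ∃ Γ : E → C(unitInterval, E), ContDiffOn ℝ ∞ Γ (Metric.ball 0 (S / 2)) ∧
      ∀ x ∈ Metric.ball (0 : E) (S / 2), Γ x ∈ Metric.ball (0 : C(unitInterval, E)) S ∧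
        Γ x - primitiveL (Xh (Γ x)) = ContinuousMap.const unitInterval x := by
  -- The identity has norm one only on a nontrivial space.
  rcases subsingleton_or_nontrivial E with hE | hE
  · refine ⟨fun _ => 0, contDiffOn_const, fun x _ => ⟨Metric.mem_ball_self h.pos, ?_⟩⟩
    ext t
    exact Subsingleton.elim _ _
  have hN : ‖((ContinuousLinearEquiv.refl ℝ C(unitInterval, E)).symm : C(unitInterval, E) →L[ℝ] C(unitInterval, E))‖₊ = 1 := by
    rw [← NNReal.coe_inj, coe_nnnorm]
    exact ContinuousLinearMap.norm_id
  have hc : Subsingleton C(unitInterval, E) ∨ (1 / 2 : NNReal) <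
      ‖((ContinuousLinearEquiv.refl ℝ C(unitInterval, E)).symm : C(unitInterval, E) →L[ℝ] C(unitInterval, E))‖₊⁻¹ := by
    right
    rw [hN, inv_one, ← NNReal.coe_lt_coe]
    norm_num
  set e := h.approximates.toOpenPartialHomeomorph _ _ hc Metric.isOpen_ball with he
  have hsource : e.source = Metric.ball 0 S := rfl
  have hmem : ∀ x ∈ Metric.ball (0 : E) (S / 2), ContinuousMap.const unitInterval x ∈ e.target := by
    intro x hx
    rw [mem_ball_zero_iff] at hx
    have hsub : Metric.closedBall (0 : C(unitInterval, E)) (2 * ‖x‖) ⊆ Metric.ball 0 S :=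
      Metric.closedBall_subset_ball (by linarith)
    -- The image of the ball of radius `2‖x‖` contains the ball of radius `(1 - 1/2) · 2‖x‖ = ‖x‖`,
    -- hence the constant curve `x`; this is why the initial points fill radius `S / 2`.
    refine h.approximates.closedBall_subset_target hc Metric.isOpen_ball (by positivity) hsub ?_
    rw [hN, h.lift_zero, map_zero, sub_zero, mem_closedBall_zero_iff]
    refine (ContinuousMap.norm_le _ (by norm_num)).2 fun t => ?_
    change ‖x‖ ≤ _
    push_cast
    linarith
  have hsmooth : ContDiff ℝ ∞ (fun γ => primitiveL (Xh γ)) :=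
    (primitiveL (E := E)).contDiff.comp h.smooth_lift
  refine ⟨fun x => e.symm (ContinuousMap.const unitInterval x), fun x hx => ?_, fun x hx => ⟨?_, ?_⟩⟩
  · refine ContDiffAt.contDiffWithinAt ?_
    have hconst : ContDiff ℝ ∞ (fun x : E => ContinuousMap.const unitInterval x) :=
      (constCurve (E := E)).contDiff
    refine ContDiffAt.comp x ?_ hconst.contDiffAt
    set γ := e.symm (ContinuousMap.const unitInterval x) with hγ
    have hγS : γ ∈ Metric.ball (0 : C(unitInterval, E)) S := e.map_target (hmem x hx)
    have hd := (hsmooth.differentiable (by simp)).differentiableAt (x := γ) |>.hasFDerivAt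
    -- The Lipschitz constant `1/2` bounds the derivative, so identity minus it is invertible by a
    -- Neumann series and the inverse map is smooth.
    have hnorm : ‖fderiv ℝ (fun γ => primitiveL (Xh γ)) γ‖ < 1 := by
      have hlip : LipschitzOnWith (1 / 2) (fun γ => primitiveL (Xh γ)) (Metric.ball 0 S) := by
        refine LipschitzOnWith.of_dist_le_mul fun γ hγ η hη => ?_
        have := h.approximates γ hγ η hη
        simp only [ContinuousLinearEquiv.coe_refl, ContinuousLinearMap.coe_id', id_eq] at this
        rw [dist_eq_norm, dist_eq_norm, ← norm_neg]
        have hab : ∀ a b c d : C(unitInterval, E), -(c - d) = a - c - (b - d) - (a - b) := by intros; abel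
        rwa [hab γ η]
      have := hd.le_of_lipschitzOn (Metric.isOpen_ball.mem_nhds hγS) hlip
      refine this.trans_lt ?_
      norm_num
    let u : (C(unitInterval, E) →L[ℝ] C(unitInterval, E))ˣ :=
      Units.oneSub (R := C(unitInterval, E) →L[ℝ] C(unitInterval, E)) _ hnorm
    have hfd : HasFDerivAt e (ContinuousLinearEquiv.ofUnit u : C(unitInterval, E) →L[ℝ] C(unitInterval, E)) γ := by
      have := (hasFDerivAt_id γ).sub hd
      exact this
    exact e.contDiffAt_symm (hmem x hx) hfd (contDiff_id.sub hsmooth).contDiffAt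
  · exact e.map_target (hmem x hx)
  · exact e.right_inv (hmem x hx)

lemma norm_sub_le_of_bound (h : SmallField X Xh S) {γ : C(unitInterval, E)} {x : E} {B : ℝ} (hB : 0 ≤ B)
    (hb : ∀ t, ‖X (γ t)‖ ≤ B)
    (hx : γ - primitiveL (Xh γ) = ContinuousMap.const unitInterval x) (t : unitInterval) : ‖γ t - x‖ ≤ B := by
  have h1 : γ t - x = primitiveL (Xh γ) t := by
    have := congrArg (fun η : C(unitInterval, E) => η t) hx
    simp only [ContinuousMap.sub_apply, ContinuousMap.const_apply] at this
    rw [← this]; abel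
  rw [h1]
  refine ((primitiveL (Xh γ)).norm_coe_le_norm t).trans ((norm_primitiveL_le _).trans ?_)
  exact (ContinuousMap.norm_le _ hB).2 fun t => by rw [h.lift]; exact hb t

lemma hasDerivWithinAt [CompleteSpace E] (h : SmallField X Xh S) {γ : C(unitInterval, E)} {x : E}
    (hx : γ - primitiveL (Xh γ) = ContinuousMap.const unitInterval x) {t : ℝ} (ht : t ∈ Set.Icc (0 : ℝ) 1) :
    HasDerivWithinAt (extendCurve γ) (X (extendCurve γ t)) (Set.Icc 0 1) t := by
  rw [← h.extend_lift]
  exact hasDerivWithinAt_extendCurve (sub_eq_iff_eq_add.1 hx) ht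

/-- A curve that is an integral curve of `X` on `[0, 1]` solves the integral equation. -/
lemma integral_eq [CompleteSpace E] (h : SmallField X Xh S) {γ : C(unitInterval, E)}
    (hγ : ∀ t ∈ Set.Icc (0 : ℝ) 1,
      HasDerivWithinAt (extendCurve γ) (X (extendCurve γ t)) (Set.Icc 0 1) t) :
    γ - primitiveL (Xh γ) = ContinuousMap.const unitInterval (γ 0) := by
  ext t
  rw [ContinuousMap.sub_apply, primitiveL_apply, ContinuousMap.const_apply,
    intervalIntegral.integral_eq_sub_of_hasDerivAt_of_le (f := extendCurve γ) t.2.1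
      (continuous_extendCurve γ).continuousOn]
  · rw [extendCurve_of_mem γ t.2, extendCurve_of_mem γ ⟨le_rfl, zero_le_one⟩]
    exact sub_sub_cancel _ _
  · intro s hs
    rw [h.extend_lift]
    have hs' : s ∈ Set.Ioo (0 : ℝ) 1 := ⟨hs.1, hs.2.trans_le t.2.2⟩
    exact (hγ s (Set.Ioo_subset_Icc_self hs')).hasDerivAt (Icc_mem_nhds hs'.1 hs'.2)
  · exact (continuous_extendCurve _).intervalIntegrable _ _

/-- Running the flow of `-X` and then the flow of `X` gives the identity. -/
lemma reverse [CompleteSpace E] {Xh' : C(unitInterval, E) → C(unitInterval, E)} (h : SmallField X Xh S)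
    (h' : SmallField (fun x => -X x) Xh' S) {γ η : C(unitInterval, E)} {x : E}
    (hγ : γ ∈ Metric.ball (0 : C(unitInterval, E)) S) (hη : η ∈ Metric.ball (0 : C(unitInterval, E)) S)
    (hx : γ - primitiveL (Xh' γ) = ContinuousMap.const unitInterval x)
    (hy : η - primitiveL (Xh η) = ContinuousMap.const unitInterval (γ 1)) : η 1 = x := by
  -- The reversed curve `t ↦ γ (1 - t)` is an integral curve of `X` starting at `γ 1`; by uniqueness
  -- it equals `η`.
  let ξ : C(unitInterval, E) := ⟨fun t => γ (unitInterval.symm t),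
    γ.continuous.comp unitInterval.continuous_symm⟩
  have hξ0 : ξ 0 = γ 1 := by simp [ξ]
  have hext : ∀ t ∈ Set.Icc (0 : ℝ) 1, extendCurve ξ t = extendCurve γ (1 - t) := by
    intro t ht
    rw [extendCurve_of_mem ξ ht, extendCurve_of_mem γ (t := 1 - t) ⟨by linarith [ht.2], by linarith [ht.1]⟩]
    rfl
  have hξ : ξ - primitiveL (Xh ξ) = ContinuousMap.const unitInterval (ξ 0) := by
    refine h.integral_eq fun t ht => ?_
    have ht' : 1 - t ∈ Set.Icc (0 : ℝ) 1 := ⟨by linarith [ht.2], by linarith [ht.1]⟩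
    have h1 := h'.hasDerivWithinAt hx ht'
    have h2 : HasDerivWithinAt (fun t : ℝ => 1 - t) (-1) (Set.Icc 0 1) t :=
      ((hasDerivAt_id t).const_sub 1).hasDerivWithinAt
    have h3 := h1.scomp t h2 (fun s hs => ⟨by linarith [hs.2], by linarith [hs.1]⟩)
    rw [hext t ht]
    simp only [smul_neg, neg_smul, one_smul, neg_neg] at h3
    exact h3.congr hext (hext t ht)
  have hξS : ξ ∈ Metric.ball (0 : C(unitInterval, E)) S := by
    rw [mem_ball_zero_iff] at hγ ⊢
    exact ((ContinuousMap.norm_le ξ (norm_nonneg γ)).2 fun t => γ.norm_coe_le_norm _).trans_lt hγ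
  rw [hξ0] at hξ
  rw [h.unique hη hξS hy hξ]
  have h0 : ξ 1 = γ 0 := by simp [ξ]
  rw [h0]
  have := congrArg (fun η : C(unitInterval, E) => η 0) hx
  simpa [primitiveL_apply] using this

/-- The variational equation. -/
lemma variational [CompleteSpace E] (h : SmallField X Xh S) {Γ : E → C(unitInterval, E)}
    {O : Set E} (hO : IsOpen O) (hΓ : ContDiffOn ℝ ∞ Γ O)
    (heq : ∀ x ∈ O, Γ x - primitiveL (Xh (Γ x)) = ContinuousMap.const unitInterval x) {x : E} (hx : x ∈ O)
    (v : E) {t : ℝ} (ht : t ∈ Set.Icc (0 : ℝ) 1) :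
    HasDerivWithinAt (extendCurve (fderiv ℝ Γ x v))
      (fderiv ℝ X (extendCurve (Γ x) t) (extendCurve (fderiv ℝ Γ x v) t)) (Set.Icc 0 1) t := by
  have hd : HasFDerivAt Γ (fderiv ℝ Γ x) x :=
    ((hΓ.differentiableOn (by simp)).differentiableAt (hO.mem_nhds hx)).hasFDerivAt
  have hXh := (h.smooth_lift.differentiable (by simp)).differentiableAt (x := Γ x) |>.hasFDerivAt
  have h1 : HasFDerivAt (fun x => Γ x - primitiveL (Xh (Γ x)))
      (fderiv ℝ Γ x - primitiveL.comp ((fderiv ℝ Xh (Γ x)).comp (fderiv ℝ Γ x))) x :=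
    hd.sub ((primitiveL (E := E)).hasFDerivAt.comp x (hXh.comp x hd))
  have h2 : HasFDerivAt (fun x => Γ x - primitiveL (Xh (Γ x))) constCurve x :=
    constCurve.hasFDerivAt.congr_of_eventuallyEq
      (Filter.eventuallyEq_of_mem (hO.mem_nhds hx) fun y hy => heq y hy)
  have h3 := congrArg (fun T : E →L[ℝ] C(unitInterval, E) => T v) (h1.unique h2)
  have h4 : fderiv ℝ Γ x v
      = ContinuousMap.const unitInterval v + primitiveL (fderiv ℝ Xh (Γ x) (fderiv ℝ Γ x v)) :=
    sub_eq_iff_eq_add.1 h3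
  convert hasDerivWithinAt_extendCurve h4 ht using 1
  -- The derivative of the lifted field, evaluated at time `τ`, is the derivative of `X` at `Γ x τ`:
  -- differentiate `ev (Xh γ) = X (ev γ)` on both sides.
  let τ : unitInterval := Set.projIcc 0 1 zero_le_one t
  let ev : C(unitInterval, E) →L[ℝ] E := ContinuousMap.evalCLM ℝ τ
  have h5 : HasFDerivAt (fun γ => ev (Xh γ)) (ev.comp (fderiv ℝ Xh (Γ x))) (Γ x) :=
    ev.hasFDerivAt.comp _ hXh
  have hX := (h.smooth.differentiable (by simp)).differentiableAt (x := Γ x τ) |>.hasFDerivAt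
  have h6 : HasFDerivAt (fun γ => ev (Xh γ)) ((fderiv ℝ X (Γ x τ)).comp ev) (Γ x) := by
    have : (fun γ => ev (Xh γ)) = fun γ => X (ev γ) := funext fun γ => h.lift γ τ
    rw [this]
    exact HasFDerivAt.comp (Γ x) (g := X) (f := ev) hX ev.hasFDerivAt
  exact (congrArg (fun T : C(unitInterval, E) →L[ℝ] E => T (fderiv ℝ Γ x v)) (h5.unique h6)).symm

/-- A bilinear form that is infinitesimally invariant under `X` is invariant under its flow. -/
lemma bilinear_invariant [CompleteSpace E] (h : SmallField X Xh S) {Γ : E → C(unitInterval, E)}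
    {O : Set E} (hO : IsOpen O) (hΓ : ContDiffOn ℝ ∞ Γ O)
    (heq : ∀ x ∈ O, Γ x - primitiveL (Xh (Γ x)) = ContinuousMap.const unitInterval x) {x : E} (hx : x ∈ O)
    (B : E →L[ℝ] E →L[ℝ] ℝ)
    (hB : ∀ y u w, B (fderiv ℝ X y u) w + B u (fderiv ℝ X y w) = 0) (v w : E) :
    B (fderiv ℝ (fun y => Γ y 1) x v) (fderiv ℝ (fun y => Γ y 1) x w) = B v w := by
  have hd : HasFDerivAt Γ (fderiv ℝ Γ x) x :=
    ((hΓ.differentiableOn (by simp)).differentiableAt (hO.mem_nhds hx)).hasFDerivAt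
  have hev : ∀ τ : unitInterval, HasFDerivAt (fun y => Γ y τ)
      ((ContinuousMap.evalCLM ℝ τ).comp (fderiv ℝ Γ x)) x := fun τ =>
    (ContinuousMap.evalCLM (M := E) ℝ τ).hasFDerivAt.comp x hd
  have h0 : ∀ v, fderiv ℝ Γ x v 0 = v := by
    intro v
    have h1 : HasFDerivAt (fun y => Γ y 0) (ContinuousLinearMap.id ℝ E) x := by
      refine (hasFDerivAt_id x).congr_of_eventuallyEq
        (Filter.eventuallyEq_of_mem (hO.mem_nhds hx) fun y hy => ?_)
      have := congrArg (fun η : C(unitInterval, E) => η 0) (heq y hy)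
      simpa [primitiveL_apply] using this
    exact congrArg (fun T : E →L[ℝ] E => T v) ((hev 0).unique h1)
  -- Both arguments solve the variational equation, so the product rule and infinitesimal invariance
  -- make the form constant in time.
  have hder : ∀ t ∈ Set.Icc (0 : ℝ) 1, HasDerivWithinAt
      (fun t => B (extendCurve (fderiv ℝ Γ x v) t) (extendCurve (fderiv ℝ Γ x w) t)) 0
      (Set.Icc 0 1) t := by
    intro t ht
    have h1 := B.hasFDerivWithinAt_of_bilinear
      (h.variational hO hΓ heq hx v ht).hasFDerivWithinAt
      (h.variational hO hΓ heq hx w ht).hasFDerivWithinAt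
    have h2 := h1.hasDerivWithinAt
    have h3 := hB (extendCurve (Γ x) t) (extendCurve (fderiv ℝ Γ x v) t)
      (extendCurve (fderiv ℝ Γ x w) t)
    rw [add_comm] at h3
    refine HasDerivWithinAt.congr_deriv (by simpa using h2) h3
  have hconst := constant_of_has_deriv_right_zero
    (f := fun t => B (extendCurve (fderiv ℝ Γ x v) t) (extendCurve (fderiv ℝ Γ x w) t))
    (a := 0) (b := 1) (fun t ht => (hder t ht).continuousWithinAt)
    (fun t ht => ((hder t (Set.Ico_subset_Icc_self ht)).mono_of_mem_nhdsWithin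
      (Icc_mem_nhdsGE_of_mem ht))) 1 ⟨zero_le_one, le_rfl⟩
  rw [(hev 1).fderiv]
  simp only [extendCurve_of_mem _ (show (1 : ℝ) ∈ Set.Icc (0 : ℝ) 1 from ⟨zero_le_one, le_rfl⟩),
    extendCurve_of_mem _ (show (0 : ℝ) ∈ Set.Icc (0 : ℝ) 1 from ⟨le_rfl, zero_le_one⟩)] at hconst
  have h00 := h0 v
  have h01 := h0 w
  refine (hconst.trans ?_)
  exact congrArg₂ (fun a b => B a b) h00 h01

end SmallField
end Flow
end

noncomputable section

/-! ### Multilinear maps given by coefficients -/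

/-- A signed mode `(δ, a)`; it indexes the coordinates `zₐ` and `\bar zₐ`. -/
abbrev Mode : Type := ℤˣ × ℤ

/-- The product of the weights of the entries of a tuple of modes. -/
def tupleWeight (σ θ : ℝ) {k : ℕ} (j : Fin k → Mode) : ℝ := ∏ α, gevreyWeight σ θ (j α).2

lemma tupleWeight_pos (σ θ : ℝ) {k : ℕ} (j : Fin k → Mode) : 0 < tupleWeight σ θ j :=
  Finset.prod_pos fun _ _ => gevreyWeight_pos _ _ _

lemma one_le_tupleWeight {σ θ : ℝ} (hσ : 0 < σ) {k : ℕ} (j : Fin k → Mode) :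
    1 ≤ tupleWeight σ θ j :=
  Finset.prod_induction _ (fun x => 1 ≤ x) (fun _ _ => one_le_mul_of_one_le_of_one_le) le_rfl
    fun _ _ => one_le_gevreyWeight hσ _

lemma tupleWeight_insertNth (σ θ : ℝ) {k : ℕ} (α : Fin (k + 1)) (i : Mode) (j : Fin k → Mode) :
    tupleWeight σ θ (α.insertNth i j : Fin (k + 1) → Mode)
      = gevreyWeight σ θ i.2 * tupleWeight σ θ j := by
  simp [tupleWeight, Fin.prod_univ_succAbove _ α]

lemma hasSum_pi_prod {ι : Type*} {k : ℕ} {f : Fin k → ι → ℝ} {s : Fin k → ℝ}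
    (hf : ∀ α i, 0 ≤ f α i) (hs : ∀ α, HasSum (f α) (s α)) :
    HasSum (fun j : Fin k → ι => ∏ α, f α (j α)) (∏ α, s α) := by
  induction k with
  | zero => simp
  | succ k ih =>
    rw [← (Fin.consEquiv fun _ : Fin (k + 1) => ι).hasSum_iff, Fin.prod_univ_succ]
    have h1 : HasSum (fun j : Fin k → ι => ∏ α : Fin k, f α.succ (j α)) (∏ α : Fin k, s α.succ) :=
      ih (fun α => hf α.succ) (fun α => hs α.succ)
    have hnn : 0 ≤ fun j : Fin k → ι => ∏ α : Fin k, f α.succ (j α) :=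
      fun j => Finset.prod_nonneg fun α _ => hf α.succ (j α)
    have hf0 : 0 ≤ f 0 := fun i => hf 0 i
    have hsum := Summable.mul_of_nonneg (hs 0).summable h1.summable hf0 hnn
    refine ((hs 0).mul h1 hsum).congr_fun fun x => ?_
    simp [Fin.prod_univ_succ]

namespace Gevrey

variable {σ θ : ℝ}

/-- The signed coordinate `z_{(δ, a)}`. -/
def sc (z : Gevrey σ θ) (i : Mode) : ℂ := signedCoord z i

lemma sc_one (z : Gevrey σ θ) (a : ℤ) : sc z (1, a) = z a := by simp [sc, signedCoord]

lemma sc_neg_one (z : Gevrey σ θ) (a : ℤ) : sc z (-1, a) = conj (z a) := by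
  simp [sc, signedCoord]

lemma mode_cases (i : Mode) : i = (1, i.2) ∨ i = (-1, i.2) := by
  rcases Int.units_eq_one_or i.1 with h | h
  · left; ext <;> simp [h]
  · right; ext <;> simp [h]

lemma norm_sc (z : Gevrey σ θ) (i : Mode) : ‖sc z i‖ = ‖z i.2‖ := by
  rcases mode_cases i with h | h <;> rw [h]
  · rw [sc_one]
  · rw [sc_neg_one, RCLike.norm_conj]

lemma sc_add (x y : Gevrey σ θ) (i : Mode) : sc (x + y) i = sc x i + sc y i := by
  rcases mode_cases i with h | h <;> rw [h]
  · simp only [sc_one, add_apply]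
  · simp only [sc_neg_one, add_apply, map_add]

lemma sc_smul (c : ℝ) (x : Gevrey σ θ) (i : Mode) : sc (c • x) i = c • sc x i := by
  rcases mode_cases i with h | h <;> rw [h]
  · simp only [sc_one, smul_apply]
  · simp only [sc_neg_one, smul_apply, Complex.real_smul, map_mul, Complex.conj_ofReal]

lemma conj_sc (z : Gevrey σ θ) (i : Mode) : conj (sc z i) = sc z (-i.1, i.2) := by
  rcases mode_cases i with h | h <;> rw [h]
  · simp only [sc_one, sc_neg_one]
  · simp only [sc_one, sc_neg_one, neg_neg, Complex.conj_conj]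

/-- The factor `2` in the norm counts the two signs: `‖z‖` is the weighted `ℓ¹` norm over signed
modes. -/
lemma hasSum_mode (z : Gevrey σ θ) :
    HasSum (fun i : Mode => gevreyWeight σ θ i.2 * ‖sc z i‖) ‖z‖ := by
  have h : HasSum (fun a => gevreyWeight σ θ a * ‖z a‖) (‖z‖ / 2) := by
    have := (summable z).hasSum
    rwa [show ‖z‖ / 2 = ∑' a, gevreyWeight σ θ a * ‖z a‖ by rw [norm_def]; ring]
  have h1 : HasSum (fun _ : ℤˣ => (1 : ℝ)) 2 := by
    simpa using hasSum_fintype (fun _ : ℤˣ => (1 : ℝ))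
  have h2 := h1.mul h (h1.summable.mul_of_nonneg h.summable (fun _ => zero_le_one)
    fun a => mul_nonneg (gevreyWeight_pos _ _ _).le (norm_nonneg _))
  rw [mul_div_cancel₀ _ (two_ne_zero' ℝ)] at h2
  simpa [norm_sc] using h2

lemma hasSum_tuple {k : ℕ} (m : Fin k → Gevrey σ θ) :
    HasSum (fun j : Fin k → Mode => tupleWeight σ θ j * ∏ α, ‖sc (m α) (j α)‖) (∏ α, ‖m α‖) := by
  have := hasSum_pi_prod (f := fun α i => gevreyWeight σ θ i.2 * ‖sc (m α) i‖)
    (fun α i => mul_nonneg (gevreyWeight_pos _ _ _).le (norm_nonneg _))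
    (fun α => hasSum_mode (m α))
  simpa [tupleWeight, Finset.prod_mul_distrib] using this

variable {E : Type*} [NormedAddCommGroup E] [NormedSpace ℝ E]

lemma norm_tuple_term_le {k : ℕ} {b : (Fin k → Mode) → ℂ →L[ℝ] E} {B : ℝ}
    (hb : ∀ j, ‖b j‖ ≤ B * tupleWeight σ θ j) (m : Fin k → Gevrey σ θ) (j : Fin k → Mode) :
    ‖b j (∏ α, sc (m α) (j α))‖ ≤ B * (tupleWeight σ θ j * ∏ α, ‖sc (m α) (j α)‖) := by
  refine ((b j).le_opNorm _).trans ?_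
  rw [norm_prod, ← mul_assoc]
  exact mul_le_mul_of_nonneg_right (hb j) (by positivity)

lemma summable_norm_tuple {k : ℕ} {b : (Fin k → Mode) → ℂ →L[ℝ] E} {B : ℝ}
    (hb : ∀ j, ‖b j‖ ≤ B * tupleWeight σ θ j) (m : Fin k → Gevrey σ θ) :
    Summable fun j => ‖b j (∏ α, sc (m α) (j α))‖ :=
  Summable.of_nonneg_of_le (fun _ => norm_nonneg _) (norm_tuple_term_le hb m)
    ((hasSum_tuple m).summable.mul_left B)

lemma summable_tuple [CompleteSpace E] {k : ℕ} {b : (Fin k → Mode) → ℂ →L[ℝ] E} {B : ℝ}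
    (hb : ∀ j, ‖b j‖ ≤ B * tupleWeight σ θ j) (m : Fin k → Gevrey σ θ) :
    Summable fun j => b j (∏ α, sc (m α) (j α)) :=
  (summable_norm_tuple hb m).of_norm

lemma prod_sc_update {k : ℕ} [DecidableEq (Fin k)] (m : Fin k → Gevrey σ θ) (α : Fin k)
    (v : Gevrey σ θ) (j : Fin k → Mode) : ∏ β, sc (Function.update m α v β) (j β)
      = sc v (j α) * ∏ β ∈ Finset.univ.erase α, sc (m β) (j β) := by
  rw [← Finset.mul_prod_erase _ _ (Finset.mem_univ α), Function.update_self]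
  congr 1
  refine Finset.prod_congr rfl fun β hβ => ?_
  rw [Function.update_of_ne (Finset.ne_of_mem_erase hβ)]

/-- The multilinear map `∑_j b_j (z¹_{j₁} ⋯ zᵏ_{j_k})`. -/
def tupleML [CompleteSpace E] {k : ℕ} (b : (Fin k → Mode) → ℂ →L[ℝ] E) (B : ℝ)
    (hb : ∀ j, ‖b j‖ ≤ B * tupleWeight σ θ j) :
    ContinuousMultilinearMap ℝ (fun _ : Fin k => Gevrey σ θ) E :=
  MultilinearMap.mkContinuous
    { toFun := fun m => ∑' j, b j (∏ α, sc (m α) (j α))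
      map_update_add' := by
        intro inst m α x y
        rw [← (summable_tuple hb _).tsum_add (summable_tuple hb _)]
        refine tsum_congr fun j => ?_
        rw [← map_add]
        congr 1
        rw [prod_sc_update, prod_sc_update, prod_sc_update, sc_add, add_mul]
      map_update_smul' := by
        intro inst m α c x
        rw [← (summable_tuple hb _).tsum_const_smul c]
        refine tsum_congr fun j => ?_
        rw [← map_smul]
        congr 1
        rw [prod_sc_update, prod_sc_update, sc_smul, smul_mul_assoc] } B (fun m => by
      have h := tsum_of_norm_bounded ((hasSum_tuple m).mul_left B) (norm_tuple_term_le hb m)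
      exact h)

lemma norm_tupleML_le [CompleteSpace E] {k : ℕ} (b : (Fin k → Mode) → ℂ →L[ℝ] E) (B : ℝ)
    (hb : ∀ j, ‖b j‖ ≤ B * tupleWeight σ θ j) (hB : 0 ≤ B) : ‖tupleML b B hb‖ ≤ B :=
  MultilinearMap.mkContinuous_norm_le _ hB _

end Gevrey
end

noncomputable section

/-! ### Polynomials given by coefficients, their gradients and Hamiltonian vector fields -/

/-- `∑_α δ_α`. -/
def charge {k : ℕ} (j : Fin k → Mode) : ℤ := ∑ α, ((j α).1 : ℤ)

/-- `∑_α δ_α a_α`. -/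
def momentum {k : ℕ} (j : Fin k → Mode) : ℤ := ∑ α, ((j α).1 : ℤ) * (j α).2

/-- `∑_α δ_α a_α²`. -/
def divisor {k : ℕ} (j : Fin k → Mode) : ℤ := ∑ α, ((j α).1 : ℤ) * (j α).2 ^ 2

/-- The conjugate mode. -/
def Mode.conj (i : Mode) : Mode := (-i.1, i.2)

/-- The conjugate tuple. -/
def conjTuple {k : ℕ} (j : Fin k → Mode) : Fin k → Mode := fun α => Mode.conj (j α)

lemma conjTuple_conjTuple {k : ℕ} (j : Fin k → Mode) : conjTuple (conjTuple j) = j := by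
  funext α; simp [conjTuple, Mode.conj]

/-- Conjugation of tuples as an equivalence. -/
def conjTupleEquiv (k : ℕ) : (Fin k → Mode) ≃ (Fin k → Mode) :=
  ⟨conjTuple, conjTuple, conjTuple_conjTuple, conjTuple_conjTuple⟩

lemma charge_conjTuple {k : ℕ} (j : Fin k → Mode) : charge (conjTuple j) = -charge j := by
  simp [charge, conjTuple, Mode.conj]

lemma momentum_conjTuple {k : ℕ} (j : Fin k → Mode) : momentum (conjTuple j) = -momentum j := by
  simp [momentum, conjTuple, Mode.conj]

lemma divisor_conjTuple {k : ℕ} (j : Fin k → Mode) : divisor (conjTuple j) = -divisor j := by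
  simp [divisor, conjTuple, Mode.conj]

lemma conjTuple_insertNth {k : ℕ} (α : Fin (k + 1)) (i : Mode) (j : Fin k → Mode) :
    conjTuple (α.insertNth i j : Fin (k + 1) → Mode) = α.insertNth (Mode.conj i) (conjTuple j) := by
  funext β
  refine Fin.succAboveCases α ?_ (fun β => ?_) β <;> simp [conjTuple]

/-- The weight is even, so the signs drop out of the submultiplicative bound. This controls the
output frequency of a monomial by its input frequencies. -/
lemma gevreyWeight_momentum_le {σ θ : ℝ} (hσ : 0 < σ) (hθ : 0 < θ) (hθ1 : θ < 1) {k : ℕ}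
    (j : Fin k → Mode) : gevreyWeight σ θ (momentum j) ≤ tupleWeight σ θ j := by
  refine (gevreyWeight_sum_le hσ hθ hθ1 _ _).trans (le_of_eq ?_)
  refine Finset.prod_congr rfl fun α _ => ?_
  rcases Int.units_eq_one_or (j α).1 with h | h <;> simp [h, gevreyWeight_neg]

/-- The coefficients vanish off the tuples with zero charge and momentum. -/
def MomentumSupported {k : ℕ} (c : (Fin k → Mode) → ℂ) : Prop :=
  ∀ j, c j ≠ 0 → charge j = 0 ∧ momentum j = 0

/-- The coefficients of a real polynomial. -/
def RealCoeffs {k : ℕ} (c : (Fin k → Mode) → ℂ) : Prop := ∀ j, conj (c j) = c (conjTuple j)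

/-- The coefficients of the partial derivative in the coordinate of the mode `i`. -/
def dcoef {k : ℕ} (c : (Fin (k + 1) → Mode) → ℂ) (i : Mode) (j : Fin k → Mode) : ℂ :=
  ∑ α : Fin (k + 1), c (α.insertNth i j)

lemma conj_dcoef {k : ℕ} {c : (Fin (k + 1) → Mode) → ℂ} (hc : RealCoeffs c) (i : Mode)
    (j : Fin k → Mode) : conj (dcoef c i j) = dcoef c (Mode.conj i) (conjTuple j) := by
  simp only [dcoef, map_sum, ← conjTuple_insertNth]
  exact Finset.sum_congr rfl fun α _ => hc _

lemma norm_dcoef_le {k : ℕ} {c : (Fin (k + 1) → Mode) → ℂ} {B : ℝ} (hc : ∀ j, ‖c j‖ ≤ B)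
    (i : Mode) (j : Fin k → Mode) : ‖dcoef c i j‖ ≤ (k + 1) * B := by
  refine (norm_sum_le _ _).trans ((Finset.sum_le_sum fun α _ => hc _).trans ?_)
  simp

lemma norm_dcoef_le_weight {σ θ : ℝ} {k : ℕ} {c : (Fin (k + 1) → Mode) → ℂ} {B : ℝ}
    (hc : ∀ j, ‖c j‖ ≤ B * tupleWeight σ θ j) (i : Mode) (j : Fin k → Mode) :
    ‖dcoef c i j‖ ≤ (k + 1) * B * gevreyWeight σ θ i.2 * tupleWeight σ θ j := by
  refine (norm_sum_le _ _).trans ((Finset.sum_le_sum fun α _ => hc _).trans (le_of_eq ?_))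
  simp only [tupleWeight_insertNth, Finset.sum_const, Finset.card_univ, Fintype.card_fin,
    nsmul_eq_mul]
  push_cast
  ring

lemma charge_insertNth {k : ℕ} (α : Fin (k + 1)) (i : Mode) (j : Fin k → Mode) :
    charge (α.insertNth i j : Fin (k + 1) → Mode) = i.1 + charge j := by
  simp [charge, Fin.sum_univ_succAbove _ α]

lemma momentum_insertNth {k : ℕ} (α : Fin (k + 1)) (i : Mode) (j : Fin k → Mode) :
    momentum (α.insertNth i j : Fin (k + 1) → Mode) = i.1 * i.2 + momentum j := by
  simp [momentum, Fin.sum_univ_succAbove _ α]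

lemma MomentumSupported.of_dcoef_ne {k : ℕ} {c : (Fin (k + 1) → Mode) → ℂ}
    (hc : MomentumSupported c) {i : Mode} {j : Fin k → Mode} (h : dcoef c i j ≠ 0) :
    (i.1 : ℤ) + charge j = 0 ∧ (i.1 : ℤ) * i.2 + momentum j = 0 := by
  obtain ⟨α, -, hα⟩ := Finset.exists_ne_zero_of_sum_ne_zero h
  have := hc _ hα
  rwa [charge_insertNth, momentum_insertNth] at this

lemma MomentumSupported.dcoef_neg {k : ℕ} {c : (Fin (k + 1) → Mode) → ℂ}
    (hc : MomentumSupported c) {a : ℤ} {j : Fin k → Mode} (h : a ≠ momentum j) :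
    dcoef c (-1, a) j = 0 := by
  by_contra hne
  have := (hc.of_dcoef_ne hne).2
  simp only [Units.val_neg, Units.val_one] at this
  exact h (by linarith)

lemma MomentumSupported.dcoef_pos {k : ℕ} {c : (Fin (k + 1) → Mode) → ℂ}
    (hc : MomentumSupported c) {a : ℤ} {j : Fin k → Mode} (h : a ≠ -momentum j) :
    dcoef c (1, a) j = 0 := by
  by_contra hne
  have := (hc.of_dcoef_ne hne).2
  simp only [Units.val_one] at this
  exact h (by linarith)

namespace Gevrey

variable {σ θ : ℝ}

/-- The monomial `z_j`. -/
def mono (z : Gevrey σ θ) {k : ℕ} (j : Fin k → Mode) : ℂ := ∏ α, sc z (j α)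

lemma conj_mono (z : Gevrey σ θ) {k : ℕ} (j : Fin k → Mode) :
    conj (mono z j) = mono z (conjTuple j) := by
  simp only [mono, map_prod]
  exact Finset.prod_congr rfl fun α _ => conj_sc z _

lemma mono_insertNth (z : Gevrey σ θ) {k : ℕ} (α : Fin (k + 1)) (i : Mode) (j : Fin k → Mode) :
    mono z (α.insertNth i j : Fin (k + 1) → Mode) = sc z i * mono z j := by
  simp [mono, Fin.prod_univ_succAbove _ α]

/-- The polynomial `∑_j c_j z_j`. -/
def polyEval {k : ℕ} (c : (Fin k → Mode) → ℂ) (z : Gevrey σ θ) : ℂ := ∑' j, c j * mono z j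

lemma norm_mulL (c : ℂ) : ‖ContinuousLinearMap.mul ℝ ℂ c‖ = ‖c‖ :=
  ContinuousLinearMap.opNorm_mul_apply ℝ ℂ c

/-- The multilinear form with the coefficients `c`. -/
def formL {k : ℕ} (c : (Fin k → Mode) → ℂ) (B : ℝ) (hc : ∀ j, ‖c j‖ ≤ B * tupleWeight σ θ j) :
    ContinuousMultilinearMap ℝ (fun _ : Fin k => Gevrey σ θ) ℂ :=
  tupleML (fun j => ContinuousLinearMap.mul ℝ ℂ (c j)) B (fun j => (norm_mulL _).le.trans (hc j))

lemma formL_apply {k : ℕ} {c : (Fin k → Mode) → ℂ} {B : ℝ}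
    (hc : ∀ j, ‖c j‖ ≤ B * tupleWeight σ θ j) (m : Fin k → Gevrey σ θ) :
    formL c B hc m = ∑' j, c j * ∏ α, sc (m α) (j α) := rfl

lemma summable_form {k : ℕ} {c : (Fin k → Mode) → ℂ} {B : ℝ}
    (hc : ∀ j, ‖c j‖ ≤ B * tupleWeight σ θ j) (m : Fin k → Gevrey σ θ) :
    Summable fun j => c j * ∏ α, sc (m α) (j α) :=
  summable_tuple (b := fun j => ContinuousLinearMap.mul ℝ ℂ (c j))
    (fun j => (norm_mulL _).le.trans (hc j)) m

lemma summable_norm_poly {k : ℕ} {c : (Fin k → Mode) → ℂ} {B : ℝ}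
    (hc : ∀ j, ‖c j‖ ≤ B * tupleWeight σ θ j) (z : Gevrey σ θ) :
    Summable fun j => ‖c j * mono z j‖ :=
  summable_norm_tuple (b := fun j => ContinuousLinearMap.mul ℝ ℂ (c j))
    (fun j => (norm_mulL _).le.trans (hc j)) (fun _ => z)

lemma summable_poly {k : ℕ} {c : (Fin k → Mode) → ℂ} {B : ℝ}
    (hc : ∀ j, ‖c j‖ ≤ B * tupleWeight σ θ j) (z : Gevrey σ θ) :
    Summable fun j => c j * mono z j := (summable_norm_poly hc z).of_norm

lemma norm_polyEval_le {k : ℕ} {c : (Fin k → Mode) → ℂ} {B : ℝ}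
    (hc : ∀ j, ‖c j‖ ≤ B * tupleWeight σ θ j) (z : Gevrey σ θ) :
    ‖polyEval c z‖ ≤ B * ‖z‖ ^ k := by
  have h := tsum_of_norm_bounded ((hasSum_tuple (fun _ : Fin k => z)).mul_left B)
    (norm_tuple_term_le (b := fun j => ContinuousLinearMap.mul ℝ ℂ (c j))
    (fun j => (norm_mulL _).le.trans (hc j)) (fun _ => z))
  simpa [polyEval, mono] using h

lemma contDiff_diag {E : Type*} [NormedAddCommGroup E] [NormedSpace ℝ E] {k : ℕ}
    (T : ContinuousMultilinearMap ℝ (fun _ : Fin k => Gevrey σ θ) E) :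
    ContDiff ℝ ∞ (fun z => T (fun _ => z)) :=
  T.contDiff.comp (contDiff_pi.2 fun _ => contDiff_id)

lemma hasFDerivAt_diag {E : Type*} [NormedAddCommGroup E] [NormedSpace ℝ E] {k : ℕ}
    (T : ContinuousMultilinearMap ℝ (fun _ : Fin k => Gevrey σ θ) E) (z : Gevrey σ θ) :
    HasFDerivAt (fun z => T (fun _ => z))
      ((T.linearDeriv (fun _ => z)).comp (ContinuousLinearMap.pi fun _ => .id ℝ _)) z :=
  (T.hasFDerivAt (fun _ => z)).comp z
    (ContinuousLinearMap.pi fun _ : Fin k => .id ℝ (Gevrey σ θ)).hasFDerivAt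

lemma contDiff_polyEval {k : ℕ} {c : (Fin k → Mode) → ℂ} {B : ℝ}
    (hc : ∀ j, ‖c j‖ ≤ B * tupleWeight σ θ j) :
    ContDiff ℝ ∞ (polyEval c : Gevrey σ θ → ℂ) :=
  contDiff_diag (formL c B hc)

lemma summable_grad {k : ℕ} {c : (Fin (k + 1) → Mode) → ℂ} {B : ℝ}
    (hc : ∀ j, ‖c j‖ ≤ B * tupleWeight σ θ j) (z v : Gevrey σ θ) (α : Fin (k + 1)) :
    Summable fun x : Mode × (Fin k → Mode) => c (α.insertNth x.1 x.2) * (sc v x.1 * mono z x.2) := by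
  have := (Fin.insertNthEquiv (fun _ : Fin (k + 1) => Mode) α).summable_iff.2
    (summable_form hc (α.insertNth v (fun _ => z)))
  refine this.congr fun x => ?_
  simp [Fin.prod_univ_succAbove _ α, mono]
  exact Or.inl rfl

/-- The diagonal of a multilinear form is differentiated one slot at a time. Splitting off the mode
in that slot and summing over the slots produces `dcoef`. -/
lemma fderiv_polyEval {k : ℕ} {c : (Fin (k + 1) → Mode) → ℂ} {B : ℝ}
    (hc : ∀ j, ‖c j‖ ≤ B * tupleWeight σ θ j) (z v : Gevrey σ θ) :
    fderiv ℝ (polyEval c) z v = ∑' i, sc v i * polyEval (dcoef c i) z := by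
  have h1 : fderiv ℝ (polyEval c) z v
      = ∑ α, formL c B hc (Function.update (fun _ => z) α v) := by
    change fderiv ℝ (fun z => formL c B hc (fun _ => z)) z v = _
    rw [(hasFDerivAt_diag (formL c B hc) z).fderiv]
    simp [ContinuousMultilinearMap.linearDeriv_apply]
  have h2 : ∀ α, formL c B hc (Function.update (fun _ => z) α v)
      = ∑' x : Mode × (Fin k → Mode), c (α.insertNth x.1 x.2) * (sc v x.1 * mono z x.2) := by
    intro α
    rw [formL_apply, ← (Fin.insertNthEquiv (fun _ : Fin (k + 1) => Mode) α).tsum_eq]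
    refine tsum_congr fun x => ?_
    simp [Fin.prod_univ_succAbove _ α, mono]
    exact Or.inl rfl
  have hs := summable_sum fun α (_ : α ∈ Finset.univ) => summable_grad hc z v α
  rw [h1, Finset.sum_congr rfl fun α _ => h2 α,
    ← Summable.tsum_finsetSum fun α _ => summable_grad hc z v α, hs.tsum_prod]
  refine tsum_congr fun i => ?_
  rw [polyEval, ← tsum_mul_left]
  refine tsum_congr fun j => ?_
  rw [dcoef, Finset.sum_mul, Finset.mul_sum]
  exact Finset.sum_congr rfl fun α _ => by ring

lemma sc_single (a : ℤ) (ζ : ℂ) (i : Mode) (h : i.2 ≠ a) :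
    sc (single a ζ : Gevrey σ θ) i = 0 := by
  rw [← norm_eq_zero, norm_sc, single_apply, if_neg h, norm_zero]

lemma tsum_sc_single (a : ℤ) (ζ : ℂ) (g : Mode → ℂ) :
    ∑' i, sc (single a ζ : Gevrey σ θ) i * g i = ζ * g (1, a) + conj ζ * g (-1, a) := by
  rw [tsum_eq_sum (s := {((1 : ℤˣ), a), ((-1 : ℤˣ), a)})]
  · rw [Finset.sum_pair (by simp), sc_one, sc_neg_one]
    simp [single_apply]
  · intro i hi
    rw [sc_single, zero_mul]
    rintro rfl
    rcases mode_cases i with h | h <;> rw [h] at hi <;> simp at hi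

lemma fderiv_polyEval_single {k : ℕ} {c : (Fin (k + 1) → Mode) → ℂ} {B : ℝ}
    (hc : ∀ j, ‖c j‖ ≤ B * tupleWeight σ θ j) (z : Gevrey σ θ) (a : ℤ) (ζ : ℂ) :
    fderiv ℝ (polyEval c) z (single a ζ)
      = ζ * polyEval (dcoef c (1, a)) z + conj ζ * polyEval (dcoef c (-1, a)) z := by
  rw [fderiv_polyEval hc, tsum_sc_single]

/-- Along `ζ = 1` and `ζ = i` the holomorphic part of the derivative cancels and the antiholomorphic
part doubles. -/
lemma dzbar_polyEval {k : ℕ} {c : (Fin (k + 1) → Mode) → ℂ} {B : ℝ}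
    (hc : ∀ j, ‖c j‖ ≤ B * tupleWeight σ θ j) (z : Gevrey σ θ) (a : ℤ) :
    dzbar (polyEval c) z a = polyEval (dcoef c (-1, a)) z := by
  rw [dzbar, fderiv_polyEval_single hc, fderiv_polyEval_single hc]
  simp only [map_one, Complex.conj_I]
  linear_combination (polyEval (dcoef c (1, a)) z - polyEval (dcoef c (-1, a)) z) / 2 * Complex.I_sq

end Gevrey
end

/-! ### Hamiltonian vector fields of momentum-preserving polynomials -/

noncomputable section

namespace Gevrey

variable {σ θ : ℝ}

lemma conj_tsum_coeffs {k : ℕ} (f : (Fin k → Mode) → ℂ) :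
    conj (∑' j, f j) = ∑' j, conj (f (conjTuple j)) := by
  rw [Complex.conj_tsum, ← (conjTupleEquiv k).tsum_eq]
  rfl

lemma conj_polyEval_dcoef {k : ℕ} {c : (Fin (k + 1) → Mode) → ℂ} (hc : RealCoeffs c) (i : Mode)
    (z : Gevrey σ θ) : conj (polyEval (dcoef c i) z) = polyEval (dcoef c (Mode.conj i)) z := by
  rw [polyEval, conj_tsum_coeffs, polyEval]
  refine tsum_congr fun j => ?_
  rw [map_mul, conj_dcoef hc, conj_mono, conjTuple_conjTuple]

lemma conj_polyEval {k : ℕ} {c : (Fin k → Mode) → ℂ} (hc : RealCoeffs c)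
    (z : Gevrey σ θ) : conj (polyEval c z) = polyEval c z := by
  rw [polyEval, conj_tsum_coeffs]
  refine tsum_congr fun j => ?_
  rw [map_mul, hc, conj_mono, conjTuple_conjTuple]

/-- The coefficients of the Hamiltonian vector field. -/
def vfCoef {k : ℕ} (c : (Fin (k + 1) → Mode) → ℂ) (j : Fin k → Mode) : ℂ :=
  Complex.I * dcoef c (-1, momentum j) j

/-- The Hamiltonian vector field of `polyEval c`, for `c` supported on zero momentum. -/
def vf {k : ℕ} (c : (Fin (k + 1) → Mode) → ℂ) (z : Gevrey σ θ) : Gevrey σ θ :=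
  ∑' j : Fin k → Mode, single (momentum j) (vfCoef c j * mono z j)

lemma norm_vfCoef_le {k : ℕ} {c : (Fin (k + 1) → Mode) → ℂ} {B : ℝ} (hB : ∀ j, ‖c j‖ ≤ B)
    (j : Fin k → Mode) : ‖vfCoef c j‖ ≤ (k + 1) * B := by
  rw [vfCoef, norm_mul, Complex.norm_I, one_mul]
  exact norm_dcoef_le hB _ _

lemma bound_nonneg {k : ℕ} {c : (Fin k → Mode) → ℂ} {B : ℝ} (hB : ∀ j, ‖c j‖ ≤ B) : 0 ≤ B :=
  (norm_nonneg _).trans (hB fun _ => (1, 0))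

/-- The single mode produced by `j` costs twice the weight of its momentum, which the weights of the
entries of `j` pay for. -/
lemma norm_vf_term_le (hσ : 0 < σ) (hθ : 0 < θ) (hθ1 : θ < 1) {k : ℕ}
    {c : (Fin (k + 1) → Mode) → ℂ} {B : ℝ} (hB : ∀ j, ‖c j‖ ≤ B) (j : Fin k → Mode) :
    ‖(singleL (momentum j) : ℂ →L[ℝ] Gevrey σ θ).comp (ContinuousLinearMap.mul ℝ ℂ (vfCoef c j))‖
      ≤ 2 * (k + 1) * B * tupleWeight σ θ j := by
  have h0 := bound_nonneg hB
  refine (ContinuousLinearMap.opNorm_comp_le _ _).trans ?_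
  rw [norm_mulL]
  calc _ ≤ 2 * tupleWeight σ θ j * ((k + 1) * B) :=
        mul_le_mul ((norm_singleL_le _).trans (by
          have := gevreyWeight_momentum_le hσ hθ hθ1 j; linarith)) (norm_vfCoef_le hB j)
          (norm_nonneg _) (by have := tupleWeight_pos σ θ j; positivity)
    _ = _ := by ring

/-- The vector field as a multilinear map. -/
def vfML (hσ : 0 < σ) (hθ : 0 < θ) (hθ1 : θ < 1) {k : ℕ}
    {c : (Fin (k + 1) → Mode) → ℂ} {B : ℝ} (hB : ∀ j, ‖c j‖ ≤ B) :
    ContinuousMultilinearMap ℝ (fun _ : Fin k => Gevrey σ θ) (Gevrey σ θ) :=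
  tupleML _ (2 * (k + 1) * B) (norm_vf_term_le hσ hθ hθ1 hB)

section

variable (hσ : 0 < σ) (hθ : 0 < θ) (hθ1 : θ < 1) {k : ℕ}
  {c : (Fin (k + 1) → Mode) → ℂ} {B : ℝ} (hB : ∀ j, ‖c j‖ ≤ B)

include hσ in
lemma weighted_bound {k : ℕ} {c : (Fin k → Mode) → ℂ} {B : ℝ} (hB : ∀ j, ‖c j‖ ≤ B)
    (j : Fin k → Mode) : ‖c j‖ ≤ B * tupleWeight σ θ j :=
  (hB j).trans (le_mul_of_one_le_right (bound_nonneg hB) (one_le_tupleWeight hσ j))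

lemma vf_eq_vfML (z : Gevrey σ θ) : vf c z = vfML hσ hθ hθ1 hB (fun _ => z) := rfl

lemma norm_vfML_le : ‖vfML hσ hθ hθ1 hB‖ ≤ 2 * (k + 1) * B :=
  norm_tupleML_le _ _ _ (by have := bound_nonneg hB; positivity)

include hσ hθ hθ1 hB

lemma summable_vf (z : Gevrey σ θ) :
    Summable fun j : Fin k → Mode => (single (momentum j) (vfCoef c j * mono z j) : Gevrey σ θ) :=
  summable_tuple (norm_vf_term_le hσ hθ hθ1 hB) (fun _ => z)

lemma norm_vf_le (z : Gevrey σ θ) : ‖vf c z‖ ≤ 2 * (k + 1) * B * ‖z‖ ^ k := by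
  rw [vf_eq_vfML hσ hθ hθ1 hB]
  refine (ContinuousMultilinearMap.le_opNorm _ _).trans ?_
  rw [Finset.prod_const, Finset.card_univ, Fintype.card_fin]
  exact mul_le_mul_of_nonneg_right (norm_vfML_le hσ hθ hθ1 hB) (by positivity)

lemma contDiff_vf : ContDiff ℝ ∞ (vf c : Gevrey σ θ → Gevrey σ θ) :=
  contDiff_diag (vfML hσ hθ hθ1 hB)

lemma norm_vf_sub_le (x y : Gevrey σ θ) {S : ℝ} (hx : ‖x‖ ≤ S) (hy : ‖y‖ ≤ S) :
    ‖vf c x - vf c y‖ ≤ 2 * (k + 1) * B * k * S ^ (k - 1) * ‖x - y‖ := by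
  have h0 := bound_nonneg hB
  have hS : 0 ≤ S := (norm_nonneg _).trans hx
  rw [vf_eq_vfML hσ hθ hθ1 hB, vf_eq_vfML hσ hθ hθ1 hB]
  refine (ContinuousMultilinearMap.norm_image_sub_le _ _ _).trans ?_
  rw [Fintype.card_fin]
  have h1 : ∀ w : Gevrey σ θ, ‖fun _ : Fin k => w‖ ≤ ‖w‖ := fun w =>
    (pi_norm_le_iff_of_nonneg (norm_nonneg _)).2 fun _ => le_rfl
  have h2 : ‖(fun _ : Fin k => x) - (fun _ => y)‖ ≤ ‖x - y‖ := h1 (x - y)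
  gcongr
  · exact norm_vfML_le hσ hθ hθ1 hB
  · exact max_le ((h1 x).trans hx) ((h1 y).trans hy)

/-- By momentum conservation the tuple `j` feeds only the frequency `momentum j`; in the sum for the
frequency `a`, all other tuples have zero coefficient. -/
lemma vf_apply (hc : MomentumSupported c) (z : Gevrey σ θ) (a : ℤ) :
    vf c z a = Complex.I * polyEval (dcoef c (-1, a)) z := by
  have h1 := ((summable_vf hσ hθ hθ1 hB z).hasSum.mapL (coordL hσ a)).tsum_eq
  rw [polyEval, ← tsum_mul_left]
  refine h1.symm.trans (tsum_congr fun j => ?_)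
  rw [coordL_apply, single_apply, vfCoef]
  split_ifs with h
  · rw [h, mul_assoc]
  · rw [hc.dcoef_neg h, zero_mul, mul_zero]

lemma hamVF_polyEval (hc : MomentumSupported c) (z : Gevrey σ θ) (a : ℤ) :
    hamVF (polyEval c) z a = vf c z a := by
  rw [vf_apply hσ hθ hθ1 hB hc, hamVF, dzbar_polyEval (weighted_bound hσ hB)]

end

/-! ### The symplectic form -/

lemma summable_pairing (hσ : 0 < σ) (u w : Gevrey σ θ) : Summable fun a => u a * conj (w a) := by
  refine Summable.of_norm_bounded ((summable w).mul_left ‖u‖) fun a => ?_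
  rw [norm_mul, RCLike.norm_conj]
  have h1 := weight_mul_norm_le u a
  have h2 := one_le_gevreyWeight (θ := θ) hσ a
  have h3 := norm_nonneg (u a)
  have h5 : ‖u a‖ ≤ ‖u‖ := by nlinarith
  have h4 : ‖w a‖ ≤ gevreyWeight σ θ a * ‖w a‖ := le_mul_of_one_le_left (norm_nonneg _) h2
  exact mul_le_mul h5 h4 (norm_nonneg _) (norm_nonneg _)

lemma norm_pairing_le (hσ : 0 < σ) (u w : Gevrey σ θ) :
    ‖∑' a, u a * conj (w a)‖ ≤ ‖u‖ * ‖w‖ := by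
  have h6 : HasSum (fun a => ‖u‖ * (gevreyWeight σ θ a * ‖w a‖)) (‖u‖ * (‖w‖ / 2)) := by
    have := ((summable w).hasSum).mul_left ‖u‖
    rwa [show ‖w‖ / 2 = ∑' a, gevreyWeight σ θ a * ‖w a‖ by rw [norm_def]; ring]
  have h := tsum_of_norm_bounded h6 (f := fun a => u a * conj (w a)) fun a => by
    rw [norm_mul, RCLike.norm_conj]
    have h1 := weight_mul_norm_le u a
    have h2 := one_le_gevreyWeight (θ := θ) hσ a
    have h3 := norm_nonneg (u a)
    have h5 : ‖u a‖ ≤ ‖u‖ := by nlinarith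
    have h4 : ‖w a‖ ≤ gevreyWeight σ θ a * ‖w a‖ := le_mul_of_one_le_left (norm_nonneg _) h2
    exact mul_le_mul h5 h4 (norm_nonneg _) (norm_nonneg _)
  refine h.trans ?_
  have := norm_nonneg w
  have := norm_nonneg u
  nlinarith [mul_nonneg (norm_nonneg u) (norm_nonneg w)]

/-- The symplectic form `(i u, w)_{L²}`. -/
def omega (hσ : 0 < σ) : Gevrey σ θ →L[ℝ] Gevrey σ θ →L[ℝ] ℝ :=
  LinearMap.mkContinuous₂
    (LinearMap.mk₂ ℝ (fun u w => (Complex.I * ∑' a, u a * conj (w a)).re)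
      (fun u v w => by
        rw [← Complex.add_re, ← mul_add,
          ← (summable_pairing hσ u w).tsum_add (summable_pairing hσ v w)]
        congr 3
        funext a
        rw [add_apply, add_mul])
      (fun r u w => by
        rw [smul_eq_mul, ← Complex.re_ofReal_mul, mul_left_comm, ← tsum_mul_left (a := (r : ℂ))]
        congr 3
        funext a
        rw [smul_apply, Complex.real_smul, mul_assoc])
      (fun u v w => by
        rw [← Complex.add_re, ← mul_add,
          ← (summable_pairing hσ u v).tsum_add (summable_pairing hσ u w)]
        congr 3
        funext a
        rw [add_apply, map_add, mul_add])
      (fun r u w => by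
        rw [smul_eq_mul, ← Complex.re_ofReal_mul, mul_left_comm, ← tsum_mul_left (a := (r : ℂ))]
        congr 3
        funext a
        rw [smul_apply, Complex.real_smul, map_mul, Complex.conj_ofReal]
        ring)) 1 (fun u w => by
      rw [LinearMap.mk₂_apply, one_mul]
      refine (Complex.abs_re_le_norm _).trans ?_
      rw [norm_mul, Complex.norm_I, one_mul]
      exact norm_pairing_le hσ u w)

lemma omega_apply (hσ : 0 < σ) (u w : Gevrey σ θ) :
    omega hσ u w = (Complex.I * ∑' a, u a * conj (w a)).re := rfl

lemma omega_eq_l2Inner (hσ : 0 < σ) (u w : Gevrey σ θ) :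
    omega hσ u w = l2Inner (fun a => Complex.I * u a) w := by
  rw [omega_apply, l2Inner, ← tsum_mul_left]
  simp only [mul_assoc]

lemma omega_antisymm (hσ : 0 < σ) (u w : Gevrey σ θ) : omega hσ u w = -omega hσ w u := by
  rw [omega_apply, omega_apply, ← Complex.conj_re, map_mul, Complex.conj_tsum, Complex.conj_I,
    neg_mul, Complex.neg_re]
  congr 4
  funext a
  rw [map_mul, Complex.conj_conj, mul_comm]

lemma tsum_mode (f : Mode → ℂ) (h1 : Summable fun a : ℤ => f (1, a))
    (h2 : Summable fun a : ℤ => f (-1, a)) :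
    ∑' i, f i = ∑' a : ℤ, f (1, a) + ∑' a : ℤ, f (-1, a) := by
  have hi : ∀ δ : ℤˣ, Function.Injective fun a : ℤ => ((δ, a) : Mode) :=
    fun δ a b h => (Prod.ext_iff.1 h).2
  have key : ∀ δ : ℤˣ, Summable (fun a : ℤ => f (δ, a)) →
      HasSum (fun i : Mode => if i.1 = δ then f i else 0) (∑' a : ℤ, f (δ, a)) := by
    intro δ hδ
    rw [← (hi δ).hasSum_iff]
    · simpa [Function.comp_def] using hδ.hasSum
    · rintro ⟨ε, a⟩ hx
      refine if_neg fun h => hx ⟨a, ?_⟩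
      simp only at h
      rw [h]
  refine (((key 1 h1).add (key (-1) h2)).congr_fun fun i => ?_).tsum_eq
  rcases mode_cases i with h | h <;> rw [h] <;> simp

/-- `ω(X_P(z), w) = -½ dP(z) w`. -/
lemma omega_vf (hσ : 0 < σ) (hθ : 0 < θ) (hθ1 : θ < 1) {k : ℕ}
    {c : (Fin (k + 1) → Mode) → ℂ} {B : ℝ} (hB : ∀ j, ‖c j‖ ≤ B) (hc : MomentumSupported c)
    (hr : RealCoeffs c) (z w : Gevrey σ θ) :
    omega hσ (vf c z) w = -(1 / 2) * (fderiv ℝ (polyEval c) z w).re := by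
  have hw := weighted_bound (θ := θ) hσ hB
  have hg : ∀ a, polyEval (dcoef c (1, a)) z = conj (polyEval (dcoef c (-1, a)) z) := fun a => by
    rw [conj_polyEval_dcoef hr]; simp [Mode.conj]
  have hs : Summable fun a => conj (w a) * polyEval (dcoef c (-1, a)) z := by
    have := (summable_pairing hσ (vf c z) w).mul_left (-Complex.I)
    refine this.congr fun a => ?_
    rw [vf_apply hσ hθ hθ1 hB hc]
    linear_combination (-(conj (w a) * polyEval (dcoef c (-1, a)) z)) * Complex.I_sq
  have hs' : Summable fun a => w a * polyEval (dcoef c (1, a)) z := by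
    refine (Complex.conjCLE.summable.2 hs).congr fun a => ?_
    rw [Complex.conjCLE_apply, map_mul, hg, Complex.conj_conj]
  have h1 : fderiv ℝ (polyEval c) z w
      = ∑' a, w a * polyEval (dcoef c (1, a)) z + ∑' a, conj (w a) * polyEval (dcoef c (-1, a)) z := by
    rw [fderiv_polyEval hw, tsum_mode (fun i => sc w i * polyEval (dcoef c i) z)]
    · simp only [sc_one, sc_neg_one]
    · simpa only [sc_one] using hs'
    · simpa only [sc_neg_one] using hs
  -- For a real polynomial the holomorphic and antiholomorphic parts of the differential are
  -- conjugate, so the differential is twice the real part of one of them.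
  have h2 : ∑' a, w a * polyEval (dcoef c (1, a)) z
      = conj (∑' a, conj (w a) * polyEval (dcoef c (-1, a)) z) := by
    rw [Complex.conj_tsum]
    refine tsum_congr fun a => ?_
    rw [map_mul, hg, Complex.conj_conj]
  rw [h1, h2, omega_apply, ← tsum_mul_left]
  have h3 : ∑' a, Complex.I * (vf c z a * conj (w a))
      = -∑' a, conj (w a) * polyEval (dcoef c (-1, a)) z := by
    rw [← tsum_neg]
    refine tsum_congr fun a => ?_
    rw [vf_apply hσ hθ hθ1 hB hc]
    linear_combination (conj (w a) * polyEval (dcoef c (-1, a)) z) * Complex.I_sq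
  rw [h3]
  simp
  ring

end Gevrey
end

noncomputable section

/-! ### Poisson brackets -/

/-- The first `k` entries of a tuple of length `n = k + l`. -/
def headTuple {k l n : ℕ} (h : k + l = n) (j : Fin n → Mode) : Fin k → Mode :=
  fun i => j (Fin.cast h (Fin.castAdd l i))

/-- The last `l` entries of a tuple of length `n = k + l`. -/
def tailTuple {k l n : ℕ} (h : k + l = n) (j : Fin n → Mode) : Fin l → Mode :=
  fun i => j (Fin.cast h (Fin.natAdd k i))

/-- Splitting a tuple in two. -/
def splitTuple {k l n : ℕ} (h : k + l = n) :
    (Fin n → Mode) ≃ (Fin k → Mode) × (Fin l → Mode) where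
  toFun j := (headTuple h j, tailTuple h j)
  invFun x := fun i => Fin.append x.1 x.2 (Fin.cast h.symm i)
  left_inv j := by
    subst h
    funext i
    refine Fin.addCases (fun i => ?_) (fun i => ?_) i <;> simp [headTuple, tailTuple]
  right_inv x := by
    subst h
    ext i <;> simp [headTuple, tailTuple]

/-- The coefficients of the Poisson bracket `dQ(X_χ)`. -/
def bracket {k l n : ℕ} (h : k + l = n) (χ : (Fin (k + 1) → Mode) → ℂ)
    (Q : (Fin (l + 1) → Mode) → ℂ) (j : Fin n → Mode) : ℂ :=
  Complex.I *
    (dcoef χ (-1, momentum (headTuple h j)) (headTuple h j)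
        * dcoef Q (1, momentum (headTuple h j)) (tailTuple h j)
      - dcoef χ (1, -momentum (headTuple h j)) (headTuple h j)
        * dcoef Q (-1, -momentum (headTuple h j)) (tailTuple h j))

section

variable {k l n : ℕ} (h : k + l = n)

lemma charge_split (j : Fin n → Mode) :
    charge j = charge (headTuple h j) + charge (tailTuple h j) := by
  subst h
  simp [charge, headTuple, tailTuple, Fin.sum_univ_add]

lemma momentum_split (j : Fin n → Mode) :
    momentum j = momentum (headTuple h j) + momentum (tailTuple h j) := by
  subst h
  simp [momentum, headTuple, tailTuple, Fin.sum_univ_add]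

lemma mono_split {σ θ : ℝ} (z : Gevrey σ θ) (j : Fin n → Mode) :
    z.mono j = z.mono (headTuple h j) * z.mono (tailTuple h j) := by
  subst h
  simp [Gevrey.mono, headTuple, tailTuple, Fin.prod_univ_add]

lemma headTuple_conj (j : Fin n → Mode) : headTuple h (conjTuple j) = conjTuple (headTuple h j) :=
  rfl

lemma tailTuple_conj (j : Fin n → Mode) : tailTuple h (conjTuple j) = conjTuple (tailTuple h j) :=
  rfl

variable {χ : (Fin (k + 1) → Mode) → ℂ} {Q : (Fin (l + 1) → Mode) → ℂ}

lemma norm_bracket_le {B C : ℝ} (hχ : ∀ j, ‖χ j‖ ≤ B) (hQ : ∀ j, ‖Q j‖ ≤ C) (j : Fin n → Mode) :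
    ‖bracket h χ Q j‖ ≤ 2 * (k + 1) * (l + 1) * B * C := by
  have hB := Gevrey.bound_nonneg hχ
  rw [bracket, norm_mul, Complex.norm_I, one_mul]
  refine (norm_sub_le _ _).trans ?_
  rw [norm_mul, norm_mul]
  have key : ∀ i i', ‖dcoef χ i (headTuple h j)‖ * ‖dcoef Q i' (tailTuple h j)‖
      ≤ ((k + 1) * B) * ((l + 1) * C) := fun i i' =>
    mul_le_mul (norm_dcoef_le hχ _ _) (norm_dcoef_le hQ _ _) (norm_nonneg _) (by positivity)
  refine (add_le_add (key _ _) (key _ _)).trans (le_of_eq ?_)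
  ring

lemma momentumSupported_bracket (hχ : MomentumSupported χ) (hQ : MomentumSupported Q) :
    MomentumSupported (bracket h χ Q) := by
  intro j hj
  rw [charge_split h, momentum_split h]
  have : dcoef χ (-1, momentum (headTuple h j)) (headTuple h j)
        * dcoef Q (1, momentum (headTuple h j)) (tailTuple h j) ≠ 0 ∨
      dcoef χ (1, -momentum (headTuple h j)) (headTuple h j)
        * dcoef Q (-1, -momentum (headTuple h j)) (tailTuple h j) ≠ 0 := by
    by_contra hcon
    push Not at hcon
    exact hj (by rw [bracket, hcon.1, hcon.2, sub_zero, mul_zero])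
  rcases this with h1 | h1
  · have h2 := hχ.of_dcoef_ne (left_ne_zero_of_mul h1)
    have h3 := hQ.of_dcoef_ne (right_ne_zero_of_mul h1)
    simp only [Units.val_neg, Units.val_one] at h2 h3
    constructor <;> linarith [h2.1, h2.2, h3.1, h3.2]
  · have h2 := hχ.of_dcoef_ne (left_ne_zero_of_mul h1)
    have h3 := hQ.of_dcoef_ne (right_ne_zero_of_mul h1)
    simp only [Units.val_neg, Units.val_one] at h2 h3
    constructor <;> linarith [h2.1, h2.2, h3.1, h3.2]

lemma realCoeffs_bracket (hχ : RealCoeffs χ) (hQ : RealCoeffs Q) :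
    RealCoeffs (bracket h χ Q) := by
  intro j
  simp only [bracket, map_mul, map_sub, conj_dcoef hχ, conj_dcoef hQ, Complex.conj_I,
    headTuple_conj, tailTuple_conj, momentum_conjTuple, Mode.conj, neg_neg]
  ring

end

namespace Gevrey

variable {σ θ : ℝ}

section

variable (hσ : 0 < σ) (hθ : 0 < θ) (hθ1 : θ < 1) {k : ℕ}
  {c : (Fin (k + 1) → Mode) → ℂ} {B : ℝ} (hB : ∀ j, ‖c j‖ ≤ B)

include hσ hθ hθ1 hB

/-- A linear form applied to a Hamiltonian vector field. -/
lemma apply_vf (hr : RealCoeffs c) (L : Gevrey σ θ →L[ℝ] ℂ) (g : Mode → ℂ) (G : ℝ)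
    (hL : ∀ a ζ, L (single a ζ) = ζ * g (1, a) + conj ζ * g (-1, a))
    (hg : ∀ i, ‖g i‖ ≤ G * gevreyWeight σ θ i.2) (z : Gevrey σ θ) :
    L (vf c z) = ∑' j : Fin k → Mode, Complex.I *
      (dcoef c (-1, momentum j) j * g (1, momentum j)
        - dcoef c (1, -momentum j) j * g (-1, -momentum j)) * mono z j := by
  have hG : 0 ≤ G := by
    have := (norm_nonneg _).trans (hg (1, 0))
    exact nonneg_of_mul_nonneg_left this (gevreyWeight_pos _ _ _)
  have hb := bound_nonneg hB
  have hbound : ∀ (δ : ℤˣ) (j : Fin k → Mode), ‖vfCoef c j * g (δ, momentum j)‖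
      ≤ (k + 1) * B * G * tupleWeight σ θ j := by
    intro δ j
    rw [norm_mul]
    calc _ ≤ ((k + 1) * B) * (G * tupleWeight σ θ j) :=
          mul_le_mul (norm_vfCoef_le hB j) ((hg (δ, momentum j)).trans (mul_le_mul_of_nonneg_left
            (gevreyWeight_momentum_le hσ hθ hθ1 j) hG)) (norm_nonneg _) (by positivity)
      _ = _ := by ring
  have hs1 : Summable fun j : Fin k → Mode => vfCoef c j * g (1, momentum j) * mono z j :=
    summable_poly (c := fun j : Fin k → Mode => vfCoef c j * g (1, momentum j))
      (B := (k + 1) * B * G) (hbound 1) z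
  have hbound2 : ∀ j : Fin k → Mode, ‖conj (vfCoef c (conjTuple j)) * g (-1, -momentum j)‖
      ≤ (k + 1) * B * G * tupleWeight σ θ j := by
    intro j
    have := hbound (-1) (conjTuple j)
    rw [momentum_conjTuple] at this
    rw [norm_mul, RCLike.norm_conj, ← norm_mul]
    exact this
  have hs2 : Summable fun j : Fin k → Mode =>
      conj (vfCoef c (conjTuple j)) * g (-1, -momentum j) * mono z j :=
    summable_poly (c := fun j : Fin k → Mode => conj (vfCoef c (conjTuple j)) * g (-1, -momentum j))
      (B := (k + 1) * B * G) hbound2 z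
  -- The antilinear part contains `conj (mono z j)`, which is again a monomial after reindexing by
  -- `conjTuple`.
  have hs2' : Summable fun j : Fin k → Mode => conj (vfCoef c j * mono z j) * g (-1, momentum j) := by
    rw [← (conjTupleEquiv k).summable_iff]
    refine hs2.congr fun j => ?_
    change _ = conj (vfCoef c (conjTuple j) * mono z (conjTuple j)) * g (-1, momentum (conjTuple j))
    rw [map_mul, conj_mono, conjTuple_conjTuple, momentum_conjTuple]
    ring
  have h1 := ((summable_vf hσ hθ hθ1 hB z).hasSum.mapL L).tsum_eq
  have h2 : L (vf c z) = ∑' j : Fin k → Mode, (vfCoef c j * g (1, momentum j) * mono z j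
      + conj (vfCoef c j * mono z j) * g (-1, momentum j)) := by
    refine h1.symm.trans (tsum_congr fun j => ?_)
    rw [hL]
    ring
  rw [h2, hs1.tsum_add hs2', ← (conjTupleEquiv k).tsum_eq
    (fun j => conj (vfCoef c j * mono z j) * g (-1, momentum j))]
  refine (hs1.tsum_add ((conjTupleEquiv k).summable_iff.2 hs2')).symm.trans ?_
  refine tsum_congr fun j => ?_
  change _ + conj (vfCoef c (conjTuple j) * mono z (conjTuple j)) * g (-1, momentum (conjTuple j)) = _
  rw [map_mul, conj_mono, conjTuple_conjTuple, momentum_conjTuple, vfCoef, vfCoef, map_mul,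
    conj_dcoef hr, conjTuple_conjTuple, momentum_conjTuple, Complex.conj_I]
  simp only [Mode.conj, neg_neg]
  ring

/-- A monomial of the bracket is a monomial of the field, the head of the tuple, times a monomial of
the gradient of `Q`, the tail. The contracted mode is fixed by the momentum of the head. -/
lemma fderiv_polyEval_vf (hr : RealCoeffs c) {l n : ℕ} (h : k + l = n)
    {Q : (Fin (l + 1) → Mode) → ℂ} {C : ℝ} (hQ : ∀ j, ‖Q j‖ ≤ C) (z : Gevrey σ θ) :
    fderiv ℝ (polyEval Q) z (vf c z) = polyEval (bracket h c Q) z := by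
  have hw := weighted_bound (θ := θ) hσ hQ
  rw [apply_vf hσ hθ hθ1 hB hr _ (fun i => polyEval (dcoef Q i) z) ((l + 1) * C * ‖z‖ ^ l)
    (fun a ζ => fderiv_polyEval_single hw z a ζ) (fun i => ?_)]
  swap
  · refine (norm_polyEval_le (norm_dcoef_le_weight hw i) z).trans (le_of_eq ?_)
    ring
  have hbr := summable_poly (weighted_bound (θ := θ) hσ (norm_bracket_le h hB hQ)) z
  have hprod := ((splitTuple h).symm.summable_iff.2 hbr).tsum_prod
  simp only [Function.comp_apply] at hprod
  rw [polyEval, ← (splitTuple h).symm.tsum_eq, hprod]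
  refine tsum_congr fun j => ?_
  have hsum : ∀ i, Summable fun j' => dcoef Q i j' * mono z j' := fun i =>
    summable_poly (norm_dcoef_le_weight hw i) z
  have hsplit : ∀ j', (splitTuple h) ((splitTuple h).symm (j, j')) = (j, j') :=
    fun j' => (splitTuple h).apply_symm_apply _
  have hhead : ∀ j', headTuple h ((splitTuple h).symm (j, j')) = j :=
    fun j' => congrArg Prod.fst (hsplit j')
  have htail : ∀ j', tailTuple h ((splitTuple h).symm (j, j')) = j' :=
    fun j' => congrArg Prod.snd (hsplit j')
  simp only [bracket, mono_split h, hhead, htail]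
  rw [polyEval, polyEval, ← tsum_mul_left, ← tsum_mul_left,
    ← ((hsum _).mul_left _).tsum_sub ((hsum _).mul_left _), ← tsum_mul_left, ← tsum_mul_right]
  refine tsum_congr fun j' => ?_
  ring

end

/-! ### The quadratic Hamiltonian -/

/-- The coefficients of `L₂`. -/
def l2Coef (j : Fin 2 → Mode) : ℂ :=
  if (j 0).1 = 1 ∧ j 1 = Mode.conj (j 0) then ((j 0).2 : ℂ) ^ 2 else 0

lemma exists_l2Coef_bound (hσ : 0 < σ) (hθ : 0 < θ) :
    ∃ B : ℝ, ∀ j, ‖l2Coef j‖ ≤ B * tupleWeight σ θ j := by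
  obtain ⟨B, hB, h⟩ := exists_sq_le_gevreyWeight hσ hθ
  refine ⟨B, fun j => ?_⟩
  have hw := tupleWeight_pos σ θ j
  rw [l2Coef]
  split_ifs
  · rw [norm_pow, Complex.norm_intCast, sq_abs]
    refine (h _).trans (mul_le_mul_of_nonneg_left ?_ hB)
    rw [tupleWeight, Fin.prod_univ_two]
    exact le_mul_of_one_le_right (gevreyWeight_pos _ _ _).le (one_le_gevreyWeight hσ _)
  · rw [norm_zero]; positivity

lemma polyEval_l2Coef (z : Gevrey σ θ) : polyEval l2Coef z = (NLSP.L2 z : ℂ) := by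
  have hinj : Function.Injective fun a : ℤ => (![((1 : ℤˣ), a), ((-1 : ℤˣ), a)] : Fin 2 → Mode) := by
    intro a b hab
    exact (Prod.ext_iff.1 (congrFun hab 0)).2
  rw [polyEval, ← hinj.tsum_eq, NLSP.L2, Complex.ofReal_tsum]
  · refine tsum_congr fun a => ?_
    simp only [l2Coef, mono, Fin.prod_univ_two]
    rw [if_pos (by simp [Mode.conj])]
    simp only [Matrix.cons_val_zero, Matrix.cons_val_one, sc_one, sc_neg_one]
    rw [Complex.mul_conj, Complex.normSq_eq_norm_sq]
    push_cast
    ring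
  · intro j hj
    have hne : l2Coef j ≠ 0 := left_ne_zero_of_mul hj
    rw [l2Coef] at hne
    have hc := (ite_ne_right_iff.1 hne).1
    refine ⟨(j 0).2, ?_⟩
    funext i
    fin_cases i
    · exact Prod.ext hc.1.symm rfl
    · refine Eq.trans ?_ hc.2.symm
      simp [Mode.conj, hc.1]

lemma polyEval_dcoef_l2Coef (z : Gevrey σ θ) (i : Mode) :
    polyEval (dcoef l2Coef i) z = (i.2 : ℂ) ^ 2 * sc z (Mode.conj i) := by
  have hd : ∀ j : Fin 1 → Mode, dcoef l2Coef i j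
      = if j 0 = Mode.conj i then (i.2 : ℂ) ^ 2 else 0 := by
    intro j
    rw [dcoef, Fin.sum_univ_two]
    have e0 : ((0 : Fin 2).insertNth i j : Fin 2 → Mode) = ![i, j 0] := by
      funext x; fin_cases x <;> rfl
    have e1 : ((1 : Fin 2).insertNth i j : Fin 2 → Mode) = ![j 0, i] := by
      funext x; fin_cases x <;> rfl
    rw [e0, e1]
    simp only [l2Coef, Matrix.cons_val_zero, Matrix.cons_val_one]
    generalize j 0 = b
    obtain ⟨δ, a⟩ := i
    obtain ⟨ε, b⟩ := b
    simp only [Mode.conj, Prod.mk.injEq]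
    rcases Int.units_eq_one_or δ with rfl | rfl <;> rcases Int.units_eq_one_or ε with rfl | rfl <;>
      rcases eq_or_ne b a with rfl | hab <;> simp [*, Ne.symm]
  rw [polyEval, tsum_eq_single (fun _ => Mode.conj i)]
  · rw [hd]; simp [mono]
  · intro j hj
    rw [hd, if_neg, zero_mul]
    intro h
    exact hj (funext fun x => by rw [Subsingleton.elim x 0, h])

/-- The flow of `L₂` rotates each `zₐ` at speed `a²`, so monomials are eigenvectors of the bracket
with `L₂`, the eigenvalue being given by the divisor. -/
lemma fderiv_L2_vf (hσ : 0 < σ) (hθ : 0 < θ) (hθ1 : θ < 1) {k : ℕ}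
    {c : (Fin (k + 1) → Mode) → ℂ} {B : ℝ} (hB : ∀ j, ‖c j‖ ≤ B) (hc : MomentumSupported c)
    (hr : RealCoeffs c) (z : Gevrey σ θ) :
    fderiv ℝ (polyEval l2Coef) z (vf c z)
      = polyEval (fun j => -Complex.I * divisor j * c j) z := by
  obtain ⟨B₂, hB₂⟩ := exists_l2Coef_bound hσ hθ
  obtain ⟨B₁, hB₁0, hB₁⟩ := exists_sq_le_gevreyWeight hσ hθ
  have hb := bound_nonneg hB
  rw [apply_vf hσ hθ hθ1 hB hr _ (fun i => polyEval (dcoef l2Coef i) z) ((1 + 1) * B₂ * ‖z‖ ^ 1)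
    (fun a ζ => fderiv_polyEval_single hB₂ z a ζ) (fun i => ?_)]
  swap
  · refine (norm_polyEval_le (norm_dcoef_le_weight hB₂ i) z).trans (le_of_eq ?_)
    push_cast
    ring
  -- The divisor is distributed over the slots. Each `a²` is unbounded but is dominated by the
  -- weight of its slot, which keeps every partial sum summable.
  let f : Fin (k + 1) → (Fin (k + 1) → Mode) → ℂ := fun β j =>
    -Complex.I * (((j β).1 : ℤ) * ((j β).2 : ℂ) ^ 2) * c j
  have hf : ∀ β j, ‖f β j‖ ≤ B * B₁ * tupleWeight σ θ j := by
    intro β j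
    have h1 : ‖(((j β).1 : ℤ) : ℂ)‖ = 1 := by
      rcases Int.units_eq_one_or (j β).1 with h | h <;> simp [h]
    simp only [f, norm_mul, norm_neg, Complex.norm_I, norm_pow, Complex.norm_intCast, sq_abs]
    rw [Complex.norm_intCast] at h1
    rw [h1, one_mul, one_mul, mul_comm, mul_assoc]
    refine mul_le_mul (hB j) ((hB₁ _).trans (mul_le_mul_of_nonneg_left ?_ hB₁0)) (by positivity) hb
    rw [tupleWeight, ← Finset.mul_prod_erase _ _ (Finset.mem_univ β)]
    refine le_mul_of_one_le_right (gevreyWeight_pos _ _ _).le ?_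
    exact Finset.prod_induction _ (fun x => 1 ≤ x) (fun _ _ => one_le_mul_of_one_le_of_one_le) le_rfl
      fun _ _ => one_le_gevreyWeight hσ _
  have h1 : polyEval (fun j => -Complex.I * divisor j * c j) z = ∑ β, polyEval (f β) z := by
    simp only [polyEval]
    rw [← Summable.tsum_finsetSum fun β _ => summable_poly (hf β) z]
    refine tsum_congr fun j => ?_
    rw [← Finset.sum_mul, ← Finset.sum_mul, ← Finset.mul_sum, divisor]
    push_cast
    rfl
  have hs := summable_sum fun β (_ : β ∈ Finset.univ) => summable_grad (hf β) z z β
  have h2 : ∑ β, polyEval (f β) z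
      = ∑' x : Mode × (Fin k → Mode), ∑ β, f β (β.insertNth x.1 x.2) * (sc z x.1 * mono z x.2) := by
    rw [Summable.tsum_finsetSum fun β _ => summable_grad (hf β) z z β]
    refine Finset.sum_congr rfl fun β _ => ?_
    rw [polyEval, ← (Fin.insertNthEquiv (fun _ : Fin (k + 1) => Mode) β).tsum_eq]
    refine tsum_congr fun x => ?_
    rw [← mono_insertNth z β]
    rfl
  have hprod := ((Equiv.prodComm (Fin k → Mode) Mode).summable_iff.2 hs).tsum_prod
  simp only [Function.comp_apply] at hprod
  rw [h1, h2, ← (Equiv.prodComm (Fin k → Mode) Mode).tsum_eq, hprod]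
  refine tsum_congr fun j => ?_
  have h3 : ∀ i : Mode, ∑ β, f β (β.insertNth i j) * (sc z i * mono z j)
      = -Complex.I * ((i.1 : ℤ) * (i.2 : ℂ) ^ 2) * dcoef c i j * (sc z i * mono z j) := by
    intro i
    rw [← Finset.sum_mul, dcoef, Finset.mul_sum]
    simp only [f, Fin.insertNth_apply_same]
  simp only [Equiv.prodComm_apply, Prod.fst_swap, Prod.snd_swap, h3]
  -- Momentum leaves one possible mode of each sign; these are the two terms of the bracket.
  rw [tsum_eq_sum (s := {((-1 : ℤˣ), momentum j), ((1 : ℤˣ), -momentum j)})]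
  · rw [Finset.sum_pair (by simp), polyEval_dcoef_l2Coef, polyEval_dcoef_l2Coef]
    simp only [Mode.conj, neg_neg, Units.val_neg, Units.val_one]
    push_cast
    ring
  · intro i hi
    have : dcoef c i j = 0 := by
      rcases mode_cases i with h | h <;> rw [h] at hi ⊢
      · exact hc.dcoef_pos fun h' => hi (by rw [h']; simp)
      · exact hc.dcoef_neg fun h' => hi (by rw [h']; simp)
    rw [this]
    ring

end Gevrey
end

noncomputable section

/-! ### Formal Lie series -/

/-- Coefficients of a homogeneous polynomial of degree `2 p + 2`. -/
abbrev Coef (p : ℕ) : Type := (Fin (2 * p + 1 + 1) → Mode) → ℂ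

/-- A formal sum of homogeneous polynomials; the `p`-th one has degree `2 p + 2`. -/
abbrev Family : Type := (p : ℕ) → Coef p

/-- The component of degree `2 p + 2` of the Poisson bracket. -/
def bracketAt {a b : ℕ} (p : ℕ) (χ : Coef a) (Q : Coef b) : Coef p :=
  if h : 2 * a + 1 + (2 * b + 1) = 2 * p + 1 + 1 then bracket h χ Q else 0

/-- The derivation `Q ↦ dQ(X_F)` on formal sums. -/
def lieD (F Q : Family) : Family := fun p =>
  ∑ x ∈ Finset.HasAntidiagonal.antidiagonal p, bracketAt p (F x.1) (Q x.2)

lemma bracketAt_zero_left {a b p : ℕ} (Q : Coef b) : bracketAt p (0 : Coef a) Q = 0 := by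
  unfold bracketAt
  split_ifs
  · funext j; simp [bracket, dcoef]
  · rfl

lemma bracketAt_zero_right {a b p : ℕ} (χ : Coef a) : bracketAt p χ (0 : Coef b) = 0 := by
  unfold bracketAt
  split_ifs
  · funext j; simp [bracket, dcoef]
  · rfl

/-- Support and reality of all components. -/
def Family.Good (Q : Family) : Prop := ∀ p, MomentumSupported (Q p) ∧ RealCoeffs (Q p)

lemma momentumSupported_zero {k : ℕ} : MomentumSupported (0 : (Fin k → Mode) → ℂ) :=
  fun _ h => absurd rfl h

lemma realCoeffs_zero {k : ℕ} : RealCoeffs (0 : (Fin k → Mode) → ℂ) := fun _ => by simp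

lemma MomentumSupported.add {k : ℕ} {c d : (Fin k → Mode) → ℂ} (hc : MomentumSupported c)
    (hd : MomentumSupported d) : MomentumSupported (c + d) := by
  intro j hj
  by_cases h : c j = 0
  · exact hd j fun h' => hj (by simp [h, h'])
  · exact hc j h

lemma RealCoeffs.add {k : ℕ} {c d : (Fin k → Mode) → ℂ} (hc : RealCoeffs c)
    (hd : RealCoeffs d) : RealCoeffs (c + d) := fun j => by simp [hc j, hd j]

lemma MomentumSupported.smul {k : ℕ} {c : (Fin k → Mode) → ℂ} (hc : MomentumSupported c) (s : ℝ) :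
    MomentumSupported (s • c) :=
  fun j hj => hc j fun h => hj (by simp [h])

lemma RealCoeffs.smul {k : ℕ} {c : (Fin k → Mode) → ℂ} (hc : RealCoeffs c) (s : ℝ) :
    RealCoeffs (s • c) := fun j => by simp [hc j]

lemma good_sum {k : ℕ} {ι : Type*} (s : Finset ι) (f : ι → (Fin k → Mode) → ℂ)
    (h : ∀ i ∈ s, MomentumSupported (f i) ∧ RealCoeffs (f i)) :
    MomentumSupported (∑ i ∈ s, f i) ∧ RealCoeffs (∑ i ∈ s, f i) :=
  Finset.sum_induction f (fun c => MomentumSupported c ∧ RealCoeffs c)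
    (fun _ _ h h' => ⟨h.1.add h'.1, h.2.add h'.2⟩) ⟨momentumSupported_zero, realCoeffs_zero⟩ h

lemma good_lieD {F Q : Family} (hF : F.Good) (hQ : Q.Good) : Family.Good (lieD F Q) := by
  intro p
  refine good_sum _ _ fun x _ => ?_
  unfold bracketAt
  split_ifs with h
  · exact ⟨momentumSupported_bracket h (hF _).1 (hQ _).1, realCoeffs_bracket h (hF _).2 (hQ _).2⟩
  · exact ⟨momentumSupported_zero, realCoeffs_zero⟩

lemma good_iterate {F Q : Family} (hF : F.Good) (hQ : Q.Good) (k : ℕ) :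
    Family.Good ((lieD F)^[k] Q) := by
  induction k with
  | zero => exact hQ
  | succ k ih => rw [Function.iterate_succ_apply']; exact good_lieD hF ih

/-- Both order-zero components vanish, so in `a + b = p` only indices strictly below `p` contribute.
-/
lemma lieD_congr {F F' Q Q' : Family} {p : ℕ} (hF : ∀ q < p, F q = F' q)
    (hQ : ∀ q < p, Q q = Q' q) (hF0 : F 0 = 0) (hF0' : F' 0 = 0) (hQ0 : Q 0 = 0) (hQ0' : Q' 0 = 0)
    {q : ℕ} (hq : q ≤ p) : lieD F Q q = lieD F' Q' q := by
  refine Finset.sum_congr rfl fun x hx => ?_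
  obtain ⟨a, b⟩ := x
  rw [Finset.HasAntidiagonal.mem_antidiagonal] at hx
  simp only at hx ⊢
  rcases Nat.eq_zero_or_pos a with rfl | ha
  · rw [hF0, hF0', bracketAt_zero_left, bracketAt_zero_left]
  rcases Nat.eq_zero_or_pos b with rfl | hb
  · rw [hQ0, hQ0', bracketAt_zero_right, bracketAt_zero_right]
  rw [hF a (by omega), hQ b (by omega)]

/-- Each derivation raises the lowest order by at least one. At a fixed order the Lie series is
therefore a finite sum. -/
lemma iterate_eq_zero {F Q : Family} (hF0 : F 0 = 0) (hQ0 : Q 0 = 0) (k : ℕ) :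
    ∀ p ≤ k, (lieD F)^[k] Q p = 0 := by
  induction k with
  | zero => intro p hp; rw [Nat.le_zero.1 hp]; exact hQ0
  | succ k ih =>
    intro p hp
    rw [Function.iterate_succ_apply']
    refine Finset.sum_eq_zero fun x hx => ?_
    obtain ⟨a, b⟩ := x
    rw [Finset.HasAntidiagonal.mem_antidiagonal] at hx
    simp only at hx ⊢
    rcases Nat.eq_zero_or_pos a with rfl | ha
    · rw [hF0, bracketAt_zero_left]
    · rw [ih b (by omega), bracketAt_zero_right]

lemma iterate_congr {F F' Q Q' : Family} {p : ℕ} (hF : ∀ q < p, F q = F' q)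
    (hQ : ∀ q < p, Q q = Q' q) (hF0 : F 0 = 0) (hF0' : F' 0 = 0) (hQ0 : Q 0 = 0) (hQ0' : Q' 0 = 0)
    (k : ℕ) : ∀ q < p, (lieD F)^[k] Q q = (lieD F')^[k] Q' q := by
  induction k with
  | zero => exact hQ
  | succ k ih =>
    intro q hq
    rw [Function.iterate_succ_apply', Function.iterate_succ_apply']
    exact lieD_congr hF ih hF0 hF0' (iterate_eq_zero hF0 hQ0 k 0 (Nat.zero_le _))
      (iterate_eq_zero hF0' hQ0' k 0 (Nat.zero_le _)) hq.le

lemma lieD_support {F Q : Family} {A B : ℕ} (hF : ∀ a, A < a → F a = 0) (hQ : ∀ b, B < b → Q b = 0) :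
    ∀ p, A + B < p → lieD F Q p = 0 := by
  intro p hp
  refine Finset.sum_eq_zero fun x hx => ?_
  obtain ⟨a, b⟩ := x
  rw [Finset.HasAntidiagonal.mem_antidiagonal] at hx
  simp only at hx ⊢
  by_cases ha : A < a
  · rw [hF a ha, bracketAt_zero_left]
  · rw [hQ b (by omega), bracketAt_zero_right]

/-! ### The quartic Hamiltonian -/

/-- Half of the coefficients of the quartic Hamiltonian. -/
def quarticHalf (j : Fin 4 → Mode) : ℂ :=
  if (j 0).1 = 1 ∧ (j 1).1 = 1 ∧ (j 2).1 = -1 ∧ (j 3).1 = -1 ∧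
    (j 0).2 + (j 1).2 = (j 2).2 + (j 3).2 ∧ (j 0).2 ≠ (j 2).2
  then 1 / (4 * (((j 0).2 : ℂ) - ((j 2).2 : ℂ)) ^ 2) else 0

/-- The coefficients of the quartic Hamiltonian. -/
def quarticCoef (j : Fin 4 → Mode) : ℂ := quarticHalf j + quarticHalf (conjTuple j)

/-- The quartic Hamiltonian as a formal sum. -/
def quartic : Family
  | 1 => quarticCoef
  | _ => 0

lemma conj_quarticHalf (j : Fin 4 → Mode) : conj (quarticHalf j) = quarticHalf j := by
  unfold quarticHalf
  split_ifs <;> simp [map_ofNat]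

lemma norm_quarticHalf_le (j : Fin 4 → Mode) : ‖quarticHalf j‖ ≤ 1 / 4 := by
  unfold quarticHalf
  split_ifs with h
  · have h1 : (1 : ℝ) ≤ |((j 0).2 : ℝ) - (j 2).2| := by
      exact_mod_cast Int.one_le_abs (sub_ne_zero.2 h.2.2.2.2.2)
    have h2 : ‖((j 0).2 : ℂ) - ((j 2).2 : ℂ)‖ = |((j 0).2 : ℝ) - (j 2).2| := by
      rw [← Int.cast_sub, Complex.norm_intCast, Int.cast_sub]
    rw [norm_div, norm_mul, norm_pow, h2, norm_one]
    simp only [Complex.norm_ofNat]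
    refine one_div_le_one_div_of_le (by norm_num) ?_
    nlinarith
  · simp

lemma norm_quarticCoef_le (j : Fin 4 → Mode) : ‖quarticCoef j‖ ≤ 1 / 2 := by
  refine (norm_add_le _ _).trans ?_
  linarith [norm_quarticHalf_le j, norm_quarticHalf_le (conjTuple j)]

/-- `quarticHalf` has real coefficients but puts the two `z` first and the two `\bar z` last, so
conjugating its tuples does not preserve it; adding the conjugate copy repairs this. -/
lemma realCoeffs_quarticCoef : RealCoeffs quarticCoef := by
  intro j
  rw [quarticCoef, quarticCoef, map_add, conj_quarticHalf, conj_quarticHalf, conjTuple_conjTuple,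
    add_comm]

lemma momentumSupported_quarticHalf : MomentumSupported quarticHalf := by
  intro j hj
  obtain ⟨h0, h1, h2, h3, h4, -⟩ := (ite_ne_right_iff.1 hj).1
  simp only [charge, momentum, Fin.sum_univ_four, h0, h1, h2, h3, Units.val_neg, Units.val_one]
  constructor
  · norm_num
  · linarith

lemma momentumSupported_quarticCoef : MomentumSupported quarticCoef := by
  refine momentumSupported_quarticHalf.add fun j hj => ?_
  have := momentumSupported_quarticHalf _ hj
  rw [charge_conjTuple, momentum_conjTuple] at this
  constructor <;> linarith [this.1, this.2]

lemma good_quartic : quartic.Good := by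
  intro p
  match p with
  | 0 => exact ⟨momentumSupported_zero, realCoeffs_zero⟩
  | 1 => exact ⟨momentumSupported_quarticCoef, realCoeffs_quarticCoef⟩
  | p + 2 => exact ⟨momentumSupported_zero, realCoeffs_zero⟩

lemma quartic_of_ne {p : ℕ} (h : p ≠ 1) : quartic p = 0 := by
  match p with
  | 0 => rfl
  | 1 => exact absurd rfl h
  | p + 2 => rfl

/-! ### The homological equation and the generator -/

/-- The derivative of `L₂` along the Hamiltonian field. -/
def quadD {k : ℕ} (c : (Fin k → Mode) → ℂ) : (Fin k → Mode) → ℂ :=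
  fun j => -Complex.I * divisor j * c j

/-- The solution of the homological equation. -/
def solve {k : ℕ} (s : (Fin k → Mode) → ℂ) : (Fin k → Mode) → ℂ :=
  fun j => if divisor j = 0 then 0 else s j / (Complex.I * divisor j)

/-- The resonant part. -/
def resPart {k : ℕ} (s : (Fin k → Mode) → ℂ) : (Fin k → Mode) → ℂ :=
  fun j => if divisor j = 0 then s j else 0

/-- The homological equation: off the resonant set the division cancels `s` exactly. -/
lemma add_quadD_solve {k : ℕ} (s : (Fin k → Mode) → ℂ) : s + quadD (solve s) = resPart s := by
  funext j
  simp only [Pi.add_apply, quadD, solve, resPart]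
  split_ifs with h
  · simp
  · have : (divisor j : ℂ) ≠ 0 := by exact_mod_cast h
    field_simp
    ring

/-- There are no small divisors: a nonzero divisor is an integer, hence at least `1` in absolute
value. -/
lemma norm_solve_le {k : ℕ} (s : (Fin k → Mode) → ℂ) (j : Fin k → Mode) :
    ‖solve s j‖ ≤ ‖s j‖ := by
  unfold solve
  split_ifs with h
  · simp
  · rw [norm_div, norm_mul, Complex.norm_I, one_mul, Complex.norm_intCast]
    refine div_le_self (norm_nonneg _) ?_
    exact_mod_cast Int.one_le_abs h

/-- `quadD` is unbounded in general, but on a solution of the homological equation it only gives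
back minus the nonresonant part of `s`. -/
lemma norm_quadD_solve_le {k : ℕ} (s : (Fin k → Mode) → ℂ) (j : Fin k → Mode) :
    ‖quadD (solve s) j‖ ≤ ‖s j‖ := by
  unfold quadD solve
  split_ifs with h
  · simp
  · have : (divisor j : ℂ) ≠ 0 := by exact_mod_cast h
    refine le_of_eq ?_
    rw [← norm_neg (s j)]
    congr 1
    field_simp

lemma norm_resPart_le {k : ℕ} (s : (Fin k → Mode) → ℂ) (j : Fin k → Mode) :
    ‖resPart s j‖ ≤ ‖s j‖ := by
  unfold resPart
  split_ifs <;> simp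

lemma MomentumSupported.solve {k : ℕ} {s : (Fin k → Mode) → ℂ} (h : MomentumSupported s) :
    MomentumSupported (solve s) := fun j hj => h j fun h0 => hj (by
  have := norm_solve_le s j
  rw [h0, norm_zero] at this
  exact norm_le_zero_iff.1 this)

lemma MomentumSupported.quadD {k : ℕ} {s : (Fin k → Mode) → ℂ} (h : MomentumSupported s) :
    MomentumSupported (quadD s) := fun j hj => h j fun h0 => hj (by simp [_root_.quadD, h0])

lemma RealCoeffs.solve {k : ℕ} {s : (Fin k → Mode) → ℂ} (h : RealCoeffs s) :
    RealCoeffs (solve s) := by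
  intro j
  simp only [_root_.solve, divisor_conjTuple, neg_eq_zero]
  split_ifs
  · simp
  · rw [map_div₀, map_mul, Complex.conj_I, h j]
    simp

lemma RealCoeffs.quadD {k : ℕ} {s : (Fin k → Mode) → ℂ} (h : RealCoeffs s) :
    RealCoeffs (quadD s) := by
  intro j
  simp only [_root_.quadD, divisor_conjTuple, map_mul, map_neg, Complex.conj_I, h j]
  simp

/-- The first derivative of the Hamiltonian along the flow of `F`. -/
def firstDer (F : Family) : Family := fun p => quadD (F p) + lieD F quartic p

/-- The components of the transformed Hamiltonian, without `L₂`. -/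
def transformed (F : Family) : Family := fun p =>
  quartic p + ∑ k ∈ Finset.range (p + 1), ((k + 1).factorial : ℝ)⁻¹ • (lieD F)^[k] (firstDer F) p

/-- The part of the transformed Hamiltonian that does not see the component `F p`. -/
def obstruction (F : Family) : Family := fun p =>
  quartic p + lieD F quartic p
    + ∑ k ∈ Finset.range p, ((k + 2).factorial : ℝ)⁻¹ • (lieD F)^[k + 1] (firstDer F) p

/-- The `k = 0` term of the Lie series is `firstDer F p`; its summand `quadD (F p)` is set apart as
the unknown of the homological equation. -/
lemma transformed_eq (F : Family) (p : ℕ) :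
    transformed F p = obstruction F p + quadD (F p) := by
  simp only [transformed, obstruction, Finset.sum_range_succ' _ p]
  simp [firstDer]
  abel

lemma quartic_zero : quartic 0 = 0 := rfl

lemma lieD_zero {F Q : Family} (hF0 : F 0 = 0) : lieD F Q 0 = 0 := by
  simp [lieD, hF0, bracketAt_zero_left]

lemma firstDer_zero {F : Family} (hF0 : F 0 = 0) : firstDer F 0 = 0 := by
  rw [firstDer, lieD_zero hF0, hF0]
  funext j
  simp [quadD]

/-- Triangularity: the obstruction at order `p` sees the generator only below order `p`, so the
generator can be built by recursion. -/
lemma obstruction_congr {F F' : Family} {p : ℕ} (hF : ∀ q < p, F q = F' q) (hF0 : F 0 = 0)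
    (hF0' : F' 0 = 0) : obstruction F p = obstruction F' p := by
  have h1 : ∀ q ≤ p, lieD F quartic q = lieD F' quartic q := fun q hq =>
    lieD_congr hF (fun _ _ => rfl) hF0 hF0' quartic_zero quartic_zero hq
  have h2 : ∀ q < p, firstDer F q = firstDer F' q := fun q hq => by
    simp only [firstDer, hF q hq, h1 q hq.le]
  simp only [obstruction, h1 p le_rfl]
  congr 1
  refine Finset.sum_congr rfl fun k _ => ?_
  rw [Function.iterate_succ_apply', Function.iterate_succ_apply']
  rw [lieD_congr hF (iterate_congr hF h2 hF0 hF0' (firstDer_zero hF0) (firstDer_zero hF0') k)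
    hF0 hF0' (iterate_eq_zero hF0 (firstDer_zero hF0) k 0 (Nat.zero_le _))
    (iterate_eq_zero hF0' (firstDer_zero hF0') k 0 (Nat.zero_le _)) le_rfl]

/-- The generator of the normal form transformation. -/
def generator (p : ℕ) : Coef p :=
  if p = 0 then 0 else
    -- The extension by zero at orders `q ≥ p` is harmless by `obstruction_congr`.
    solve (obstruction (fun q => if _ : q < p then generator q else 0) p)
termination_by p

/-- The generator truncated at order `n`. -/
def truncGen (n : ℕ) : Family := fun p => if p ≤ n then generator p else 0

lemma generator_zero : generator 0 = 0 := by rw [generator]; simp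

lemma truncGen_zero (n : ℕ) : truncGen n 0 = 0 := by simp [truncGen, generator_zero]

lemma truncGen_eq_solve {n p : ℕ} (hp : p ≤ n) :
    truncGen n p = solve (obstruction (truncGen n) p) := by
  rcases Nat.eq_zero_or_pos p with rfl | h0
  · rw [truncGen_zero]
    funext j
    simp [obstruction, lieD_zero (truncGen_zero n), quartic_zero, solve]
  · rw [truncGen, if_pos hp, generator, if_neg h0.ne']
    congr 1
    refine obstruction_congr (fun q hq => ?_) (by simp [h0, generator_zero]) (truncGen_zero n)
    rw [dif_pos hq, truncGen, if_pos (by omega)]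

lemma truncGen_eq_zero {n p : ℕ} (hp : n < p) : truncGen n p = 0 := by
  rw [truncGen, if_neg (by omega)]

lemma good_obstruction {F : Family} (hF : F.Good) : (obstruction F).Good := by
  have h1 := good_lieD hF good_quartic
  have h2 : (firstDer F).Good := fun p =>
    ⟨(hF p).1.quadD.add (h1 p).1, (hF p).2.quadD.add (h1 p).2⟩
  intro p
  have h3 := good_sum (Finset.range p)
    (fun k => ((k + 2).factorial : ℝ)⁻¹ • (lieD F)^[k + 1] (firstDer F) p) fun k _ =>
      ⟨(good_iterate hF h2 (k + 1) p).1.smul _, (good_iterate hF h2 (k + 1) p).2.smul _⟩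
  exact ⟨((good_quartic p).1.add (h1 p).1).add h3.1, ((good_quartic p).2.add (h1 p).2).add h3.2⟩

lemma good_generator (p : ℕ) : MomentumSupported (generator p) ∧ RealCoeffs (generator p) := by
  induction p using Nat.strong_induction_on with
  | _ p ih =>
    rw [generator]
    split_ifs with h
    · exact ⟨momentumSupported_zero, realCoeffs_zero⟩
    · have hg : Family.Good (fun q => if _ : q < p then generator q else 0) := by
        intro q
        simp only
        split_ifs with hq
        · exact ih q hq
        · exact ⟨momentumSupported_zero, realCoeffs_zero⟩
      exact ⟨(good_obstruction hg p).1.solve, (good_obstruction hg p).2.solve⟩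

lemma good_truncGen (n : ℕ) : (truncGen n).Good := by
  intro p
  unfold truncGen
  split_ifs
  · exact good_generator p
  · exact ⟨momentumSupported_zero, realCoeffs_zero⟩

/-- The generator cancels all nonresonant terms up to the truncation order. -/
lemma transformed_truncGen {n p : ℕ} (hp : p ≤ n) :
    transformed (truncGen n) p = resPart (obstruction (truncGen n) p) := by
  rw [transformed_eq, truncGen_eq_solve hp, ← add_quadD_solve]

lemma good_transformed {F : Family} (hF : F.Good) : (transformed F).Good := fun p => by
  rw [transformed_eq]
  exact ⟨(good_obstruction hF p).1.add (hF p).1.quadD, (good_obstruction hF p).2.add (hF p).2.quadD⟩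

end

noncomputable section

open scoped ENNReal NNReal

/-! ### Majorant estimates for the formal Lie series -/

/-- The supremum norm of coefficients. -/
def supCoef {k : ℕ} (c : (Fin k → Mode) → ℂ) : ℝ≥0∞ := ⨆ j, ‖c j‖ₑ

lemma enorm_le_supCoef {k : ℕ} (c : (Fin k → Mode) → ℂ) (j : Fin k → Mode) :
    ‖c j‖ₑ ≤ supCoef c := le_iSup (fun j => ‖c j‖ₑ) j

lemma supCoef_zero {k : ℕ} : supCoef (0 : (Fin k → Mode) → ℂ) = 0 := by simp [supCoef]

lemma supCoef_add_le {k : ℕ} (c d : (Fin k → Mode) → ℂ) :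
    supCoef (c + d) ≤ supCoef c + supCoef d :=
  iSup_le fun j => (enorm_add_le _ _).trans
    (add_le_add (enorm_le_supCoef c j) (enorm_le_supCoef d j))

lemma supCoef_sum_le {k : ℕ} {ι : Type*} (s : Finset ι) (f : ι → (Fin k → Mode) → ℂ) :
    supCoef (∑ i ∈ s, f i) ≤ ∑ i ∈ s, supCoef (f i) :=
  Finset.le_sum_of_subadditive supCoef supCoef_zero.le supCoef_add_le s f

lemma supCoef_mono {k : ℕ} {c d : (Fin k → Mode) → ℂ} (h : ∀ j, ‖c j‖ ≤ ‖d j‖) :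
    supCoef c ≤ supCoef d :=
  iSup_le fun j => (enorm_le_iff_norm_le.2 (h j)).trans (enorm_le_supCoef d j)

lemma supCoef_smul_le {k : ℕ} (s : ℝ) (c : (Fin k → Mode) → ℂ) :
    supCoef (s • c) ≤ ‖s‖ₑ * supCoef c :=
  iSup_le fun j => by
    rw [Pi.smul_apply, enorm_smul]
    exact mul_le_mul_right (enorm_le_supCoef c j) _

lemma enorm_dcoef_le {k : ℕ} (c : (Fin (k + 1) → Mode) → ℂ) (i : Mode) (j : Fin k → Mode) :
    ‖dcoef c i j‖ₑ ≤ (k + 1) * supCoef c := by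
  refine (enorm_sum_le _ _).trans ((Finset.sum_le_sum fun α _ => enorm_le_supCoef c _).trans ?_)
  simp

/-- The two products of the bracket each cost the numbers of slots `2a + 2` and `2b + 2`, in all `2
(2a + 2)(2b + 2)`. -/
lemma supCoef_bracketAt_le {a b : ℕ} (p : ℕ) (χ : Coef a) (Q : Coef b) :
    supCoef (bracketAt p χ Q) ≤ 8 * (a + 1) * (b + 1) * (supCoef χ * supCoef Q) := by
  unfold bracketAt
  split_ifs with h
  · refine iSup_le fun j => ?_
    rw [bracket, enorm_mul]
    have key : ∀ i i', ‖dcoef χ i (headTuple h j) * dcoef Q i' (tailTuple h j)‖ₑ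
        ≤ 4 * (a + 1) * (b + 1) * (supCoef χ * supCoef Q) := fun i i' => by
      rw [enorm_mul]
      refine (mul_le_mul' (enorm_dcoef_le χ _ _) (enorm_dcoef_le Q _ _)).trans (le_of_eq ?_)
      push_cast
      ring
    have hI : ‖Complex.I‖ₑ = 1 := by rw [enorm_eq_nnnorm, Complex.nnnorm_I]; rfl
    rw [hI, one_mul]
    refine (enorm_sub_le).trans ((add_le_add (key _ _) (key _ _)).trans (le_of_eq ?_))
    ring
  · rw [supCoef_zero]; exact zero_le

/-- The truncated weighted norm `∑_{p ≤ N} ‖Q_p‖ x^p`. -/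
def wnorm (N : ℕ) (x : ℝ≥0∞) (Q : Family) : ℝ≥0∞ :=
  ∑ p ∈ Finset.range (N + 1), supCoef (Q p) * x ^ p

lemma wnorm_mono_left {M N : ℕ} (h : M ≤ N) (x : ℝ≥0∞) (Q : Family) :
    wnorm M x Q ≤ wnorm N x Q :=
  Finset.sum_le_sum_of_subset (Finset.range_mono (by omega))

lemma supCoef_le_wnorm {N p : ℕ} (h : p ≤ N) (x : ℝ≥0∞) (Q : Family) :
    supCoef (Q p) * x ^ p ≤ wnorm N x Q :=
  Finset.single_le_sum (f := fun p => supCoef (Q p) * x ^ p) (fun _ _ => zero_le)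
    (Finset.mem_range.2 (by omega))

lemma wnorm_add_le (N : ℕ) (x : ℝ≥0∞) (Q R : Family) :
    wnorm N x (Q + R) ≤ wnorm N x Q + wnorm N x R := by
  unfold wnorm
  rw [← Finset.sum_add_distrib]
  refine Finset.sum_le_sum fun p _ => ?_
  rw [← add_mul]
  exact mul_le_mul_left (supCoef_add_le _ _) _

lemma sum_antidiagonal_le (N : ℕ) (f g : ℕ → ℝ≥0∞) :
    ∑ p ∈ Finset.range (N + 1), ∑ x ∈ Finset.HasAntidiagonal.antidiagonal p, f x.1 * g x.2
      ≤ (∑ a ∈ Finset.range (N + 1), f a) * ∑ b ∈ Finset.range (N + 1), g b := by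
  rw [← Finset.sum_biUnion, Finset.sum_mul_sum, ← Finset.sum_product']
  · refine Finset.sum_le_sum_of_subset fun x hx => ?_
    simp only [Finset.mem_biUnion, Finset.mem_range, Finset.HasAntidiagonal.mem_antidiagonal] at hx
    obtain ⟨p, hp, hx⟩ := hx
    simp only [Finset.mem_product, Finset.mem_range]
    omega
  · intro p _ q _ hpq
    rw [Function.onFun, Finset.disjoint_left]
    intro x hx hx'
    rw [Finset.HasAntidiagonal.mem_antidiagonal] at hx hx'
    exact hpq (hx.symm.trans hx')

/-- A truncated Cauchy product. The slot factors are replaced by their largest values, `r` for the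
generator and `N + 1` for the other argument. -/
lemma wnorm_lieD_le {N r : ℕ} {F : Family} (hF : ∀ a ≤ N, r < a + 1 → F a = 0) (x : ℝ≥0∞)
    (Q : Family) : wnorm N x (lieD F Q) ≤ 8 * r * (N + 1) * wnorm N x F * wnorm N x Q := by
  have h1 : ∀ p ∈ Finset.range (N + 1), supCoef (lieD F Q p) * x ^ p
      ≤ 8 * r * (N + 1) * ∑ y ∈ Finset.HasAntidiagonal.antidiagonal p,
        (supCoef (F y.1) * x ^ y.1) * (supCoef (Q y.2) * x ^ y.2) := by
    intro p hp
    rw [Finset.mem_range] at hp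
    rw [Finset.mul_sum]
    refine (mul_le_mul_left (supCoef_sum_le _ _) _).trans ?_
    rw [Finset.sum_mul]
    refine Finset.sum_le_sum fun y hy => ?_
    rw [Finset.HasAntidiagonal.mem_antidiagonal] at hy
    by_cases hr : r < y.1 + 1
    · rw [hF y.1 (by omega) hr, bracketAt_zero_left, supCoef_zero]
      simp
    · calc supCoef (bracketAt p (F y.1) (Q y.2)) * x ^ p
          ≤ (8 * (y.1 + 1) * (y.2 + 1) * (supCoef (F y.1) * supCoef (Q y.2))) * x ^ p :=
            mul_le_mul_left (supCoef_bracketAt_le _ _ _) _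
        _ ≤ (8 * r * (N + 1) * (supCoef (F y.1) * supCoef (Q y.2))) * x ^ p := by
            have e1 : ((y.1 : ℝ≥0∞) + 1) ≤ r := by exact_mod_cast (by omega : y.1 + 1 ≤ r)
            have e2 : ((y.2 : ℝ≥0∞) + 1) ≤ N + 1 := by exact_mod_cast (by omega : y.2 + 1 ≤ N + 1)
            gcongr
        _ = _ := by rw [← hy, pow_add]; ring
  refine (Finset.sum_le_sum h1).trans ?_
  rw [← Finset.mul_sum, mul_assoc _ (wnorm N x F)]
  exact mul_le_mul_right (sum_antidiagonal_le N (fun a => supCoef (F a) * x ^ a)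
    (fun b => supCoef (Q b) * x ^ b)) _

lemma wnorm_iterate_le {N r : ℕ} {F : Family} (hF : ∀ a ≤ N, r < a + 1 → F a = 0) (x : ℝ≥0∞)
    (Q : Family) (k : ℕ) :
    wnorm N x ((lieD F)^[k] Q) ≤ (8 * r * (N + 1) * wnorm N x F) ^ k * wnorm N x Q := by
  induction k with
  | zero => simp
  | succ k ih =>
    rw [Function.iterate_succ_apply']
    refine (wnorm_lieD_le hF x _).trans ?_
    rw [pow_succ', mul_assoc _ _ (wnorm N x Q)]
    exact mul_le_mul_right ih _

lemma supCoef_quartic_le : supCoef (quartic 1) ≤ ((1 / 2 : ℝ≥0) : ℝ≥0∞) := by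
  refine iSup_le fun j => ?_
  have h := norm_quarticCoef_le j
  change ‖quarticCoef j‖ₑ ≤ _
  rw [enorm_eq_nnnorm, ENNReal.coe_le_coe, ← NNReal.coe_le_coe]
  simpa using h

lemma wnorm_quartic_le (N : ℕ) (x : ℝ≥0∞) : wnorm N x quartic ≤ ((1 / 2 : ℝ≥0) : ℝ≥0∞) * x := by
  unfold wnorm
  calc _ ≤ ∑ p ∈ Finset.range (N + 1), if p = 1 then ((1 / 2 : ℝ≥0) : ℝ≥0∞) * x else 0 := by
        refine Finset.sum_le_sum fun p _ => ?_
        split_ifs with h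
        · subst h
          rw [pow_one]
          exact mul_le_mul_left supCoef_quartic_le _
        · rw [quartic_of_ne h, supCoef_zero, zero_mul]
    _ ≤ _ := by
        rw [Finset.sum_ite_eq']
        split_ifs <;> simp

lemma sum_eighth_pow_le (n : ℕ) :
    ∑ k ∈ Finset.range n, (((1 / 8 : ℝ≥0) : ℝ≥0∞)) ^ (k + 1) ≤ ((1 / 4 : ℝ≥0) : ℝ≥0∞) := by
  have key : ∀ n : ℕ, ∑ k ∈ Finset.range n, (1 / 8 : ℝ) ^ (k + 1) + (1 / 8 : ℝ) ^ n / 4 ≤ 1 / 4 := by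
    intro n
    induction n with
    | zero => norm_num
    | succ n ih =>
      rw [Finset.sum_range_succ]
      have : (0 : ℝ) < (1 / 8) ^ n := by positivity
      rw [pow_succ]
      linarith
  have h : ∑ k ∈ Finset.range n, (1 / 8 : ℝ≥0) ^ (k + 1) ≤ 1 / 4 := by
    rw [← NNReal.coe_le_coe]
    push_cast
    have := key n
    have : (0 : ℝ) < (1 / 8) ^ n := by positivity
    linarith
  exact_mod_cast h

lemma enorm_inv_factorial_le (k : ℕ) : ‖((k.factorial : ℝ))⁻¹‖ₑ ≤ 1 := by
  rw [enorm_eq_nnnorm, ← ENNReal.coe_one, ENNReal.coe_le_coe, ← NNReal.coe_le_coe, coe_nnnorm,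
    norm_inv, Real.norm_natCast, NNReal.coe_one]
  exact inv_le_one_of_one_le₀ (by exact_mod_cast Nat.factorial_pos k)

lemma wnorm_firstDer_le {N r : ℕ} {F : Family} (hF : ∀ a ≤ N, r < a + 1 → F a = 0) (x : ℝ≥0∞) :
    wnorm N x (firstDer F) ≤ wnorm N x (fun p => quadD (F p))
      + 8 * r * (N + 1) * wnorm N x F * (((1 / 2 : ℝ≥0) : ℝ≥0∞) * x) :=
  (wnorm_add_le N x (fun p => quadD (F p)) (lieD F quartic)).trans
    (add_le_add le_rfl ((wnorm_lieD_le hF x _).trans (mul_le_mul_right (wnorm_quartic_le N x) _)))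

/-- Under these hypotheses each derivation contracts by `1/8`. The quartic term, its bracket and the
tail of the Lie series contribute `1/2`, `1/16` and `(1/4)(17/16)` times `x`, together less than
`x`. -/
lemma wnorm_obstruction_le {N : ℕ} {F : Family} {x : ℝ≥0}
    (hx : 8 * (N + 1) * (N + 1) * x ≤ 1 / 8) (h1 : wnorm N x F ≤ x)
    (h2 : wnorm N x (fun p => quadD (F p)) ≤ x) : wnorm N x (obstruction F) ≤ x := by
  have hF : ∀ a ≤ N, N + 1 < a + 1 → F a = 0 := fun a ha h => by omega
  have hu : 8 * ((N + 1 : ℕ) : ℝ≥0∞) * (N + 1) * wnorm N x F ≤ ((1 / 8 : ℝ≥0) : ℝ≥0∞) :=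
    (mul_le_mul_right h1 _).trans (by exact_mod_cast hx)
  have hG : wnorm N x (firstDer F)
      ≤ x + ((1 / 8 : ℝ≥0) : ℝ≥0∞) * (((1 / 2 : ℝ≥0) : ℝ≥0∞) * x) :=
    (wnorm_firstDer_le hF x).trans (add_le_add h2 (mul_le_mul_left hu _))
  have hD : wnorm N x (lieD F quartic) ≤ ((1 / 8 : ℝ≥0) : ℝ≥0∞) * (((1 / 2 : ℝ≥0) : ℝ≥0∞) * x) :=
    (wnorm_lieD_le hF x _).trans (mul_le_mul' hu (wnorm_quartic_le N x))
  have hk : ∀ k, wnorm N x ((lieD F)^[k + 1] (firstDer F)) ≤ ((1 / 8 : ℝ≥0) : ℝ≥0∞) ^ (k + 1)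
      * (x + ((1 / 8 : ℝ≥0) : ℝ≥0∞) * (((1 / 2 : ℝ≥0) : ℝ≥0∞) * x)) := fun k =>
    (wnorm_iterate_le hF x _ _).trans (mul_le_mul' (pow_le_pow_left' hu _) hG)
  have hsup : ∀ p ≤ N, supCoef (obstruction F p) * (x : ℝ≥0∞) ^ p
      ≤ supCoef (quartic p) * (x : ℝ≥0∞) ^ p + supCoef (lieD F quartic p) * (x : ℝ≥0∞) ^ p
        + ∑ k ∈ Finset.range N, supCoef ((lieD F)^[k + 1] (firstDer F) p) * (x : ℝ≥0∞) ^ p := by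
    intro p hp
    rw [← Finset.sum_mul, ← add_mul, ← add_mul]
    refine mul_le_mul_left ?_ _
    refine (supCoef_add_le _ _).trans (add_le_add (supCoef_add_le _ _) ?_)
    refine (supCoef_sum_le _ _).trans ((Finset.sum_le_sum fun k _ => ?_).trans
      (Finset.sum_le_sum_of_subset (Finset.range_mono hp)))
    refine (supCoef_smul_le _ _).trans ?_
    exact (mul_le_mul_left (enorm_inv_factorial_le _) _).trans (one_mul _).le
  calc wnorm N x (obstruction F)
      ≤ wnorm N x quartic + wnorm N x (lieD F quartic)
        + ∑ k ∈ Finset.range N, wnorm N x ((lieD F)^[k + 1] (firstDer F)) := by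
        unfold wnorm
        rw [Finset.sum_comm, ← Finset.sum_add_distrib, ← Finset.sum_add_distrib]
        exact Finset.sum_le_sum fun p hp => hsup p (by rw [Finset.mem_range] at hp; omega)
    _ ≤ ((1 / 2 : ℝ≥0) : ℝ≥0∞) * x + ((1 / 8 : ℝ≥0) : ℝ≥0∞) * (((1 / 2 : ℝ≥0) : ℝ≥0∞) * x)
        + ((1 / 4 : ℝ≥0) : ℝ≥0∞)
          * (x + ((1 / 8 : ℝ≥0) : ℝ≥0∞) * (((1 / 2 : ℝ≥0) : ℝ≥0∞) * x)) := by
        refine add_le_add (add_le_add (wnorm_quartic_le N x) hD) ?_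
        refine (Finset.sum_le_sum fun k _ => hk k).trans ?_
        rw [← Finset.sum_mul]
        exact mul_le_mul_left (sum_eighth_pow_le N) _
    _ ≤ x := by
        have : (1 / 2 : ℝ≥0) * x + (1 / 8) * ((1 / 2) * x)
            + (1 / 4) * (x + (1 / 8) * ((1 / 2) * x)) ≤ x := by
          rw [← NNReal.coe_le_coe]
          push_cast
          have h0 : (0 : ℝ) ≤ x := x.2
          linarith
        exact_mod_cast this

/-- Bootstrap on the order: the bound for the obstruction up to `M` controls the generator up to
`M`, which is all that the obstruction at order `M + 1` involves. -/
lemma wnorm_obstruction_truncGen_le {N n : ℕ} (hn : N ≤ n) {x : ℝ≥0}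
    (hx : 8 * (N + 1) * (N + 1) * x ≤ 1 / 8) :
    ∀ M ≤ N, wnorm M x (obstruction (truncGen n)) ≤ x := by
  intro M
  induction M with
  | zero =>
    intro _
    have h0 : obstruction (truncGen n) 0 = 0 := by
      simp [obstruction, lieD_zero (truncGen_zero n), quartic_zero]
    simp [wnorm, h0, supCoef_zero]
  | succ M ih =>
    intro hM
    have ih' := ih (by omega)
    have hob : ∀ p ≤ M + 1, obstruction (truncGen n) p = obstruction (truncGen M) p := fun p hp =>
      obstruction_congr (fun q hq => by
        rw [truncGen, truncGen, if_pos (by omega), if_pos (by omega)])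
        (truncGen_zero _) (truncGen_zero _)
    -- Applied with `f` the identity and `f = quadD`; both are bounded by the source of the
    -- homological equation.
    have hle : ∀ f : (p : ℕ) → Coef p → Coef p, (∀ p, f p 0 = 0) →
        (∀ p s j, ‖f p (solve s) j‖ ≤ ‖s j‖) →
        wnorm (M + 1) x (fun p => f p (truncGen M p)) ≤ x := by
      intro f hf0 hf
      refine le_trans ?_ ih'
      unfold wnorm
      have hz : truncGen M (M + 1) = 0 := truncGen_eq_zero (Nat.lt_succ_self M)
      rw [Finset.sum_range_succ _ (M + 1)]
      simp only [hz, hf0, supCoef_zero, zero_mul, add_zero]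
      refine Finset.sum_le_sum fun p hp => mul_le_mul_left ?_ _
      rw [Finset.mem_range] at hp
      rw [truncGen_eq_solve (by omega : p ≤ M), hob p (by omega)]
      exact supCoef_mono (hf p _)
    have e1 := hle (fun _ c => c) (fun _ => rfl) (fun p s j => norm_solve_le s j)
    have e2 := hle (fun _ c => quadD c) (fun _ => by funext j; simp [quadD])
      (fun p s j => norm_quadD_solve_le s j)
    have h3 : wnorm (M + 1) x (obstruction (truncGen n)) = wnorm (M + 1) x (obstruction (truncGen M)) :=
      Finset.sum_congr rfl fun p hp => by
        rw [Finset.mem_range] at hp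
        rw [hob p (by omega)]
    rw [h3]
    refine wnorm_obstruction_le ?_ e1 e2
    refine le_trans ?_ hx
    have : ((M + 1 : ℕ) : ℝ≥0) ≤ N := by exact_mod_cast hM
    gcongr

lemma norm_mul_pow_le {Q : Family} {p N : ℕ} {x B : ℝ≥0} (h : wnorm N x Q ≤ B) (hp : p ≤ N)
    (j : Fin (2 * p + 1 + 1) → Mode) : ‖Q p j‖ * (x : ℝ) ^ p ≤ B := by
  have h1 : ‖Q p j‖ₑ * (x : ℝ≥0∞) ^ p ≤ B :=
    (mul_le_mul_left (enorm_le_supCoef (Q p) j) _).trans ((supCoef_le_wnorm hp x Q).trans h)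
  rw [enorm_eq_nnnorm] at h1
  have h2 : ‖Q p j‖₊ * x ^ p ≤ B := by exact_mod_cast h1
  exact_mod_cast h2

lemma norm_obstruction_le {n p : ℕ} (hp : 1 ≤ p) (hn : p ≤ n) (j : Fin (2 * p + 1 + 1) → Mode) :
    ‖obstruction (truncGen n) p j‖ ≤ (64 * ((p : ℝ) + 1) ^ 2) ^ (p - 1) := by
  -- The majorant parameter is adapted to the order `p` itself. From `‖Q_p‖ x^p ≤ x` comes `x^(1 -
  -- p)`, with `(p + 1)²` and not `r²` inside.
  have h := norm_mul_pow_le (wnorm_obstruction_truncGen_le hn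
    (x := (64 * ((p : ℝ≥0) + 1) ^ 2)⁻¹) (by
      refine le_of_eq ?_
      field_simp
      norm_num) p le_rfl) le_rfl j
  obtain ⟨q, rfl⟩ : ∃ q, p = q + 1 := ⟨p - 1, by omega⟩
  rw [Nat.add_sub_cancel]
  push_cast at h ⊢
  set y : ℝ := 64 * ((q : ℝ) + 1 + 1) ^ 2 with hy
  have hy0 : 0 < y := by positivity
  rw [pow_succ, ← mul_assoc] at h
  have h3 := le_of_mul_le_mul_right (h.trans_eq (one_mul _).symm) (inv_pos.2 hy0)
  rwa [inv_pow, mul_inv_le_iff₀ (by positivity), one_mul] at h3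

/-! ### Bounds with the parameter fixed by the truncation order -/

section Bounds

variable {n : ℕ}

lemma small_weight (n : ℕ) : 8 * ((n : ℝ≥0) + 1) * (n + 1) * (64 * ((n : ℝ≥0) + 1) ^ 2)⁻¹ ≤ 1 / 8 := by
  refine le_of_eq ?_
  field_simp
  norm_num

/-- The truncated generator has no component above `n`, so its majorant bound at `N = n` holds for
every `N`. -/
lemma wnorm_of_truncGen_le (f : (p : ℕ) → Coef p → Coef p) (hf0 : ∀ p, f p 0 = 0)
    (hf : ∀ p s j, ‖f p (solve s) j‖ ≤ ‖s j‖) (N : ℕ) :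
    wnorm N ((64 * ((n : ℝ≥0) + 1) ^ 2)⁻¹ : ℝ≥0) (fun p => f p (truncGen n p))
      ≤ ((64 * ((n : ℝ≥0) + 1) ^ 2)⁻¹ : ℝ≥0) := by
  set x : ℝ≥0 := (64 * ((n : ℝ≥0) + 1) ^ 2)⁻¹
  have h1 := wnorm_obstruction_truncGen_le le_rfl (small_weight n) n le_rfl
  refine le_trans ?_ h1
  refine le_trans (wnorm_mono_left (le_max_left N n) _ _) ?_
  unfold wnorm
  rw [← Finset.sum_subset (Finset.range_mono (by omega : n + 1 ≤ max N n + 1))]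
  · refine Finset.sum_le_sum fun p hp => mul_le_mul_left ?_ _
    rw [Finset.mem_range] at hp
    beta_reduce
    rw [truncGen_eq_solve (by omega : p ≤ n)]
    exact supCoef_mono (hf p _)
  · intro p _ hp
    rw [Finset.mem_range] at hp
    have hz : truncGen n p = 0 := truncGen_eq_zero (by omega)
    simp only [hz, hf0, supCoef_zero, zero_mul]

lemma norm_truncGen_le {p : ℕ} (hp : 1 ≤ p) (j : Fin (2 * p + 1 + 1) → Mode) :
    ‖truncGen n p j‖ ≤ (64 * ((n : ℝ) + 1) ^ 2) ^ (p - 1) := by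
  have h := norm_mul_pow_le (wnorm_of_truncGen_le (n := n) (fun _ c => c) (fun _ => rfl)
    (fun p s j => norm_solve_le s j) p) le_rfl j
  obtain ⟨q, rfl⟩ : ∃ q, p = q + 1 := ⟨p - 1, by omega⟩
  rw [Nat.add_sub_cancel]
  push_cast at h ⊢
  set y : ℝ := 64 * ((n : ℝ) + 1) ^ 2 with hy
  have hy0 : 0 < y := by positivity
  rw [pow_succ, ← mul_assoc] at h
  have h3 := le_of_mul_le_mul_right (h.trans_eq (one_mul _).symm) (inv_pos.2 hy0)
  rwa [inv_pow, mul_inv_le_iff₀ (by positivity), one_mul] at h3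

lemma pow_div_factorial_le (p k : ℕ) : ((p : ℝ) + 1) ^ k / k.factorial ≤ 3 ^ (p + 1) := by
  refine (Real.pow_div_factorial_le_exp _ (by positivity) k).trans ?_
  rw [show (p : ℝ) + 1 = ((p + 1 : ℕ) : ℝ) * 1 by push_cast; ring, Real.exp_nat_mul]
  exact pow_le_pow_left₀ (Real.exp_pos _).le (Real.exp_one_lt_d9.le.trans (by norm_num)) _

/-- With `x` fixed, a derivation at orders up to `p` costs `(p + 1) / 16`, which is not small for
large `p`. Since `(p + 1)^k / k! ≤ 3^(p + 1)`, the factorial turns this into decay `16^(-k)` at the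
price of a geometric factor in `p`. -/
lemma norm_iterate_le (hn : 1 ≤ n) (k p : ℕ) (j : Fin (2 * p + 1 + 1) → Mode) :
    ‖(lieD (truncGen n))^[k] (firstDer (truncGen n)) p j‖ / k.factorial
        * ((64 * ((n : ℝ) + 1) ^ 2)⁻¹) ^ p
      ≤ (1 / 16) ^ k * 6 ^ (p + 1) * (64 * ((n : ℝ) + 1) ^ 2)⁻¹ := by
  set x : ℝ≥0 := (64 * ((n : ℝ≥0) + 1) ^ 2)⁻¹ with hx
  have hF : ∀ a ≤ p, n + 1 < a + 1 → truncGen n a = 0 := fun a _ h => truncGen_eq_zero (by omega)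
  have e1 : wnorm p x (truncGen n) ≤ x := wnorm_of_truncGen_le (fun _ c => c) (fun _ => rfl)
    (fun p s j => norm_solve_le s j) p
  have e2 : wnorm p x (fun p => quadD (truncGen n p)) ≤ x :=
    wnorm_of_truncGen_le (fun _ c => quadD c) (fun _ => by funext j; simp [quadD])
      (fun p s j => norm_quadD_solve_le s j) p
  have hxr : (x : ℝ) = (64 * ((n : ℝ) + 1) ^ 2)⁻¹ := by rw [hx]; push_cast; rfl
  have hx0 : (0 : ℝ) < x := by rw [hxr]; positivity
  have hn' : (1 : ℝ) ≤ n := by exact_mod_cast hn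
  -- The left side is `(p + 1) / (8 (n + 1))`, and `n ≥ 1`.
  have hu0 : 8 * ((n + 1 : ℕ) : ℝ≥0) * (p + 1) * x ≤ (p + 1) / 16 := by
    rw [← NNReal.coe_le_coe]
    push_cast
    rw [hxr, ← div_eq_mul_inv, div_le_div_iff₀ (by positivity) (by norm_num)]
    have : 0 ≤ ((p : ℝ) + 1) * (n + 1) * (n - 1) := by
      have : 0 ≤ (n : ℝ) - 1 := by linarith
      positivity
    nlinarith
  have hu : 8 * ((n + 1 : ℕ) : ℝ≥0∞) * (p + 1) * wnorm p x (truncGen n)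
      ≤ (((p + 1) / 16 : ℝ≥0) : ℝ≥0∞) :=
    (mul_le_mul_right e1 _).trans (by exact_mod_cast hu0)
  have hG : wnorm p x (firstDer (truncGen n)) ≤ ((2 ^ (p + 1) * x : ℝ≥0) : ℝ≥0∞) := by
    refine (wnorm_firstDer_le hF x).trans ((add_le_add e2 (mul_le_mul_left hu _)).trans ?_)
    have : x + ((p : ℝ≥0) + 1) / 16 * (1 / 2 * x) ≤ 2 ^ (p + 1) * x := by
      rw [← NNReal.coe_le_coe]
      push_cast
      have h2 : (p : ℝ) + 1 ≤ 2 ^ p := by exact_mod_cast Nat.lt_two_pow_self (n := p)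
      have h3 : (1 : ℝ) ≤ 2 ^ p := one_le_pow₀ (by norm_num)
      rw [pow_succ]
      nlinarith
    exact_mod_cast this
  have hk : wnorm p x ((lieD (truncGen n))^[k] (firstDer (truncGen n)))
      ≤ ((((p + 1) / 16) ^ k * (2 ^ (p + 1) * x) : ℝ≥0) : ℝ≥0∞) := by
    refine (wnorm_iterate_le hF x _ _).trans ((mul_le_mul' (pow_le_pow_left' hu _) hG).trans ?_)
    push_cast
    exact le_rfl
  have h := norm_mul_pow_le hk le_rfl j
  push_cast at h
  rw [← hxr]
  have hfac : (0 : ℝ) < k.factorial := by exact_mod_cast k.factorial_pos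
  calc _ = (‖(lieD (truncGen n))^[k] (firstDer (truncGen n)) p j‖ * (x : ℝ) ^ p) / k.factorial := by
        ring
    _ ≤ (((p : ℝ) + 1) / 16) ^ k * (2 ^ (p + 1) * x) / k.factorial := by gcongr
    _ = (((p : ℝ) + 1) ^ k / k.factorial) * ((1 / 16) ^ k * 2 ^ (p + 1) * x) := by
        rw [div_pow, one_div, inv_pow]; ring
    _ ≤ 3 ^ (p + 1) * ((1 / 16) ^ k * 2 ^ (p + 1) * x) := by
        gcongr
        exact pow_div_factorial_le p k
    _ = _ := by
        rw [show (6 : ℝ) = 3 * 2 by norm_num, mul_pow]; ring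

end Bounds

end

noncomputable section

/-! ### The flow of the generator -/

/-- Applied pointwise in time, a bounded multilinear map is bounded multilinear on curves, hence its
diagonal is smooth there. -/
lemma exists_curve_lift {E : Type*} [NormedAddCommGroup E] [NormedSpace ℝ E] {k : ℕ}
    (T : ContinuousMultilinearMap ℝ (fun _ : Fin k => E) E) :
    ∃ Xh : C(unitInterval, E) → C(unitInterval, E), ContDiff ℝ ∞ Xh ∧ ∀ γ t, Xh γ t = T (fun _ => γ t) := by
  let M : MultilinearMap ℝ (fun _ : Fin k => C(unitInterval, E)) C(unitInterval, E) :=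
    { toFun := fun γ => ⟨fun t => T (fun α => γ α t),
        T.cont.comp (continuous_pi fun α => (γ α).continuous)⟩
      map_update_add' := by
        intro inst γ α x y
        ext t
        have h : ∀ η : C(unitInterval, E), (fun β => Function.update γ α η β t)
            = Function.update (fun β => γ β t) α (η t) := by
          intro η
          funext β
          by_cases hβ : β = α
          · subst hβ; simp
          · simp [hβ]
        change T (fun β => Function.update γ α (x + y) β t) = T (fun β => Function.update γ α x β t)
          + T (fun β => Function.update γ α y β t)
        rw [h, h, h]
        exact T.map_update_add _ _ _ _
      map_update_smul' := by
        intro inst γ α c x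
        ext t
        have h : ∀ η : C(unitInterval, E), (fun β => Function.update γ α η β t)
            = Function.update (fun β => γ β t) α (η t) := by
          intro η
          funext β
          by_cases hβ : β = α
          · subst hβ; simp
          · simp [hβ]
        change T (fun β => Function.update γ α (c • x) β t)
          = c • T (fun β => Function.update γ α x β t)
        rw [h, h]
        exact T.map_update_smul _ _ _ _ }
  let M' : ContinuousMultilinearMap ℝ (fun _ : Fin k => C(unitInterval, E)) C(unitInterval, E) :=
    M.mkContinuous ‖T‖ (fun γ => by
      rw [ContinuousMap.norm_le _ (by positivity)]
      intro t
      refine (T.le_opNorm _).trans ?_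
      gcongr with α
      exact (γ α).norm_coe_le_norm t)
  exact ⟨fun γ => M' (fun _ => γ), M'.contDiff.comp (contDiff_pi.2 fun _ => contDiff_id),
    fun γ t => rfl⟩

lemma SmallField.neg {E : Type*} [NormedAddCommGroup E] [NormedSpace ℝ E] {X : E → E}
    {Xh : C(unitInterval, E) → C(unitInterval, E)} {S : ℝ} (h : SmallField X Xh S) :
    SmallField (fun x => -X x) (fun γ => -Xh γ) S where
  pos := h.pos
  lift γ t := by rw [ContinuousMap.neg_apply, h.lift]
  smooth := h.smooth.neg
  smooth_lift := h.smooth_lift.neg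
  zero := by rw [h.zero, neg_zero]
  contract x hx y hy := by
    rw [← neg_sub', norm_neg]
    exact h.contract x hx y hy

lemma sum_geom_le_two {q : ℝ} (h0 : 0 ≤ q) (h1 : q ≤ 1 / 2) (n : ℕ) :
    ∑ i ∈ Finset.range n, q ^ i ≤ 2 := by
  calc _ ≤ ∑ i ∈ Finset.range n, (1 / 2 : ℝ) ^ i :=
        Finset.sum_le_sum fun i _ => pow_le_pow_left₀ h0 h1 i
    _ ≤ 2 := sum_geometric_two_le n

namespace Gevrey

variable {σ θ : ℝ}

/-- The Hamiltonian vector field of the truncated generator. -/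
def genField (n : ℕ) (z : Gevrey σ θ) : Gevrey σ θ :=
  ∑ a ∈ Finset.range (n + 1), vf (truncGen n a) z

lemma vf_zero {k : ℕ} (z : Gevrey σ θ) : vf (0 : (Fin (k + 1) → Mode) → ℂ) z = 0 := by
  have h : ∀ j : Fin k → Mode,
      (single (momentum j) (vfCoef 0 j * mono z j) : Gevrey σ θ) = 0 := fun j => by
    rw [← norm_eq_zero, norm_single]
    simp [vfCoef, dcoef]
  simp only [vf, h, tsum_zero]

lemma genField_eq (n : ℕ) (z : Gevrey σ θ) :
    genField n z = ∑ q ∈ Finset.range n, vf (truncGen n (q + 1)) z := by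
  rw [genField, Finset.sum_range_succ', truncGen_zero, vf_zero, add_zero]

lemma exists_truncGen_bound (n p : ℕ) : ∃ B : ℝ, ∀ j, ‖truncGen n p j‖ ≤ B := by
  rcases Nat.eq_zero_or_pos p with rfl | h
  · exact ⟨0, fun j => by rw [truncGen_zero]; simp⟩
  · exact ⟨_, norm_truncGen_le h⟩

section

variable (hσ : 0 < σ) (hθ : 0 < θ) (hθ1 : θ < 1) (n : ℕ)

include hσ hθ hθ1

/-- The field starts with a cubic term and is dominated by a geometric series; the degree factor `q
+ 2` is absorbed into `2 · 2^q`. -/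
lemma norm_genField_le {z : Gevrey σ θ} (hz : 64 * ((n : ℝ) + 1) ^ 2 * ‖z‖ ^ 2 ≤ 1 / 8) :
    ‖genField n z‖ ≤ 16 * ‖z‖ ^ 3 := by
  set y := 64 * ((n : ℝ) + 1) ^ 2 with hy
  have hy0 : 0 ≤ y := by positivity
  clear_value y
  rw [genField_eq]
  calc _ ≤ ∑ q ∈ Finset.range n, ‖vf (truncGen n (q + 1)) z‖ := norm_sum_le _ _
    _ ≤ ∑ q ∈ Finset.range n, 8 * ‖z‖ ^ 3 * (2 * (y * ‖z‖ ^ 2)) ^ q := by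
        refine Finset.sum_le_sum fun q _ => ?_
        refine (norm_vf_le hσ hθ hθ1 (norm_truncGen_le (Nat.le_add_left 1 q)) z).trans ?_
        rw [Nat.add_sub_cancel, ← hy]
        have h2 : (q : ℝ) + 1 ≤ 2 ^ q := by exact_mod_cast Nat.lt_two_pow_self (n := q)
        have h3 : (1 : ℝ) ≤ 2 ^ q := one_le_pow₀ (by norm_num)
        have h4 : ((q : ℝ) + 2) ≤ 2 * 2 ^ q := by linarith
        have e : 2 * (((2 * (q + 1) + 1 : ℕ) : ℝ) + 1) * y ^ q * ‖z‖ ^ (2 * (q + 1) + 1)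
            = 4 * ((q : ℝ) + 2) * (y ^ q * ‖z‖ ^ (2 * q) * ‖z‖ ^ 3) := by
          push_cast
          ring
        rw [e]
        calc _ ≤ 4 * (2 * 2 ^ q) * (y ^ q * ‖z‖ ^ (2 * q) * ‖z‖ ^ 3) := by gcongr
          _ = _ := by rw [mul_pow, mul_pow, pow_mul]; ring
    _ ≤ 8 * ‖z‖ ^ 3 * 2 := by
        rw [← Finset.mul_sum]
        gcongr
        exact sum_geom_le_two (by positivity) (by linarith) n
    _ = _ := by ring

lemma norm_genField_sub_le {S : ℝ} (hS : 64 * ((n : ℝ) + 1) ^ 2 * S ^ 2 ≤ 1 / 8) {x y : Gevrey σ θ}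
    (hx : ‖x‖ ≤ S) (hy : ‖y‖ ≤ S) : ‖genField n x - genField n y‖ ≤ 48 * S ^ 2 * ‖x - y‖ := by
  set w := 64 * ((n : ℝ) + 1) ^ 2 with hw
  have hw0 : 0 ≤ w := by positivity
  clear_value w
  have hS0 : 0 ≤ S := (norm_nonneg _).trans hx
  rw [genField_eq, genField_eq, ← Finset.sum_sub_distrib]
  calc _ ≤ ∑ q ∈ Finset.range n, ‖vf (truncGen n (q + 1)) x - vf (truncGen n (q + 1)) y‖ :=
        norm_sum_le _ _
    _ ≤ ∑ q ∈ Finset.range n, 24 * S ^ 2 * ‖x - y‖ * (4 * (w * S ^ 2)) ^ q := by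
        refine Finset.sum_le_sum fun q _ => ?_
        refine (norm_vf_sub_le hσ hθ hθ1 (norm_truncGen_le (Nat.le_add_left 1 q))
          x y hx hy).trans ?_
        rw [Nat.add_sub_cancel, Nat.add_sub_cancel, ← hw]
        have h2 : (q : ℝ) + 1 ≤ 2 ^ q := by exact_mod_cast Nat.lt_two_pow_self (n := q)
        have h3 : (1 : ℝ) ≤ 2 ^ q := one_le_pow₀ (by norm_num)
        have h4 : ((q : ℝ) + 2) * (2 * q + 3) ≤ 6 * 4 ^ q := by
          rw [show (4 : ℝ) = 2 * 2 by norm_num, mul_pow]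
          nlinarith
        have e : 2 * (((2 * (q + 1) + 1 : ℕ) : ℝ) + 1) * w ^ q * ((2 * (q + 1) + 1 : ℕ) : ℝ)
              * S ^ (2 * (q + 1)) * ‖x - y‖
            = 4 * (((q : ℝ) + 2) * (2 * q + 3)) * (w ^ q * S ^ (2 * q) * S ^ 2 * ‖x - y‖) := by
          push_cast
          ring
        rw [e]
        calc _ ≤ 4 * (6 * 4 ^ q) * (w ^ q * S ^ (2 * q) * S ^ 2 * ‖x - y‖) := by gcongr
          _ = _ := by rw [mul_pow, mul_pow, pow_mul]; ring
    _ ≤ 24 * S ^ 2 * ‖x - y‖ * 2 := by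
        rw [← Finset.mul_sum]
        gcongr
        exact sum_geom_le_two (by positivity) (by linarith) n
    _ = _ := by ring

lemma exists_smallField {S : ℝ} (hS0 : 0 < S) (hS : 64 * ((n : ℝ) + 1) ^ 2 * S ^ 2 ≤ 1 / 8)
    (hS' : 48 * S ^ 2 ≤ 1 / 2) :
    ∃ Xh, SmallField (genField n : Gevrey σ θ → Gevrey σ θ) Xh S := by
  choose B hB using exists_truncGen_bound n
  choose Xh hXh hXh' using fun a => exists_curve_lift (vfML hσ hθ hθ1 (hB a))
  refine ⟨fun γ => ∑ a ∈ Finset.range (n + 1), Xh a γ, hS0, fun γ t => ?_, ?_, ?_, ?_, ?_⟩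
  · rw [ContinuousMap.sum_apply]
    exact Finset.sum_congr rfl fun a _ => hXh' a γ t
  · exact ContDiff.sum fun a _ => contDiff_vf hσ hθ hθ1 (hB a)
  · exact ContDiff.sum fun a _ => hXh a
  · have := norm_genField_le hσ hθ hθ1 n (z := 0) (by simp)
    simpa using this
  · intro x hx y hy
    rw [mem_ball_zero_iff] at hx hy
    refine (norm_genField_sub_le hσ hθ hθ1 n hS hx.le hy.le).trans ?_
    exact mul_le_mul_of_nonneg_right hS' (norm_nonneg _)

/-- The Hamiltonian field is infinitesimally symplectic. -/
lemma omega_fderiv_genField (y u w : Gevrey σ θ) :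
    omega hσ (fderiv ℝ (genField n) y u) w + omega hσ u (fderiv ℝ (genField n) y w) = 0 := by
  choose B hB using exists_truncGen_bound n
  have hw := fun a => weighted_bound (θ := θ) hσ (hB a)
  -- A potential for the field, `ω(X, v) = df(v)`. The linearised field paired with `v` is then the
  -- Hessian of `f`, and its symmetry is the claim.
  let f : Gevrey σ θ → ℝ := fun z =>
    -(1 / 2) * (∑ a ∈ Finset.range (n + 1), polyEval (truncGen n a) z).re
  have hf : ContDiff ℝ ∞ f :=
    contDiff_const.mul (Complex.reCLM.contDiff.comp
      (ContDiff.sum fun a _ => contDiff_polyEval (hw a)))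
  have hX : ContDiff ℝ ∞ (genField n : Gevrey σ θ → Gevrey σ θ) :=
    ContDiff.sum fun a _ => contDiff_vf hσ hθ hθ1 (hB a)
  have hgrad : ∀ z v, omega hσ (genField n z) v = fderiv ℝ f z v := by
    intro z v
    have h1 : HasFDerivAt (fun z : Gevrey σ θ => ∑ a ∈ Finset.range (n + 1), polyEval (truncGen n a) z)
        (∑ a ∈ Finset.range (n + 1), fderiv ℝ (polyEval (truncGen n a)) z) z :=
      HasFDerivAt.fun_sum fun a _ =>
        ((contDiff_polyEval (hw a)).differentiable (by simp) z).hasFDerivAt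
    have h2 : HasFDerivAt f (-(1 / 2 : ℝ) • Complex.reCLM.comp
        (∑ a ∈ Finset.range (n + 1), fderiv ℝ (polyEval (truncGen n a)) z)) z :=
      (Complex.reCLM.hasFDerivAt.comp z h1).const_mul (-(1 / 2))
    rw [h2.fderiv, genField, map_sum]
    have h3 : ∀ a ∈ Finset.range (n + 1), omega hσ (vf (truncGen n a) z) v
        = -(1 / 2) * (fderiv ℝ (polyEval (truncGen n a)) z v).re := fun a _ =>
      omega_vf hσ hθ hθ1 (hB a) (good_truncGen n a).1 (good_truncGen n a).2 z v
    rw [sum_apply, Finset.sum_congr rfl h3, ← Finset.mul_sum]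
    simp
  have hfd : HasFDerivAt (fun z => fderiv ℝ f z) (fderiv ℝ (fderiv ℝ f) y) y :=
    ((hf.fderiv_right (m := ∞) (by simp)).differentiable (by simp) y).hasFDerivAt
  have hXd := (hX.differentiable (by simp) y).hasFDerivAt
  have key : ∀ u v, omega hσ (fderiv ℝ (genField n) y u) v = fderiv ℝ (fderiv ℝ f) y u v := by
    intro u v
    have h1 : HasFDerivAt (fun z => omega hσ (genField n z) v)
        (((omega hσ).flip v).comp (fderiv ℝ (genField n) y)) y :=
      ((omega hσ).flip v).hasFDerivAt.comp y hXd
    have h2 : HasFDerivAt (fun z => omega hσ (genField n z) v)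
        ((ContinuousLinearMap.apply ℝ ℝ v).comp (fderiv ℝ (fderiv ℝ f) y)) y := by
      simp only [hgrad]
      exact (ContinuousLinearMap.apply ℝ ℝ v).hasFDerivAt.comp y hfd
    exact congrArg (fun T : Gevrey σ θ →L[ℝ] ℝ => T u) (h1.unique h2)
  have hsymm : fderiv ℝ (fderiv ℝ f) y u w = fderiv ℝ (fderiv ℝ f) y w u :=
    second_derivative_symmetric (fun z => (hf.differentiable (by simp) z).hasFDerivAt) hfd u w
  rw [omega_antisymm hσ u, key, key, hsymm, add_neg_cancel]

end

end Gevrey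
end

noncomputable section

/-! ### Convergence of the Lie series -/

/-- A Taylor series with geometrically decaying normalized derivatives converges. -/
lemma hasSum_taylor {g : ℕ → ℝ → ℂ} {M : ℝ}
    (hg : ∀ k, ∀ t ∈ Set.Icc (0 : ℝ) 1, HasDerivWithinAt (g k) (g (k + 1) t) (Set.Icc 0 1) t)
    (hM : ∀ k, ∀ t ∈ Set.Icc (0 : ℝ) 1, ‖g (k + 1) t‖ ≤ M * k.factorial * (1 / 16) ^ k) :
    HasSum (fun k => ((k + 1).factorial : ℝ)⁻¹ • g (k + 1) 0) (g 0 1 - g 0 0) := by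
  have h01 : (0 : ℝ) ∈ Set.Icc (0 : ℝ) 1 := by simp
  have h11 : (1 : ℝ) ∈ Set.Icc (0 : ℝ) 1 := by simp
  have hM0 : 0 ≤ M := by
    have := (norm_nonneg _).trans (hM 0 0 h01)
    simpa using this
  -- The Taylor polynomial centred at `t` and evaluated at `1`. Its derivative in `t` telescopes to
  -- one term, and its endpoint values are `g 0 1` and the partial sum at `0`.
  let E : ℕ → ℝ → ℂ := fun n t =>
    ∑ k ∈ Finset.range (n + 1), ((1 - t) ^ k * (k.factorial : ℝ)⁻¹) • g k t
  have hE : ∀ n, ∀ t ∈ Set.Icc (0 : ℝ) 1, HasDerivWithinAt (E n)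
      (((1 - t) ^ n * (n.factorial : ℝ)⁻¹) • g (n + 1) t) (Set.Icc 0 1) t := by
    intro n
    induction n with
    | zero =>
      intro t ht
      simpa [E] using hg 0 t ht
    | succ n ih =>
      intro t ht
      have hfac : (n.factorial : ℝ) ≠ 0 := by exact_mod_cast n.factorial_ne_zero
      have h1 : HasDerivWithinAt (fun t : ℝ => (1 - t) ^ (n + 1) * ((n + 1).factorial : ℝ)⁻¹)
          (-((1 - t) ^ n * (n.factorial : ℝ)⁻¹)) (Set.Icc 0 1) t := by
        have := ((((hasDerivAt_id t).const_sub 1).pow (n + 1)).mul_const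
          ((n + 1).factorial : ℝ)⁻¹).hasDerivWithinAt (s := Set.Icc 0 1)
        refine this.congr_deriv ?_
        rw [Nat.factorial_succ]
        push_cast
        have : (n : ℝ) + 1 ≠ 0 := by positivity
        simp
        field_simp
      have h2 := (ih t ht).add (h1.smul (hg (n + 1) t ht))
      have e : E (n + 1) = E n + fun t => ((1 - t) ^ (n + 1) * ((n + 1).factorial : ℝ)⁻¹) • g (n + 1) t := by
        funext t
        simp only [E, Pi.add_apply]
        rw [Finset.sum_range_succ]
      rw [e]
      refine h2.congr_deriv ?_
      simp only [neg_smul]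
      abel
  have hbound : ∀ n, ‖E n 1 - E n 0‖ ≤ M * (1 / 16) ^ n := by
    intro n
    have h := (convex_Icc (0 : ℝ) 1).norm_image_sub_le_of_norm_hasDerivWithin_le
      (C := M * (1 / 16) ^ n) (hE n) (fun t ht => ?_) h01 h11
    · simpa using h
    · have hfac : (0 : ℝ) < n.factorial := by exact_mod_cast n.factorial_pos
      have h1 : |(1 - t) ^ n| ≤ 1 := by
        rw [abs_pow]
        exact pow_le_one₀ (abs_nonneg _) (abs_le.2 ⟨by linarith [ht.2], by linarith [ht.1]⟩)
      rw [norm_smul, norm_mul, Real.norm_eq_abs, Real.norm_eq_abs, abs_of_pos (inv_pos.2 hfac)]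
      calc _ ≤ 1 * (n.factorial : ℝ)⁻¹ * (M * n.factorial * (1 / 16) ^ n) := by
            gcongr
            exact hM n t ht
        _ = _ := by field_simp
  have e1 : ∀ n, E n 1 = g 0 1 := by
    intro n
    simp only [E]
    rw [Finset.sum_range_succ']
    simp
  have e0 : ∀ n, E n 0 = g 0 0 + ∑ k ∈ Finset.range n, ((k + 1).factorial : ℝ)⁻¹ • g (k + 1) 0 := by
    intro n
    simp only [E]
    rw [Finset.sum_range_succ']
    simp [add_comm]
  have hsum : Summable fun k => ((k + 1).factorial : ℝ)⁻¹ • g (k + 1) 0 := by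
    refine Summable.of_norm_bounded (g := fun k => M * (1 / 16 : ℝ) ^ k)
      ((summable_geometric_of_lt_one (by norm_num) (by norm_num)).mul_left M) fun k => ?_
    have hfac : (0 : ℝ) < k.factorial := by exact_mod_cast k.factorial_pos
    have hfac' : (k.factorial : ℝ) ≤ (k + 1).factorial := by
      exact_mod_cast Nat.factorial_le (Nat.le_succ k)
    rw [norm_smul, Real.norm_eq_abs, abs_of_nonneg (by positivity)]
    calc _ ≤ (k.factorial : ℝ)⁻¹ * (M * k.factorial * (1 / 16) ^ k) := by
          gcongr
          exact hM k 0 h01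
      _ = _ := by field_simp
  rw [hsum.hasSum_iff_tendsto_nat, tendsto_iff_norm_sub_tendsto_zero]
  refine squeeze_zero (fun _ => norm_nonneg _) (fun n => ?_)
    (((tendsto_pow_atTop_nhds_zero_of_lt_one (by norm_num : (0 : ℝ) ≤ 1 / 16)
      (by norm_num)).const_mul M).trans (by simp))
  have := hbound n
  rw [e1, e0, ← norm_neg] at this
  rwa [show ∀ a b c : ℂ, -(a - (b + c)) = c - (a - b) by intros; ring] at this

/-- Boundedness of coefficients. -/
def BddCoef {k : ℕ} (c : (Fin k → Mode) → ℂ) : Prop := ∃ B : ℝ, ∀ j, ‖c j‖ ≤ B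

lemma bddCoef_zero {k : ℕ} : BddCoef (0 : (Fin k → Mode) → ℂ) := ⟨0, fun _ => by simp⟩

lemma BddCoef.add {k : ℕ} {c d : (Fin k → Mode) → ℂ} (hc : BddCoef c) (hd : BddCoef d) :
    BddCoef (c + d) := by
  obtain ⟨B, hB⟩ := hc
  obtain ⟨D, hD⟩ := hd
  exact ⟨B + D, fun j => (norm_add_le _ _).trans (add_le_add (hB j) (hD j))⟩

lemma BddCoef.smul {k : ℕ} {c : (Fin k → Mode) → ℂ} (hc : BddCoef c) (s : ℝ) :
    BddCoef (s • c) := by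
  obtain ⟨B, hB⟩ := hc
  exact ⟨‖s‖ * B, fun j => by
    rw [Pi.smul_apply, norm_smul]
    exact mul_le_mul_of_nonneg_left (hB j) (norm_nonneg _)⟩

lemma BddCoef.sum {k : ℕ} {ι : Type*} {s : Finset ι} {f : ι → (Fin k → Mode) → ℂ}
    (h : ∀ i ∈ s, BddCoef (f i)) : BddCoef (∑ i ∈ s, f i) :=
  Finset.sum_induction f BddCoef (fun _ _ h h' => h.add h') bddCoef_zero h

lemma bddCoef_bracketAt {a b p : ℕ} {χ : Coef a} {Q : Coef b} (hχ : BddCoef χ) (hQ : BddCoef Q) :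
    BddCoef (bracketAt p χ Q) := by
  unfold bracketAt
  split_ifs with h
  · obtain ⟨B, hB⟩ := hχ
    obtain ⟨D, hD⟩ := hQ
    exact ⟨_, norm_bracket_le h hB hD⟩
  · exact bddCoef_zero

lemma bddCoef_lieD {F Q : Family} (hF : ∀ p, BddCoef (F p)) (hQ : ∀ p, BddCoef (Q p)) (p : ℕ) :
    BddCoef (lieD F Q p) :=
  BddCoef.sum fun _ _ => bddCoef_bracketAt (hF _) (hQ _)

lemma bddCoef_quartic (p : ℕ) : BddCoef (quartic p) := by
  match p with
  | 0 => exact bddCoef_zero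
  | 1 => exact ⟨_, norm_quarticCoef_le⟩
  | p + 2 => exact bddCoef_zero

lemma norm_iterate_le_pow {n : ℕ} (hn : 1 ≤ n) (k p : ℕ) (j : Fin (2 * p + 1 + 1) → Mode) :
    ‖(lieD (truncGen n))^[k] (firstDer (truncGen n)) p j‖
      ≤ k.factorial * (1 / 16) ^ k
        * (6 * (64 * ((n : ℝ) + 1) ^ 2)⁻¹ * (6 * (64 * ((n : ℝ) + 1) ^ 2)) ^ p) := by
  have h := norm_iterate_le hn k p j
  have hy : 0 < 64 * ((n : ℝ) + 1) ^ 2 := by positivity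
  generalize 64 * ((n : ℝ) + 1) ^ 2 = y at h hy ⊢
  have hfac : (0 : ℝ) < k.factorial := by exact_mod_cast k.factorial_pos
  calc _ = (‖(lieD (truncGen n))^[k] (firstDer (truncGen n)) p j‖ / k.factorial * (y⁻¹) ^ p)
        * (k.factorial * y ^ p) := by
        rw [inv_pow]
        field_simp
    _ ≤ ((1 / 16) ^ k * 6 ^ (p + 1) * y⁻¹) * (k.factorial * y ^ p) := by gcongr
    _ = _ := by rw [mul_pow]; ring

/-- Summing the decay `16^(-k)` leaves growth that is only geometric in the order. This covers
orders beyond `n`, where the homological equation is no longer solved. -/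
lemma norm_transformed_le {n : ℕ} (hn : 1 ≤ n) (p : ℕ) (j : Fin (2 * p + 1 + 1) → Mode) :
    ‖transformed (truncGen n) p j‖
      ≤ 13 * (64 * ((n : ℝ) + 1) ^ 2)⁻¹ * (6 * (64 * ((n : ℝ) + 1) ^ 2)) ^ p := by
  have h := fun k => norm_iterate_le_pow hn k p j
  have hy : 0 < 64 * ((n : ℝ) + 1) ^ 2 := by positivity
  generalize 64 * ((n : ℝ) + 1) ^ 2 = y at h hy ⊢
  have h1 : ‖quartic p j‖ ≤ y⁻¹ * (6 * y) ^ p := by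
    match p with
    | 0 => exact (show ‖quartic 0 j‖ = 0 by simp [quartic]).le.trans (by positivity)
    | 1 =>
      have : y⁻¹ * (6 * y) ^ 1 = 6 := by field_simp
      rw [this]
      exact (norm_quarticCoef_le j).trans (by norm_num)
    | p + 2 => exact (show ‖quartic (p + 2) j‖ = 0 by simp [quartic]).le.trans (by positivity)
  have h2 : ‖∑ k ∈ Finset.range (p + 1), ((k + 1).factorial : ℝ)⁻¹ •
      (lieD (truncGen n))^[k] (firstDer (truncGen n)) p j‖ ≤ 2 * (6 * y⁻¹ * (6 * y) ^ p) := by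
    refine (norm_sum_le _ _).trans ?_
    calc _ ≤ ∑ k ∈ Finset.range (p + 1), (1 / 16 : ℝ) ^ k * (6 * y⁻¹ * (6 * y) ^ p) := by
          refine Finset.sum_le_sum fun k _ => ?_
          have hfac : (0 : ℝ) < k.factorial := by exact_mod_cast k.factorial_pos
          have hfac' : (k.factorial : ℝ) ≤ (k + 1).factorial := by
            exact_mod_cast Nat.factorial_le (Nat.le_succ k)
          rw [norm_smul, Real.norm_eq_abs, abs_of_nonneg (by positivity)]
          calc _ ≤ (k.factorial : ℝ)⁻¹
                * (k.factorial * (1 / 16) ^ k * (6 * y⁻¹ * (6 * y) ^ p)) := by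
                gcongr
                exact h k
            _ = _ := by field_simp
      _ ≤ _ := by
          rw [← Finset.sum_mul]
          gcongr
          exact sum_geom_le_two (by norm_num) (by norm_num) _
  simp only [transformed, Pi.add_apply, Finset.sum_apply, Pi.smul_apply]
  refine (norm_add_le _ _).trans ?_
  linarith

lemma bddCoef_iterate {n : ℕ} (hn : 1 ≤ n) (k p : ℕ) :
    BddCoef ((lieD (truncGen n))^[k] (firstDer (truncGen n)) p) :=
  ⟨_, norm_iterate_le_pow hn k p⟩

lemma quadD_zero {k : ℕ} : quadD (0 : (Fin k → Mode) → ℂ) = 0 := by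
  funext j
  simp [quadD]

lemma firstDer_support {n : ℕ} (p : ℕ) (hp : n + 1 < p) : firstDer (truncGen n) p = 0 := by
  rw [firstDer, truncGen_eq_zero (by omega), quadD_zero, zero_add]
  exact lieD_support (fun a => truncGen_eq_zero) (fun b hb => quartic_of_ne (by omega)) p hp

/-- Finite support makes each iterate an honest polynomial, which can be differentiated along the
flow without any limit. -/
lemma exists_iterate_support (n k : ℕ) : ∃ N, ∀ p, N < p →
    (lieD (truncGen n))^[k] (firstDer (truncGen n)) p = 0 := by
  induction k with
  | zero => exact ⟨n + 1, firstDer_support⟩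
  | succ k ih =>
    obtain ⟨N, hN⟩ := ih
    refine ⟨n + N, fun p hp => ?_⟩
    rw [Function.iterate_succ_apply']
    exact lieD_support (fun a => truncGen_eq_zero) hN p hp

/-! ### Values of formal sums along the flow -/

namespace Gevrey

variable {σ θ : ℝ}

lemma polyEval_zero {k : ℕ} (z : Gevrey σ θ) : polyEval (0 : (Fin k → Mode) → ℂ) z = 0 := by
  simp [polyEval]

lemma polyEval_add (hσ : 0 < σ) {k : ℕ} {c d : (Fin k → Mode) → ℂ} (hc : BddCoef c)
    (hd : BddCoef d) (z : Gevrey σ θ) : polyEval (c + d) z = polyEval c z + polyEval d z := by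
  obtain ⟨B, hB⟩ := hc
  obtain ⟨D, hD⟩ := hd
  rw [polyEval, polyEval, polyEval, ← (summable_poly (weighted_bound hσ hB) z).tsum_add
    (summable_poly (weighted_bound hσ hD) z)]
  simp only [Pi.add_apply, add_mul]

lemma polyEval_smul {k : ℕ} (c : (Fin k → Mode) → ℂ) (s : ℝ) (z : Gevrey σ θ) :
    polyEval (s • c) z = s • polyEval c z := by
  rw [polyEval, polyEval, ← tsum_const_smul'']
  simp only [Pi.smul_apply, smul_mul_assoc]

lemma polyEval_sum (hσ : 0 < σ) {k : ℕ} {ι : Type*} (s : Finset ι) {f : ι → (Fin k → Mode) → ℂ}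
    (h : ∀ i ∈ s, BddCoef (f i)) (z : Gevrey σ θ) :
    polyEval (∑ i ∈ s, f i) z = ∑ i ∈ s, polyEval (f i) z := by
  classical
  induction s using Finset.induction_on with
  | empty => simp [polyEval_zero]
  | insert i s hi ih =>
    have h' : ∀ i ∈ s, BddCoef (f i) := fun i hi => h i (Finset.mem_insert_of_mem hi)
    rw [Finset.sum_insert hi, Finset.sum_insert hi,
      polyEval_add hσ (h i (Finset.mem_insert_self _ _)) (BddCoef.sum h'), ih h']

lemma differentiable_polyEval (hσ : 0 < σ) {k : ℕ} {c : (Fin k → Mode) → ℂ} (hc : BddCoef c) :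
    Differentiable ℝ (polyEval c : Gevrey σ θ → ℂ) := by
  obtain ⟨B, hB⟩ := hc
  exact (contDiff_polyEval (weighted_bound hσ hB)).differentiable (by simp)

lemma norm_fderiv_polyEval_le (hσ : 0 < σ) {k : ℕ} {c : (Fin (k + 1) → Mode) → ℂ} {B : ℝ}
    (hB : ∀ j, ‖c j‖ ≤ B) (z : Gevrey σ θ) :
    ‖fderiv ℝ (polyEval c) z‖ ≤ (k + 1) * B * ‖z‖ ^ k := by
  have hB0 := bound_nonneg hB
  refine ContinuousLinearMap.opNorm_le_bound _ (by positivity) fun v => ?_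
  rw [fderiv_polyEval (weighted_bound hσ hB)]
  refine tsum_of_norm_bounded ((hasSum_mode v).mul_left _) fun i => ?_
  rw [norm_mul]
  have := norm_polyEval_le (norm_dcoef_le_weight (weighted_bound (θ := θ) hσ hB) i) z
  calc _ ≤ ‖sc v i‖ * ((k + 1) * B * gevreyWeight σ θ i.2 * ‖z‖ ^ k) := by gcongr
    _ = _ := by ring

lemma fderiv_polyEval_genField (hσ : 0 < σ) (hθ : 0 < θ) (hθ1 : θ < 1) (n : ℕ) {b : ℕ} {Q : Coef b}
    (hQ : BddCoef Q) (z : Gevrey σ θ) :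
    fderiv ℝ (polyEval Q) z (genField n z)
      = ∑ a ∈ Finset.range (n + 1), polyEval (bracketAt (a + b) (truncGen n a) Q) z := by
  obtain ⟨D, hD⟩ := hQ
  rw [genField, map_sum]
  refine Finset.sum_congr rfl fun a _ => ?_
  obtain ⟨B, hB⟩ := exists_truncGen_bound n a
  have h : 2 * a + 1 + (2 * b + 1) = 2 * (a + b) + 1 + 1 := by ring
  rw [bracketAt, dif_pos h, fderiv_polyEval_vf hσ hθ hθ1 hB (good_truncGen n a).2 h hD]

/-- The value of a formal sum. -/
def famEval (Q : Family) (z : Gevrey σ θ) : ℂ := ∑' p, polyEval (Q p) z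

lemma famEval_eq_sum {Q : Family} {N : ℕ} (hQ : ∀ p, N < p → Q p = 0) (z : Gevrey σ θ) :
    famEval Q z = ∑ p ∈ Finset.range (N + 1), polyEval (Q p) z :=
  tsum_eq_sum fun p hp => by
    rw [hQ p (by simpa using hp), polyEval_zero]

lemma famEval_lieD (hσ : 0 < σ) {F Q : Family} {A N : ℕ} (hF : ∀ p, A < p → F p = 0)
    (hQ : ∀ p, N < p → Q p = 0) (hF' : ∀ p, BddCoef (F p)) (hQ' : ∀ p, BddCoef (Q p))
    (z : Gevrey σ θ) : famEval (lieD F Q) z = ∑ b ∈ Finset.range (N + 1),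
      ∑ a ∈ Finset.range (A + 1), polyEval (bracketAt (a + b) (F a) (Q b)) z := by
  let f : ℕ × ℕ → ℂ := fun x => polyEval (bracketAt (x.1 + x.2) (F x.1) (Q x.2)) z
  have hmaps : ∀ x ∈ Finset.range (A + 1) ×ˢ Finset.range (N + 1),
      x.1 + x.2 ∈ Finset.range (A + N + 1) := fun x hx => by
    simp only [Finset.mem_product, Finset.mem_range] at hx ⊢
    omega
  rw [famEval_eq_sum (lieD_support hF hQ), Finset.sum_comm]
  refine Eq.trans ?_ (Finset.sum_product (f := f) _ _)
  rw [← Finset.sum_fiberwise_of_maps_to hmaps f]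
  refine Finset.sum_congr rfl fun p _ => ?_
  rw [lieD, polyEval_sum hσ _ fun x _ => bddCoef_bracketAt (hF' _) (hQ' _)]
  symm
  calc _ = ∑ x ∈ (Finset.range (A + 1) ×ˢ Finset.range (N + 1)).filter (fun x => x.1 + x.2 = p),
        polyEval (bracketAt p (F x.1) (Q x.2)) z := by
        refine Finset.sum_congr rfl fun x hx => ?_
        obtain rfl := (Finset.mem_filter.1 hx).2
        rfl
    _ = _ := by
        refine Finset.sum_subset (fun x hx => ?_) fun x _ hx' => ?_
        · exact Finset.HasAntidiagonal.mem_antidiagonal.2 (Finset.mem_filter.1 hx).2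
        · rename_i hx
          rw [Finset.HasAntidiagonal.mem_antidiagonal] at hx
          simp only [Finset.mem_filter, Finset.mem_product, Finset.mem_range, hx, and_true,
            not_and_or, not_lt] at hx'
          rcases hx' with h | h
          · rw [hF _ (by omega), bracketAt_zero_left, polyEval_zero]
          · rw [hQ _ (by omega), bracketAt_zero_right, polyEval_zero]

lemma hasFDerivAt_famEval (hσ : 0 < σ) {Q : Family} {N : ℕ} (hQ : ∀ p, N < p → Q p = 0)
    (hQ' : ∀ p, BddCoef (Q p)) (z : Gevrey σ θ) :
    HasFDerivAt (famEval Q) (∑ p ∈ Finset.range (N + 1), fderiv ℝ (polyEval (Q p)) z) z := by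
  have e : (famEval Q : Gevrey σ θ → ℂ) = fun z => ∑ p ∈ Finset.range (N + 1), polyEval (Q p) z :=
    funext fun z => famEval_eq_sum hQ z
  rw [e]
  exact HasFDerivAt.fun_sum fun p _ => (differentiable_polyEval hσ (hQ' p) z).hasFDerivAt

section

variable (hσ : 0 < σ) (hθ : 0 < θ) (hθ1 : θ < 1) {n : ℕ}

include hσ hθ hθ1

lemma hasDerivWithinAt_famEval {Q : Family} {N : ℕ} (hQ : ∀ p, N < p → Q p = 0)
    (hQ' : ∀ p, BddCoef (Q p)) {η : ℝ → Gevrey σ θ} {s : Set ℝ} {t : ℝ}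
    (hη : HasDerivWithinAt η (genField n (η t)) s t) :
    HasDerivWithinAt (fun t => famEval Q (η t)) (famEval (lieD (truncGen n) Q) (η t)) s t := by
  have h := (hasFDerivAt_famEval hσ hQ hQ' (η t)).comp_hasDerivWithinAt t hη
  refine h.congr_deriv ?_
  rw [famEval_lieD hσ (fun p => truncGen_eq_zero) hQ (exists_truncGen_bound n) hQ', sum_apply]
  exact Finset.sum_congr rfl fun b _ => fderiv_polyEval_genField hσ hθ hθ1 n (hQ' b) (η t)

/-- Along the flow `L₂` contributes `quadD` of the generator and the quartic part its bracket. After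
this derivative the large constant of `L₂` has disappeared. -/
lemma hasDerivWithinAt_hamiltonian (hn : 1 ≤ n) {η : ℝ → Gevrey σ θ} {s : Set ℝ} {t : ℝ}
    (hη : HasDerivWithinAt η (genField n (η t)) s t) :
    HasDerivWithinAt (fun t => polyEval l2Coef (η t) + polyEval quarticCoef (η t))
      (famEval (firstDer (truncGen n)) (η t)) s t := by
  obtain ⟨B, hB⟩ := exists_l2Coef_bound (σ := σ) (θ := θ) hσ hθ
  have hl := ((contDiff_polyEval hB).differentiable (by simp) (η t)).hasFDerivAt.comp_hasDerivWithinAt t hη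
  have hq0 : ∀ p, 1 < p → quartic p = 0 := fun p hp => quartic_of_ne (by omega)
  have hq := hasDerivWithinAt_famEval hσ hθ hθ1 (n := n) hq0 bddCoef_quartic hη
  have e : ∀ z : Gevrey σ θ, famEval quartic z = polyEval quarticCoef z := by
    intro z
    rw [famEval_eq_sum hq0, Finset.sum_range_succ, Finset.sum_range_one, quartic_zero,
      polyEval_zero, zero_add]
    rfl
  simp only [e] at hq
  refine (hl.add hq).congr_deriv ?_
  have hlie := bddCoef_lieD (exists_truncGen_bound n) bddCoef_quartic
  -- Boundedness is read off from `firstDer` minus the bracket, both already bounded.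
  have hquad : ∀ p, BddCoef (quadD (truncGen n p)) := by
    intro p
    have := (bddCoef_iterate hn 0 p).add ((hlie p).smul (-1))
    convert this using 1
    simp [firstDer]
  have h1 : fderiv ℝ (polyEval l2Coef) (η t) (genField n (η t))
      = ∑ p ∈ Finset.range (n + 1 + 1), polyEval (quadD (truncGen n p)) (η t) := by
    rw [Finset.sum_range_succ, truncGen_eq_zero (Nat.lt_succ_self n), quadD_zero,
      polyEval_zero, add_zero, genField, map_sum]
    refine Finset.sum_congr rfl fun p _ => ?_
    obtain ⟨B, hB⟩ := exists_truncGen_bound n p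
    exact fderiv_L2_vf hσ hθ hθ1 hB (good_truncGen n p).1 (good_truncGen n p).2 _
  rw [h1, famEval_eq_sum (lieD_support (fun a => truncGen_eq_zero) hq0),
    famEval_eq_sum firstDer_support, ← Finset.sum_add_distrib]
  exact Finset.sum_congr rfl fun p _ => (polyEval_add hσ (hquad p) (hlie p) _).symm

/-- The threshold `1/64` makes the ratio in `p` at most `6 / 64 ≤ 1/2`, so the double series in time
order and degree converges absolutely. -/
lemma norm_polyEval_iterate_le (hn : 1 ≤ n) {z : Gevrey σ θ}
    (hz : 64 * ((n : ℝ) + 1) ^ 2 * ‖z‖ ^ 2 ≤ 1 / 64) (k p : ℕ) :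
    ‖polyEval ((lieD (truncGen n))^[k] (firstDer (truncGen n)) p) z‖
      ≤ k.factorial * (1 / 16) ^ k * (1 / 2) ^ p := by
  have h := norm_polyEval_le (weighted_bound (θ := θ) hσ (norm_iterate_le_pow hn k p)) z
  refine h.trans ?_
  have hy : 1 ≤ 64 * ((n : ℝ) + 1) ^ 2 := by nlinarith [(Nat.cast_nonneg n : (0 : ℝ) ≤ n)]
  generalize 64 * ((n : ℝ) + 1) ^ 2 = y at hz hy ⊢
  have h1 : 6 * ‖z‖ ^ 2 ≤ 1 := by nlinarith [sq_nonneg ‖z‖]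
  have h2 : y⁻¹ ≤ 1 := inv_le_one_of_one_le₀ hy
  calc _ = k.factorial * (1 / 16) ^ k * ((6 * ‖z‖ ^ 2) * y⁻¹ * (6 * (y * ‖z‖ ^ 2)) ^ p) := by
        rw [mul_pow, mul_pow, mul_pow]; ring
    _ ≤ k.factorial * (1 / 16) ^ k * (1 * 1 * (1 / 2) ^ p) := by
        gcongr
        linarith
    _ = _ := by ring

lemma norm_famEval_iterate_le (hn : 1 ≤ n) {z : Gevrey σ θ}
    (hz : 64 * ((n : ℝ) + 1) ^ 2 * ‖z‖ ^ 2 ≤ 1 / 64) (k : ℕ) :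
    ‖famEval ((lieD (truncGen n))^[k] (firstDer (truncGen n))) z‖
      ≤ 2 * k.factorial * (1 / 16) ^ k := by
  refine (tsum_of_norm_bounded (hasSum_geometric_two.mul_left _)
    (norm_polyEval_iterate_le hσ hθ hθ1 hn hz k)).trans (le_of_eq ?_)
  ring

lemma summable_famEval_transformed (hn : 1 ≤ n) {z : Gevrey σ θ}
    (hz : 64 * ((n : ℝ) + 1) ^ 2 * ‖z‖ ^ 2 ≤ 1 / 64) :
    Summable fun p => polyEval (transformed (truncGen n) p) z := by
  refine Summable.of_norm_bounded (summable_geometric_two.mul_left 13) fun p => ?_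
  refine (norm_polyEval_le (weighted_bound (θ := θ) hσ (norm_transformed_le hn p)) z).trans ?_
  have hy : 1 ≤ 64 * ((n : ℝ) + 1) ^ 2 := by nlinarith [(Nat.cast_nonneg n : (0 : ℝ) ≤ n)]
  generalize 64 * ((n : ℝ) + 1) ^ 2 = y at hz hy ⊢
  have h1 : ‖z‖ ^ 2 ≤ 1 := by nlinarith [sq_nonneg ‖z‖]
  have h2 : y⁻¹ ≤ 1 := inv_le_one_of_one_le₀ hy
  calc _ = 13 * (‖z‖ ^ 2 * y⁻¹ * (6 * (y * ‖z‖ ^ 2)) ^ p) := by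
        rw [mul_pow, mul_pow, mul_pow]; ring
    _ ≤ 13 * (1 * 1 * (1 / 2) ^ p) := by
        gcongr
        linarith
    _ = _ := by ring

/-- The Hamiltonian at the end point of an integral curve of the generator. -/
lemma hamiltonian_flow (hn : 1 ≤ n) {η : ℝ → Gevrey σ θ}
    (hη : ∀ t ∈ Set.Icc (0 : ℝ) 1, HasDerivWithinAt η (genField n (η t)) (Set.Icc 0 1) t)
    (hb : ∀ t ∈ Set.Icc (0 : ℝ) 1, 64 * ((n : ℝ) + 1) ^ 2 * ‖η t‖ ^ 2 ≤ 1 / 64) :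
    polyEval l2Coef (η 1) + polyEval quarticCoef (η 1)
      = polyEval l2Coef (η 0) + famEval (transformed (truncGen n)) (η 0) := by
  set D : ℕ → Family := fun k => (lieD (truncGen n))^[k] (firstDer (truncGen n)) with hD
  let g : ℕ → ℝ → ℂ := fun k => Nat.casesOn k
    (fun t => polyEval l2Coef (η t) + polyEval quarticCoef (η t)) (fun k t => famEval (D k) (η t))
  have hg : ∀ k, ∀ t ∈ Set.Icc (0 : ℝ) 1,
      HasDerivWithinAt (g k) (g (k + 1) t) (Set.Icc 0 1) t := by
    intro k t ht
    cases k with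
    | zero => exact hasDerivWithinAt_hamiltonian hσ hθ hθ1 hn (hη t ht)
    | succ k =>
      obtain ⟨N, hN⟩ := exists_iterate_support n k
      have := hasDerivWithinAt_famEval hσ hθ hθ1 hN (bddCoef_iterate hn k) (hη t ht)
      rw [← Function.iterate_succ_apply' (f := lieD (truncGen n))] at this
      exact this
  have hs := hasSum_taylor hg (M := 2) fun k t ht =>
    norm_famEval_iterate_le hσ hθ hθ1 hn (hb t ht) k
  set z := η 0 with hz0
  have hz := hb 0 (by simp)
  rw [← hz0] at hz
  -- Absolute summability permits collecting the Taylor series by degree instead of by time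
  -- derivative.
  have hdouble : Summable fun x : ℕ × ℕ =>
      ((x.1 + 1).factorial : ℝ)⁻¹ • polyEval (D x.1 x.2) z := by
    refine Summable.of_norm_bounded ((summable_geometric_of_lt_one (by norm_num : (0 : ℝ) ≤ 1 / 16)
      (by norm_num)).mul_of_nonneg summable_geometric_two (fun k => by positivity)
      (fun p => by positivity)) fun x => ?_
    have hfac : (0 : ℝ) < x.1.factorial := by exact_mod_cast x.1.factorial_pos
    have hfac' : (x.1.factorial : ℝ) ≤ (x.1 + 1).factorial := by
      exact_mod_cast Nat.factorial_le (Nat.le_succ x.1)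
    rw [norm_smul, Real.norm_eq_abs, abs_of_nonneg (by positivity)]
    calc _ ≤ (x.1.factorial : ℝ)⁻¹ * (x.1.factorial * (1 / 16) ^ x.1 * (1 / 2) ^ x.2) := by
          gcongr
          exact norm_polyEval_iterate_le hσ hθ hθ1 hn hz x.1 x.2
      _ = _ := by field_simp
  have h1 : g 0 1 - g 0 0 = ∑' p, ∑' k, ((k + 1).factorial : ℝ)⁻¹ • polyEval (D k p) z := by
    rw [← hs.tsum_eq]
    refine Eq.trans (tsum_congr fun k => ?_) (Summable.tsum_comm
      (f := fun k p => ((k + 1).factorial : ℝ)⁻¹ • polyEval (D k p) z) hdouble).symm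
    exact (tsum_const_smul'' _).symm
  have h2 : ∀ p, polyEval (transformed (truncGen n) p) z
      = polyEval (quartic p) z + ∑' k, ((k + 1).factorial : ℝ)⁻¹ • polyEval (D k p) z := by
    intro p
    have hb : ∀ k ∈ Finset.range (p + 1), BddCoef (((k + 1).factorial : ℝ)⁻¹ • D k p) :=
      fun k _ => (bddCoef_iterate hn k p).smul _
    rw [transformed, polyEval_add hσ (bddCoef_quartic p) (BddCoef.sum hb), polyEval_sum hσ _ hb,
      -- Iterates of index `k ≥ p` vanish at order `p`, so the finite sum in `transformed` is the
      -- full series.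
      tsum_eq_sum (s := Finset.range (p + 1)) fun k hk => ?_]
    · simp only [polyEval_smul]
    · rw [Finset.mem_range, not_lt] at hk
      have : D k p = 0 :=
        iterate_eq_zero (truncGen_zero n) (firstDer_zero (truncGen_zero n)) k p (by omega)
      rw [this, polyEval_zero, smul_zero]
  have h3 : HasSum (fun p => polyEval (quartic p) z) (polyEval quarticCoef z) :=
    hasSum_single 1 fun p hp => by rw [quartic_of_ne hp, polyEval_zero]
  have h4 := (summable_famEval_transformed hσ hθ hθ1 hn hz).hasSum.sub h3
  simp only [h2, add_sub_cancel_left] at h4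
  have h5 := h4.tsum_eq
  rw [← h1, ← funext h2] at h5
  change polyEval l2Coef (η 1) + polyEval quarticCoef (η 1) - (polyEval l2Coef z + polyEval quarticCoef z)
    = famEval (transformed (truncGen n)) z - polyEval quarticCoef z at h5
  linear_combination h5

/-! ### Fields and differentials of the transformed components, and the remainder -/

lemma norm_vf_transformed_le (hn : 1 ≤ n) (z : Gevrey σ θ) (p : ℕ) :
    ‖vf (transformed (truncGen n) p) z‖ ≤ 52 * (64 * ((n : ℝ) + 1) ^ 2)⁻¹ * ‖z‖
      * (12 * (64 * ((n : ℝ) + 1) ^ 2 * ‖z‖ ^ 2)) ^ p := by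
  refine (norm_vf_le hσ hθ hθ1 (norm_transformed_le hn p) z).trans ?_
  have hy : 0 < 64 * ((n : ℝ) + 1) ^ 2 := by positivity
  generalize 64 * ((n : ℝ) + 1) ^ 2 = y at hy ⊢
  have h2 : (p : ℝ) + 1 ≤ 2 ^ p := by exact_mod_cast Nat.lt_two_pow_self (n := p)
  calc _ = 52 * ((p : ℝ) + 1) * (y⁻¹ * (6 * y) ^ p * ‖z‖ ^ (2 * p + 1)) := by push_cast; ring
    _ ≤ 52 * 2 ^ p * (y⁻¹ * (6 * y) ^ p * ‖z‖ ^ (2 * p + 1)) := by gcongr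
    _ = _ := by
        rw [show 12 * (y * ‖z‖ ^ 2) = 2 * (6 * y) * ‖z‖ ^ 2 by ring, mul_pow (2 * (6 * y)), mul_pow 2 (6 * y)]
        ring

lemma norm_fderiv_transformed_le (hn : 1 ≤ n) {z : Gevrey σ θ} {S : ℝ} (hz : ‖z‖ ≤ S)
    (hS : 64 * ((n : ℝ) + 1) ^ 2 * S ^ 2 ≤ 1 / 64) (p : ℕ) :
    ‖fderiv ℝ (polyEval (transformed (truncGen n) p)) z‖
      ≤ 26 * (64 * ((n : ℝ) + 1) ^ 2)⁻¹ * S * (1 / 2) ^ p := by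
  refine (norm_fderiv_polyEval_le hσ (norm_transformed_le hn p) z).trans ?_
  have hy : 0 < 64 * ((n : ℝ) + 1) ^ 2 := by positivity
  generalize 64 * ((n : ℝ) + 1) ^ 2 = y at hS hy ⊢
  have hS0 : 0 ≤ S := (norm_nonneg _).trans hz
  have h2 : (p : ℝ) + 1 ≤ 2 ^ p := by exact_mod_cast Nat.lt_two_pow_self (n := p)
  calc _ = 26 * ((p : ℝ) + 1) * (y⁻¹ * (6 * y) ^ p * ‖z‖ ^ (2 * p + 1)) := by push_cast; ring
    _ ≤ 26 * 2 ^ p * (y⁻¹ * (6 * y) ^ p * S ^ (2 * p + 1)) := by gcongr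
    _ = 26 * y⁻¹ * S * (12 * (y * S ^ 2)) ^ p := by
        rw [show 12 * (y * S ^ 2) = 2 * (6 * y) * S ^ 2 by ring, mul_pow (2 * (6 * y)), mul_pow 2 (6 * y)]
        ring
    _ ≤ _ := by
        gcongr
        linarith

end

/-- The remainder of the normal form. -/
def remainder (n : ℕ) (z : Gevrey σ θ) : ℝ :=
  (∑' i, polyEval (transformed (truncGen n) (n + 1 + i)) z).re

lemma ofReal_remainder (n : ℕ) (z : Gevrey σ θ) :
    (remainder n z : ℂ) = ∑' i, polyEval (transformed (truncGen n) (n + 1 + i)) z := by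
  refine Complex.conj_eq_iff_re.1 ?_
  rw [Complex.conj_tsum]
  exact tsum_congr fun i => conj_polyEval (good_transformed (good_truncGen n) _).2 z

/-- The Hamiltonian vector field of the remainder. -/
lemma exists_remainder_field (hσ : 0 < σ) (hθ : 0 < θ) (hθ1 : θ < 1) {n : ℕ} (hn : 1 ≤ n) {S : ℝ}
    (hS : 64 * ((n : ℝ) + 1) ^ 2 * S ^ 2 ≤ 1 / 64) {z : Gevrey σ θ} (hz : z ∈ Metric.ball 0 S) :
    ∃ X : Gevrey σ θ, (∀ a, X a = hamVF (fun y => (remainder n y : ℂ)) z a) ∧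
      ‖X‖ ≤ 104 * (64 * ((n : ℝ) + 1) ^ 2)⁻¹ * ‖z‖
        * (12 * (64 * ((n : ℝ) + 1) ^ 2 * ‖z‖ ^ 2)) ^ (n + 1) := by
  set T := transformed (truncGen n) with hT
  have hb : ∀ p, ∀ j, ‖T p j‖ ≤ _ := norm_transformed_le hn
  have hz' : ‖z‖ < S := by simpa using hz
  have hS0 : 0 ≤ S := (norm_nonneg _).trans hz'.le
  have hd : HasFDerivAt (fun y : Gevrey σ θ => (remainder n y : ℂ))
      (∑' i, fderiv ℝ (polyEval (T (n + 1 + i))) z) z := by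
    simp only [ofReal_remainder]
    -- The differentials are bounded uniformly on the ball by a geometric series, which allows
    -- differentiation under the sum.
    refine hasFDerivAt_tsum_of_isPreconnected (u := fun i =>
        26 * (64 * ((n : ℝ) + 1) ^ 2)⁻¹ * S * (1 / 2) ^ (n + 1 + i))
      ?_ Metric.isOpen_ball (convex_ball (0 : Gevrey σ θ) S).isPreconnected
      (fun i y _ => (differentiable_polyEval hσ ⟨_, hb _⟩ y).hasFDerivAt)
      (fun i y hy => norm_fderiv_transformed_le hσ hθ hθ1 hn (mem_ball_zero_iff.1 hy).le hS _)
      hz ?_ hz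
    · simp only [pow_add _ (n + 1)]
      exact (summable_geometric_two.mul_left _).mul_left _
    · exact (summable_famEval_transformed hσ hθ hθ1 hn (z := z) ((mul_le_mul_of_nonneg_left
        (pow_le_pow_left₀ (norm_nonneg _) hz'.le 2) (by positivity)).trans hS)).comp_injective
        (add_right_injective (n + 1))
  have hds : Summable fun i => fderiv ℝ (polyEval (T (n + 1 + i))) z := by
    refine Summable.of_norm_bounded (g := fun i =>
        26 * (64 * ((n : ℝ) + 1) ^ 2)⁻¹ * S * (1 / 2) ^ (n + 1 + i)) ?_
      fun i => norm_fderiv_transformed_le hσ hθ hθ1 hn hz'.le hS _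
    simp only [pow_add _ (n + 1)]
    exact (summable_geometric_two.mul_left _).mul_left _
  have hvs : ∀ i, ‖vf (T (n + 1 + i)) z‖ ≤ 52 * (64 * ((n : ℝ) + 1) ^ 2)⁻¹ * ‖z‖
      * (12 * (64 * ((n : ℝ) + 1) ^ 2 * ‖z‖ ^ 2)) ^ (n + 1) * (1 / 2) ^ i := by
    intro i
    refine (norm_vf_transformed_le hσ hθ hθ1 hn z _).trans ?_
    rw [pow_add _ (n + 1), ← mul_assoc]
    gcongr
    have := (mul_le_mul_of_nonneg_left (pow_le_pow_left₀ (norm_nonneg _) hz'.le 2)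
      (by positivity : 0 ≤ 64 * ((n : ℝ) + 1) ^ 2)).trans hS
    linarith
  have hv : Summable fun i => vf (T (n + 1 + i)) z :=
    Summable.of_norm_bounded (summable_geometric_two.mul_left _) hvs
  refine ⟨∑' i, vf (T (n + 1 + i)) z, fun a => ?_, ?_⟩
  · have e1 := (coordL hσ a).map_tsum hv
    simp only [coordL_apply] at e1
    rw [e1, hamVF, dzbar, hd.fderiv]
    have e2 : ∀ v : Gevrey σ θ, HasSum (fun i => fderiv ℝ (polyEval (T (n + 1 + i))) z v)
        ((∑' i, fderiv ℝ (polyEval (T (n + 1 + i))) z) v) := fun v =>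
      (ContinuousLinearMap.apply ℝ ℂ v).hasSum hds.hasSum
    have e3 := (((e2 (single a 1)).add ((e2 (single a Complex.I)).mul_left Complex.I)).div_const
      2).mul_left Complex.I
    rw [← e3.tsum_eq]
    exact tsum_congr fun i => (hamVF_polyEval hσ hθ hθ1 (hb _)
      (good_transformed (good_truncGen n) _).1 z a).symm
  · refine (tsum_of_norm_bounded (hasSum_geometric_two.mul_left _) hvs).trans (le_of_eq ?_)
    ring

end Gevrey
end

noncomputable section

/-! ### Evaluation of the quartic terms -/

namespace Gevrey

variable {σ θ : ℝ}

lemma polyEval_comp_conjTuple {k : ℕ} {c : (Fin k → Mode) → ℂ} (hc : ∀ j, conj (c j) = c j)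
    (z : Gevrey σ θ) : polyEval (fun j => c (conjTuple j)) z = conj (polyEval c z) := by
  rw [polyEval, polyEval, conj_tsum_coeffs]
  refine tsum_congr fun j => ?_
  rw [map_mul, hc, conj_mono, conjTuple_conjTuple]

/-- The tuple of modes of `z_{a₁} z_{a₂} \bar z_{b₁} \bar z_{b₂}`. -/
def quartetTuple (q : ℤ × ℤ × ℤ × ℤ) : Fin 4 → Mode :=
  ![(1, q.1), (1, q.2.1), (-1, q.2.2.1), (-1, q.2.2.2)]

lemma quartetTuple_injective : Function.Injective quartetTuple := by
  rintro ⟨a, b, c, d⟩ ⟨a', b', c', d'⟩ h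
  have h0 := congrFun h 0
  have h1 := congrFun h 1
  have h2 := congrFun h 2
  have h3 := congrFun h 3
  simp [quartetTuple] at h0 h1 h2 h3
  rw [h0, h1, h2, h3]

lemma eq_quartetTuple {j : Fin 4 → Mode} (h : quarticHalf j ≠ 0) :
    j = quartetTuple ((j 0).2, (j 1).2, (j 2).2, (j 3).2) := by
  obtain ⟨h0, h1, h2, h3, -⟩ := (ite_ne_right_iff.1 h).1
  funext i
  fin_cases i
  · exact Prod.ext h0 rfl
  · exact Prod.ext h1 rfl
  · exact Prod.ext h2 rfl
  · exact Prod.ext h3 rfl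

lemma mono_quartetTuple (z : Gevrey σ θ) (a₁ a₂ b₁ b₂ : ℤ) :
    mono z (quartetTuple (a₁, a₂, b₁, b₂)) = z a₁ * z a₂ * conj (z b₁) * conj (z b₂) := by
  rw [mono, Fin.prod_univ_four, ← sc_one, ← sc_one, ← sc_neg_one, ← sc_neg_one]
  rfl

lemma quarticHalf_quartetTuple {a₁ a₂ b₁ b₂ : ℤ} (h : a₁ + a₂ = b₁ + b₂) (h' : a₁ ≠ b₁) :
    quarticHalf (quartetTuple (a₁, a₂, b₁, b₂)) = 1 / (4 * ((a₁ : ℂ) - (b₁ : ℂ)) ^ 2) :=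
  if_pos ⟨rfl, rfl, rfl, rfl, h, h'⟩

lemma polyEval_quarticHalf (z : Gevrey σ θ) : polyEval quarticHalf z = NLSP.P4 z / 2 := by
  have hinj : Function.Injective fun q : NLSP.quartets => quartetTuple q.1 :=
    quartetTuple_injective.comp Subtype.val_injective
  rw [polyEval, ← hinj.tsum_eq, NLSP.P4, ← tsum_div_const]
  · refine tsum_congr fun q => ?_
    obtain ⟨⟨a₁, a₂, b₁, b₂⟩, h, h'⟩ := q
    simp only
    rw [quarticHalf_quartetTuple h h', mono_quartetTuple, one_div, one_div, mul_inv, mul_inv]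
    ring
  · intro j hj
    have hne : quarticHalf j ≠ 0 := left_ne_zero_of_mul hj
    obtain ⟨-, -, -, -, h, h'⟩ := (ite_ne_right_iff.1 hne).1
    exact ⟨⟨((j 0).2, (j 1).2, (j 2).2, (j 3).2), h, h'⟩, (eq_quartetTuple hne).symm⟩

lemma conj_P4 (z : Gevrey σ θ) : conj (NLSP.P4 z) = NLSP.P4 z := by
  let e : NLSP.quartets ≃ NLSP.quartets :=
    { toFun := fun q => ⟨(q.1.2.2.1, q.1.2.2.2, q.1.1, q.1.2.1), q.2.1.symm, q.2.2.symm⟩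
      invFun := fun q => ⟨(q.1.2.2.1, q.1.2.2.2, q.1.1, q.1.2.1), q.2.1.symm, q.2.2.symm⟩
      left_inv := fun _ => rfl
      right_inv := fun _ => rfl }
  rw [NLSP.P4, Complex.conj_tsum, ← e.tsum_eq]
  refine tsum_congr fun q => ?_
  obtain ⟨⟨a₁, a₂, b₁, b₂⟩, h, h'⟩ := q
  simp only [e, Equiv.coe_fn_mk, map_mul, map_div₀, map_one, map_pow, map_sub, Complex.conj_conj,
    map_ofNat, map_intCast]
  ring

lemma polyEval_quarticCoef (hσ : 0 < σ) (z : Gevrey σ θ) :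
    polyEval quarticCoef z = NLSP.P4 z := by
  have h := polyEval_add hσ (c := quarticHalf) (d := fun j => quarticHalf (conjTuple j))
    ⟨_, norm_quarticHalf_le⟩ ⟨_, fun j => norm_quarticHalf_le _⟩ z
  rw [polyEval_comp_conjTuple conj_quarticHalf, polyEval_quarticHalf, map_div₀, conj_P4,
    map_ofNat, add_halves] at h
  exact h

/-- Quartic resonances are trivial: equal sums and equal sums of squares force the two pairs of
frequencies to agree, and `a₁ ≠ b₁` leaves only the crossed pairing. -/
lemma polyEval_resPart_quarticHalf (z : Gevrey σ θ) :
    polyEval (resPart quarticHalf) z = (NLSP.L4 z : ℂ) / 2 := by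
  have hinj : Function.Injective fun p : {p : ℤ × ℤ // p.1 ≠ p.2} =>
      quartetTuple (p.1.1, p.1.2, p.1.2, p.1.1) := by
    intro p q h
    have := quartetTuple_injective h
    simp only [Prod.mk.injEq] at this
    exact Subtype.ext (Prod.ext this.1 this.2.1)
  rw [polyEval, ← hinj.tsum_eq, NLSP.L4, Complex.ofReal_tsum, ← tsum_div_const]
  · refine tsum_congr fun p => ?_
    obtain ⟨⟨a₁, a₂⟩, h⟩ := p
    have hd : divisor (quartetTuple (a₁, a₂, a₂, a₁)) = 0 := by
      simp [divisor, Fin.sum_univ_four, quartetTuple]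
    simp only [resPart]
    rw [if_pos hd, quarticHalf_quartetTuple (add_comm _ _) h, mono_quartetTuple]
    push_cast
    rw [← Complex.mul_conj', ← Complex.mul_conj', one_div, one_div, mul_inv, mul_inv]
    ring
  · intro j hj
    have hne := (ite_ne_right_iff.1 (left_ne_zero_of_mul hj : resPart quarticHalf j ≠ 0))
    obtain ⟨hd, hne⟩ := hne
    have hj := eq_quartetTuple hne
    obtain ⟨-, -, -, -, h, h'⟩ := (ite_ne_right_iff.1 hne).1
    generalize (j 0).2 = a₁ at hj h h'
    generalize (j 1).2 = a₂ at hj h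
    generalize (j 2).2 = b₁ at hj h h'
    generalize (j 3).2 = b₂ at hj h
    subst hj
    simp [divisor, Fin.sum_univ_four, quartetTuple] at hd
    -- Substituting `b₂ = a₁ + a₂ - b₁` makes the divisor `2 (a₁ - b₁)(b₁ - a₂)`.
    have h1 : (a₁ - b₁) * (a₂ - b₁) = 0 := by
      obtain rfl : b₂ = a₁ + a₂ - b₁ := by linarith
      nlinarith
    have h2 : a₂ = b₁ := by
      rcases mul_eq_zero.1 h1 with h | h
      · exact absurd (sub_eq_zero.1 h) h'
      · exact sub_eq_zero.1 h
    subst h2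
    obtain rfl : a₁ = b₂ := by linarith
    exact ⟨⟨(a₁, a₂), h'⟩, rfl⟩

lemma polyEval_resPart_quarticCoef (hσ : 0 < σ) (z : Gevrey σ θ) :
    polyEval (resPart quarticCoef) z = (NLSP.L4 z : ℂ) := by
  have hb : ∀ j, ‖resPart quarticHalf j‖ ≤ 1 / 4 := fun j =>
    (norm_resPart_le _ _).trans (norm_quarticHalf_le j)
  have hc : ∀ j, conj (resPart quarticHalf j) = resPart quarticHalf j := by
    intro j
    unfold resPart
    split_ifs
    · exact conj_quarticHalf j
    · simp
  have h := polyEval_add hσ (c := resPart quarticHalf)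
    (d := fun j => resPart quarticHalf (conjTuple j)) ⟨_, hb⟩ ⟨_, fun j => hb _⟩ z
  rw [polyEval_comp_conjTuple hc, polyEval_resPart_quarticHalf, map_div₀, Complex.conj_ofReal,
    map_ofNat, add_halves] at h
  rw [← h]
  congr 1
  funext j
  simp only [resPart, quarticCoef, Pi.add_apply, divisor_conjTuple, neg_eq_zero]
  split_ifs <;> simp

end Gevrey

/-- At order one all brackets vanish and the obstruction is the quartic Hamiltonian itself. -/
lemma transformed_one {n : ℕ} (hn : 1 ≤ n) :
    transformed (truncGen n) 1 = resPart quarticCoef := by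
  have h1 : lieD (truncGen n) quartic 1 = 0 :=
    iterate_eq_zero (truncGen_zero n) quartic_zero 1 1 le_rfl
  have h2 := iterate_eq_zero (truncGen_zero n) (firstDer_zero (truncGen_zero n)) 1 1 le_rfl
  rw [transformed_truncGen hn, obstruction, h1, Finset.sum_range_one, h2, smul_zero, add_zero,
    add_zero]
  rfl

/-! ### Symmetrization -/

/-- The mean of the coefficients over the permutations of the entries. -/
def symmCoef {k : ℕ} (c : (Fin k → Mode) → ℂ) : (Fin k → Mode) → ℂ :=
  ((k.factorial : ℝ)⁻¹) • ∑ φ : Equiv.Perm (Fin k), fun j => c (j ∘ φ)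

lemma symmCoef_apply {k : ℕ} (c : (Fin k → Mode) → ℂ) (j : Fin k → Mode) :
    symmCoef c j = ((k.factorial : ℝ)⁻¹) • ∑ φ : Equiv.Perm (Fin k), c (j ∘ φ) := by
  simp [symmCoef]

lemma symmCoef_comp_perm {k : ℕ} (c : (Fin k → Mode) → ℂ) (j : Fin k → Mode)
    (ψ : Equiv.Perm (Fin k)) : symmCoef c (j ∘ ψ) = symmCoef c j := by
  rw [symmCoef_apply, symmCoef_apply, ← Equiv.sum_comp (Equiv.mulLeft ψ) (fun φ : Equiv.Perm (Fin k) => c (j ∘ φ))]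
  rfl

lemma exists_of_symmCoef_ne {k : ℕ} {c : (Fin k → Mode) → ℂ} {j : Fin k → Mode}
    (h : symmCoef c j ≠ 0) : ∃ φ : Equiv.Perm (Fin k), c (j ∘ φ) ≠ 0 := by
  by_contra! h'
  exact h (by simp [symmCoef_apply, h'])

lemma norm_symmCoef_le {k : ℕ} {c : (Fin k → Mode) → ℂ} {B : ℝ} (hB : ∀ j, ‖c j‖ ≤ B)
    (j : Fin k → Mode) : ‖symmCoef c j‖ ≤ B := by
  have hfac : (0 : ℝ) < k.factorial := by exact_mod_cast k.factorial_pos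
  have h : ‖∑ φ : Equiv.Perm (Fin k), c (j ∘ φ)‖ ≤ k.factorial * B := by
    refine (norm_sum_le_of_le Finset.univ fun (φ : Equiv.Perm (Fin k)) _ => hB (j ∘ φ)).trans (le_of_eq ?_)
    rw [Finset.sum_const, Finset.card_univ, Fintype.card_perm, Fintype.card_fin, nsmul_eq_mul]
  rw [symmCoef_apply, norm_smul, Real.norm_eq_abs, abs_of_pos (inv_pos.2 hfac)]
  calc _ ≤ (k.factorial : ℝ)⁻¹ * (k.factorial * B) := by gcongr
    _ = B := by field_simp

lemma momentumSupported_symmCoef {k : ℕ} {c : (Fin k → Mode) → ℂ} (hc : MomentumSupported c) :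
    MomentumSupported (symmCoef c) := by
  intro j hj
  obtain ⟨φ, hφ⟩ := exists_of_symmCoef_ne hj
  have h := hc _ hφ
  simp only [charge, momentum, Function.comp_apply] at h ⊢
  rwa [Equiv.sum_comp φ (fun α => ((j α).1 : ℤ)), Equiv.sum_comp φ (fun α => ((j α).1 : ℤ) * (j α).2)] at h

lemma divisor_eq_zero_of_symmCoef_ne {k : ℕ} {c : (Fin k → Mode) → ℂ}
    (hc : ∀ j, c j ≠ 0 → divisor j = 0) {j : Fin k → Mode} (hj : symmCoef c j ≠ 0) :
    divisor j = 0 := by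
  obtain ⟨φ, hφ⟩ := exists_of_symmCoef_ne hj
  have h := hc _ hφ
  simp only [divisor, Function.comp_apply] at h ⊢
  rwa [Equiv.sum_comp φ (fun α => ((j α).1 : ℤ) * (j α).2 ^ 2)] at h

lemma realCoeffs_symmCoef {k : ℕ} {c : (Fin k → Mode) → ℂ} (hc : RealCoeffs c) :
    RealCoeffs (symmCoef c) := by
  intro j
  rw [symmCoef_apply, symmCoef_apply, Complex.real_smul, Complex.real_smul, map_mul,
    Complex.conj_ofReal, map_sum]
  congr 1
  exact Finset.sum_congr rfl fun φ _ => hc _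

/-- Monomials commute, so averaging coefficients over permutations does not change the function. The
recursion can thus ignore symmetry and restore it at the end. -/
lemma Gevrey.polyEval_symmCoef {σ θ : ℝ} (hσ : 0 < σ) {k : ℕ} {c : (Fin k → Mode) → ℂ}
    (hc : BddCoef c) (z : Gevrey σ θ) : polyEval (symmCoef c) z = polyEval c z := by
  obtain ⟨B, hB⟩ := hc
  have hfac : (k.factorial : ℝ) ≠ 0 := by exact_mod_cast k.factorial_ne_zero
  have h : ∀ φ : Equiv.Perm (Fin k), polyEval (fun j => c (j ∘ φ)) z = polyEval c z := by
    intro φ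
    rw [polyEval, polyEval, ← (Equiv.arrowCongr φ.symm (Equiv.refl Mode)).tsum_eq
      (fun j => c j * mono z j)]
    refine tsum_congr fun j => ?_
    congr 1
    exact (Equiv.prod_comp φ (fun α => sc z (j α))).symm
  rw [symmCoef, polyEval_smul, polyEval_sum hσ _ fun φ _ => ⟨B, fun j => hB _⟩]
  simp only [h]
  rw [Finset.sum_const, Finset.card_univ, Fintype.card_perm, Fintype.card_fin,
    ← Nat.cast_smul_eq_nsmul ℝ, smul_smul, inv_mul_cancel₀ hfac, one_smul]

/-- The symmetric polynomial with given coefficients. -/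
def HPoly.ofCoef {m : ℕ} (c : (Fin (2 * m) → Mode) → ℂ) (hs : MomentumSupported c)
    (hr : RealCoeffs c) (hb : BddCoef c) : HPoly m where
  coeff := symmCoef c
  support j hj := by
    by_contra h
    exact hj (momentumSupported_symmCoef hs j h)
  reality j := realCoeffs_symmCoef hr j
  symmetry j φ := symmCoef_comp_perm c j φ
  bounded := by
    obtain ⟨B, hB⟩ := hb
    exact ⟨B, by rintro _ ⟨j, rfl⟩; exact norm_symmCoef_le hB j⟩

lemma HPoly.eval_ofCoef {σ θ : ℝ} (hσ : 0 < σ) {m : ℕ} {c : (Fin (2 * m) → Mode) → ℂ}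
    (hs : MomentumSupported c) (hr : RealCoeffs c) (hb : BddCoef c) (z : Gevrey σ θ) :
    (HPoly.ofCoef c hs hr hb).eval z = Gevrey.polyEval c z := by
  rw [← Gevrey.polyEval_symmCoef hσ hb]
  exact tsum_subtype_eq_of_support_subset (f := fun j => symmCoef c j * Gevrey.mono z j)
    fun j hj => momentumSupported_symmCoef hs j (left_ne_zero_of_mul hj)

lemma HPoly.supNorm_ofCoef_le {m : ℕ} {c : (Fin (2 * m) → Mode) → ℂ}
    (hs : MomentumSupported c) (hr : RealCoeffs c) (hb : BddCoef c) {B : ℝ}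
    (hB : ∀ j, ‖c j‖ ≤ B) : (HPoly.ofCoef c hs hr hb).supNorm ≤ B :=
  Real.iSup_le (fun j => norm_symmCoef_le hB j.1) (Gevrey.bound_nonneg hB)

lemma HPoly.isResonant_ofCoef {m : ℕ} {c : (Fin (2 * m) → Mode) → ℂ}
    (hs : MomentumSupported c) (hr : RealCoeffs c) (hb : BddCoef c)
    (hd : ∀ j, c j ≠ 0 → divisor j = 0) : (HPoly.ofCoef c hs hr hb).IsResonant := fun j hj =>
  ⟨momentumSupported_symmCoef hs j hj, divisor_eq_zero_of_symmCoef_ne hd hj⟩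

/-! ### The normal form polynomials -/

/-- The coefficients of the component of degree `2 m` of the transformed Hamiltonian. -/
def normalCoef (n : ℕ) : (m : ℕ) → (Fin (2 * m) → Mode) → ℂ
  | 0 => 0
  | p + 1 => transformed (truncGen n) p

lemma good_normalCoef (n m : ℕ) :
    MomentumSupported (normalCoef n m) ∧ RealCoeffs (normalCoef n m) := by
  match m with
  | 0 => exact ⟨momentumSupported_zero, realCoeffs_zero⟩
  | p + 1 => exact good_transformed (good_truncGen n) p

lemma bddCoef_normalCoef {n : ℕ} (hn : 1 ≤ n) (m : ℕ) : BddCoef (normalCoef n m) := by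
  match m with
  | 0 => exact bddCoef_zero
  | p + 1 => exact ⟨_, norm_transformed_le hn p⟩

/-- The component of degree `2 m` of the normal form. -/
def normalPoly {n : ℕ} (hn : 1 ≤ n) (m : ℕ) : HPoly m :=
  HPoly.ofCoef (normalCoef n m) (good_normalCoef n m).1 (good_normalCoef n m).2
    (bddCoef_normalCoef hn m)

lemma normalPoly_eval {σ θ : ℝ} (hσ : 0 < σ) {n : ℕ} (hn : 1 ≤ n) (p : ℕ) (z : Gevrey σ θ) :
    (normalPoly hn (p + 1)).eval z = Gevrey.polyEval (transformed (truncGen n) p) z :=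
  HPoly.eval_ofCoef hσ _ _ _ z

lemma normalPoly_isResonant {n : ℕ} (hn : 1 ≤ n) {p : ℕ} (hp : p ≤ n) :
    (normalPoly hn (p + 1)).IsResonant := by
  refine HPoly.isResonant_ofCoef _ _ _ fun j hj => ?_
  have h : normalCoef n (p + 1) = resPart (obstruction (truncGen n) p) := transformed_truncGen hp
  rw [h] at hj
  exact (ite_ne_right_iff.1 hj).1

lemma normalPoly_supNorm_le {n : ℕ} (hn : 1 ≤ n) {p : ℕ} (hp1 : 1 ≤ p) (hp : p ≤ n) :
    (normalPoly hn (p + 1)).supNorm ≤ (64 * ((p : ℝ) + 1) ^ 2) ^ (p - 1) := by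
  refine HPoly.supNorm_ofCoef_le _ _ _ fun j => ?_
  have h : normalCoef n (p + 1) = resPart (obstruction (truncGen n) p) := transformed_truncGen hp
  rw [h]
  exact (norm_resPart_le _ _).trans (norm_obstruction_le hp1 hp j)

end

noncomputable section

/-! ### The normal form theorem -/

namespace Gevrey

variable {σ θ : ℝ}

/-- The time-one map of a field of the size of the generator. -/
lemma exists_flow (hσ : 0 < σ) (hθ : 0 < θ) (hθ1 : θ < 1) (n : ℕ) {S : ℝ}
    (hS : 64 * ((n : ℝ) + 1) ^ 2 * S ^ 2 ≤ 1 / 8) {X : Gevrey σ θ → Gevrey σ θ}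
    {Xh : C(unitInterval, Gevrey σ θ) → C(unitInterval, Gevrey σ θ)} (h : SmallField X Xh S)
    (hX : ∀ w, ‖X w‖ = ‖genField n w‖)
    (hω : ∀ y u w, omega hσ (fderiv ℝ X y u) w + omega hσ u (fderiv ℝ X y w) = 0) :
    ∃ Γ : Gevrey σ θ → C(unitInterval, Gevrey σ θ),
      (∀ x ∈ Metric.ball (0 : Gevrey σ θ) (S / 2),
        Γ x ∈ Metric.ball (0 : C(unitInterval, Gevrey σ θ)) S ∧
        Γ x - primitiveL (Xh (Γ x)) = ContinuousMap.const unitInterval x) ∧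
      ContDiffOn ℝ ∞ (fun x => Γ x 1) (Metric.ball 0 (S / 2)) ∧
      IsSymplecticOn (fun x => Γ x 1) (Metric.ball 0 (S / 2)) ∧
      ∀ x ∈ Metric.ball (0 : Gevrey σ θ) (S / 2),
        ‖Γ x 1‖ ≤ 2 * ‖x‖ ∧ ‖Γ x 1 - x‖ ≤ 128 * ‖x‖ ^ 3 := by
  obtain ⟨Γ, hΓ, hΓ'⟩ := h.exists_curve
  refine ⟨Γ, hΓ', ?_, fun x hx v w => ?_, fun x hx => ?_⟩
  · exact (ContinuousMap.evalCLM ℝ (1 : unitInterval)).contDiff.comp_contDiffOn hΓ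
  · rw [← omega_eq_l2Inner hσ, ← omega_eq_l2Inner hσ]
    exact h.bilinear_invariant Metric.isOpen_ball hΓ (fun y hy => (hΓ' y hy).2) hx _ hω v w
  · obtain ⟨hb, he⟩ := hΓ' x hx
    have h2 := h.norm_le_two_mul hb he
    have hle : ∀ t, ‖Γ x t‖ ≤ 2 * ‖x‖ := fun t => ((Γ x).norm_coe_le_norm t).trans h2
    refine ⟨hle 1, h.norm_sub_le_of_bound (by positivity) (fun t => ?_) he 1⟩
    have hbt := mem_ball_zero_iff.1 (curve_mem_ball hb t)
    rw [hX]
    refine (norm_genField_le hσ hθ hθ1 n ((mul_le_mul_of_nonneg_left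
      (pow_le_pow_left₀ (norm_nonneg _) hbt.le 2) (by positivity)).trans hS)).trans ?_
    calc _ ≤ 16 * (2 * ‖x‖) ^ 3 := by gcongr; exact hle t
      _ = _ := by ring

lemma famEval_transformed (hσ : 0 < σ) (hθ : 0 < θ) (hθ1 : θ < 1) {n : ℕ} (hn : 1 ≤ n)
    {z : Gevrey σ θ} (hz : 64 * ((n : ℝ) + 1) ^ 2 * ‖z‖ ^ 2 ≤ 1 / 64) :
    famEval (transformed (truncGen n)) z
      = ∑ p ∈ Finset.range (n + 1), polyEval (transformed (truncGen n) p) z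
        + (remainder n z : ℂ) := by
  rw [famEval, ofReal_remainder, ← (summable_famEval_transformed hσ hθ hθ1 hn hz).sum_add_tsum_nat_add
    (n + 1)]
  exact congrArg _ (tsum_congr fun i => by rw [Nat.add_comm i (n + 1)])

lemma sum_transformed (hσ : 0 < σ) {n : ℕ} (hn : 1 ≤ n) (z : Gevrey σ θ) :
    ∑ p ∈ Finset.range (n + 1), polyEval (transformed (truncGen n) p) z
      = (NLSP.L4 z : ℂ) + ∑ m ∈ Finset.Icc 3 (n + 1), (normalPoly hn m).eval z := by
  obtain ⟨k, rfl⟩ : ∃ k, n = k + 1 := ⟨n - 1, by omega⟩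
  have h0 : transformed (truncGen (k + 1)) 0 = 0 := by
    simp [transformed, firstDer_zero (truncGen_zero _), quartic_zero]
  rw [Finset.sum_range_succ', Finset.sum_range_succ', h0, polyEval_zero, add_zero,
    transformed_one hn, polyEval_resPart_quarticCoef hσ, add_comm,
    show Finset.Icc 3 (k + 1 + 1) = Finset.Ico 3 (k + 3) by ext; simp; omega,
    Finset.sum_Ico_eq_sum_range, Nat.add_sub_cancel]
  congr 1
  refine Finset.sum_congr rfl fun i _ => ?_
  rw [show 3 + i = i + 1 + 1 + 1 by ring]
  exact (normalPoly_eval hσ hn _ z).symm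

end Gevrey

open Gevrey in
theorem proposition3p1 :
    ∃ C : ℝ, 2 ^ 8 ≤ C ∧
      ∀ (σ θ : ℝ), 0 < σ → 0 < θ → θ < 1 → ∀ r : ℕ, 2 ≤ r →
      ∀ ρ : ℝ, ρ = 1 / (8 * C * (r : ℝ)) →
      ∃ (φ₀ φ₁ : Gevrey σ θ → Gevrey σ θ) (K : (m : ℕ) → HPoly m) (R : Gevrey σ θ → ℝ),
        -- smooth symplectic maps
        ContDiffOn ℝ ∞ φ₀ (Metric.ball 0 ρ) ∧
        ContDiffOn ℝ ∞ φ₁ (Metric.ball 0 (2 * ρ)) ∧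
        Gevrey.IsSymplecticOn φ₀ (Metric.ball 0 ρ) ∧
        Gevrey.IsSymplecticOn φ₁ (Metric.ball 0 (2 * ρ)) ∧
        -- commuting diagram
        Set.MapsTo φ₀ (Metric.ball 0 ρ) (Metric.ball 0 (2 * ρ)) ∧
        (∀ z ∈ Metric.ball (0 : Gevrey σ θ) ρ, φ₁ (φ₀ z) = z) ∧
        -- closeness to the identity
        (∀ z ∈ Metric.ball (0 : Gevrey σ θ) ρ, ‖φ₀ z - z‖ ≤ C ^ 2 * ‖z‖ ^ 3) ∧
        (∀ z ∈ Metric.ball (0 : Gevrey σ θ) (2 * ρ), ‖φ₁ z - z‖ ≤ C ^ 2 * ‖z‖ ^ 3) ∧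
        -- normal form decomposition
        (∀ z ∈ Metric.ball (0 : Gevrey σ θ) (2 * ρ),
          NLSP.H (φ₁ z) = (NLSP.L2 z : ℂ) + (NLSP.L4 z : ℂ)
            + ∑ m ∈ Finset.Icc 3 r, (K m).eval z + (R z : ℂ)) ∧
        -- resonant polynomials, the quartic one being `L₄`
        (∀ z : Gevrey σ θ, (K 2).eval z = (NLSP.L4 z : ℂ)) ∧
        (∀ m : ℕ, 2 ≤ m → m ≤ r →
          (K m).IsResonant ∧ (K m).supNorm ≤ C ^ (2 * m - 3) * (m : ℝ) ^ (2 * (m - 2))) ∧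
        -- smooth remainder, whose vector field takes values in the Gevrey space
        ContDiffOn ℝ ∞ R (Metric.ball 0 (2 * ρ)) ∧
        (∀ z ∈ Metric.ball (0 : Gevrey σ θ) (2 * ρ), ∃ X : Gevrey σ θ,
          (∀ a : ℤ, X a = Gevrey.hamVF (fun y => (R y : ℂ)) z a) ∧
          ‖X‖ ≤ C ^ (4 * r - 1) * (r : ℝ) ^ (2 * r) * ‖z‖ ^ (2 * r + 1)) := by
  refine ⟨256, by norm_num, fun σ θ hσ hθ hθ1 r hr ρ hρ => ?_⟩
  obtain ⟨n, rfl⟩ : ∃ n, r = n + 1 := ⟨r - 1, by omega⟩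
  have hn : 1 ≤ n := by omega
  have hn1 : (1 : ℝ) ≤ (n : ℝ) + 1 := by linarith [(Nat.cast_nonneg n : (0 : ℝ) ≤ n)]
  push_cast at hρ
  have hρ0 : 0 < ρ := by rw [hρ]; positivity
  -- Curves live in the ball of radius `4ρ`, so initial points fill `2ρ`. The value `1/4096` lies
  -- below both thresholds, `1/8` for the field and `1/64` for the series.
  have hy : 64 * ((n : ℝ) + 1) ^ 2 * (4 * ρ) ^ 2 = 1 / 4096 := by
    rw [hρ]
    field_simp
    norm_num
  have hρ1 : 4 * ρ ≤ 1 / 512 := by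
    rw [hρ, ← mul_div_assoc, div_le_div_iff₀ (by positivity) (by norm_num)]
    linarith
  have hsmall : ∀ s, 0 ≤ s → s ≤ 4 * ρ → 64 * ((n : ℝ) + 1) ^ 2 * s ^ 2 ≤ 1 / 64 := fun s h0 hs =>
    (mul_le_mul_of_nonneg_left (pow_le_pow_left₀ h0 hs 2) (by positivity)).trans
      (hy.le.trans (by norm_num))
  have hball : 2 * ρ = 4 * ρ / 2 := by ring
  obtain ⟨Xh, hX⟩ := exists_smallField hσ hθ hθ1 n (S := 4 * ρ) (by positivity)
    (hy.le.trans (by norm_num)) (by nlinarith)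
  have hω := omega_fderiv_genField hσ hθ hθ1 n
  obtain ⟨Γ, hΓ, hs, hsymp, hclose⟩ := exists_flow hσ hθ hθ1 n (hy.le.trans (by norm_num)) hX
    (fun _ => rfl) hω
  obtain ⟨Γ', hΓ', hs', hsymp', hclose'⟩ := exists_flow hσ hθ hθ1 n (hy.le.trans (by norm_num))
    hX.neg (fun _ => norm_neg _) (fun y u w => by
      have e : fderiv ℝ (fun x : Gevrey σ θ => -genField n x) y = -fderiv ℝ (genField n) y :=
        fderiv_fun_neg
      have := hω y u w
      simp only [e, _root_.neg_apply, map_neg]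
      linarith)
  rw [← hball] at hΓ hs hsymp hclose hΓ' hs' hsymp' hclose'
  have hsub : Metric.ball (0 : Gevrey σ θ) ρ ⊆ Metric.ball 0 (2 * ρ) :=
    Metric.ball_subset_ball (by linarith)
  -- The backward flow is solved on the whole ball of radius `2ρ`; restricted to `ρ`, it at most
  -- doubles norms and lands where the forward flow is defined.
  have hmaps : Set.MapsTo (fun x => Γ' x 1) (Metric.ball 0 ρ) (Metric.ball 0 (2 * ρ)) := by
    intro z hz
    have h1 := (hclose' z (hsub hz)).1
    rw [mem_ball_zero_iff] at hz ⊢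
    linarith
  have hham : ∀ z ∈ Metric.ball (0 : Gevrey σ θ) (2 * ρ),
      polyEval l2Coef (Γ z 1) + polyEval quarticCoef (Γ z 1) = polyEval l2Coef z
        + (∑ p ∈ Finset.range (n + 1), polyEval (transformed (truncGen n) p) z
          + (remainder n z : ℂ)) := by
    intro z hz
    obtain ⟨hb, he⟩ := hΓ z hz
    have e1 : extendCurve (Γ z) 1 = Γ z 1 := extendCurve_of_mem _ ⟨zero_le_one, le_rfl⟩
    have e0 : extendCurve (Γ z) 0 = z := by
      have h0 := congrArg (fun γ : C(unitInterval, Gevrey σ θ) => γ 0) he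
      simp only [ContinuousMap.sub_apply, primitiveL_apply, ContinuousMap.const_apply,
        Set.Icc.coe_zero, intervalIntegral.integral_same, sub_zero] at h0
      rw [extendCurve_of_mem _ ⟨le_rfl, zero_le_one⟩]
      exact h0
    have h := hamiltonian_flow hσ hθ hθ1 hn (η := extendCurve (Γ z))
      (fun t ht => hX.hasDerivWithinAt he ht) (fun t ht => by
        rw [extendCurve_of_mem _ ht]
        exact hsmall _ (norm_nonneg _) (mem_ball_zero_iff.1 (curve_mem_ball hb _)).le)
    rw [e1, e0] at h
    rw [h, famEval_transformed hσ hθ hθ1 hn]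
    rw [mem_ball_zero_iff] at hz
    exact hsmall _ (norm_nonneg _) (by linarith)
  refine ⟨fun z => Γ' z 1, fun z => Γ z 1, normalPoly hn, remainder n, hs'.mono hsub, hs,
    fun z hz => hsymp' z (hsub hz), hsymp, hmaps, fun z hz => ?_, fun z hz => ?_, fun z hz => ?_,
    fun z hz => ?_, fun z => ?_, fun m hm hmr => ?_, ?_, fun z hz => ?_⟩
  · obtain ⟨hb', he'⟩ := hΓ' z (hsub hz)
    obtain ⟨hb, he⟩ := hΓ _ (hmaps hz)
    exact hX.reverse hX.neg hb' hb he' he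
  · refine ((hclose' z (hsub hz)).2).trans ?_
    gcongr
    norm_num
  · refine ((hclose z hz).2).trans ?_
    gcongr
    norm_num
  · have h := hham z hz
    rw [sum_transformed hσ hn, polyEval_l2Coef, polyEval_l2Coef, polyEval_quarticCoef hσ] at h
    rw [NLSP.H, h]
    ring
  · rw [normalPoly_eval hσ hn 1, transformed_one hn, polyEval_resPart_quarticCoef hσ]
  · obtain ⟨q, rfl⟩ : ∃ q, m = q + 1 + 1 := ⟨m - 2, by omega⟩
    refine ⟨normalPoly_isResonant hn (by omega), ?_⟩
    refine (normalPoly_supNorm_le hn (by omega) (by omega)).trans ?_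
    rw [Nat.add_sub_cancel, show q + 1 + 1 - 2 = q by omega, mul_pow, ← pow_mul]
    push_cast
    refine mul_le_mul_of_nonneg_right ?_ (by positivity)
    calc (64 : ℝ) ^ q ≤ 256 ^ q := by gcongr; norm_num
      _ ≤ _ := pow_le_pow_right₀ (by norm_num) (by omega)
  -- Smoothness of the remainder is read off from the identity for `H ∘ φ₁`: every other term is
  -- smooth, so no series of higher derivatives is needed.
  · obtain ⟨B, hB⟩ := exists_l2Coef_bound (σ := σ) (θ := θ) hσ hθ
    have hL := contDiff_polyEval hB
    have hQ := contDiff_polyEval (weighted_bound (σ := σ) (θ := θ) hσ norm_quarticCoef_le)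
    have hT : ContDiff ℝ ∞ fun z : Gevrey σ θ =>
        ∑ p ∈ Finset.range (n + 1), polyEval (transformed (truncGen n) p) z :=
      ContDiff.sum fun p _ => contDiff_polyEval (weighted_bound hσ (norm_transformed_le hn p))
    refine ContDiffOn.congr (Complex.reCLM.contDiff.comp_contDiffOn
      ((((hL.comp_contDiffOn hs).add (hQ.comp_contDiffOn hs)).sub hL.contDiffOn).sub
        hT.contDiffOn)) fun z hz => ?_
    have h := hham z hz
    simp only [Function.comp_apply, Complex.reCLM_apply]
    rw [h, ← Complex.ofReal_re (remainder n z)]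
    refine congrArg Complex.re ?_
    rw [Complex.ofReal_re]
    ring
  · obtain ⟨X, hXa, hXn⟩ := exists_remainder_field hσ hθ hθ1 hn
      (hsmall (2 * ρ) (by linarith) (by linarith)) hz
    refine ⟨X, hXa, hXn.trans ?_⟩
    push_cast
    have h1 : (64 * ((n : ℝ) + 1) ^ 2)⁻¹ ≤ 1 / 64 := by
      rw [one_div]
      exact inv_anti₀ (by norm_num) (by nlinarith)
    -- Here `768 = 12 · 64` is the ratio in the bound for the field of the remainder.
    have h2 : (2 : ℝ) * 768 ^ (n + 1) ≤ 256 ^ (4 * (n + 1) - 1) := by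
      calc (2 : ℝ) * 768 ^ (n + 1) ≤ 256 * (256 ^ 2) ^ (n + 1) := by gcongr <;> norm_num
        _ = 256 ^ (2 * (n + 1) + 1) := by rw [← pow_mul, pow_succ]; ring
        _ ≤ _ := pow_le_pow_right₀ (by norm_num) (by omega)
    calc _ ≤ 104 * (1 / 64) * ‖z‖ * (12 * (64 * ((n : ℝ) + 1) ^ 2 * ‖z‖ ^ 2)) ^ (n + 1) := by gcongr
      _ = 104 / 64 * 768 ^ (n + 1) * ((n : ℝ) + 1) ^ (2 * (n + 1)) * ‖z‖ ^ (2 * (n + 1) + 1) := by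
          rw [show 12 * (64 * ((n : ℝ) + 1) ^ 2 * ‖z‖ ^ 2)
            = 768 * ((n : ℝ) + 1) ^ 2 * ‖z‖ ^ 2 by ring, mul_pow, mul_pow, ← pow_mul, ← pow_mul,
            pow_succ ‖z‖ (2 * (n + 1))]
          ring
      _ ≤ 2 * 768 ^ (n + 1) * ((n : ℝ) + 1) ^ (2 * (n + 1)) * ‖z‖ ^ (2 * (n + 1) + 1) := by
          gcongr
          norm_num
      _ ≤ _ := by gcongr

end
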